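/- **Theorem (existence and uniqueness of eternal acceleration).** Let $m,n>1$ be integers with $m+n\ge 9$ and $(m,n)\neq(2,7)$. Let $(M,g)$ and $(N,h)$ be nonempty smooth Riemannian manifolds of dimensions $m$ and $n$ with $\mathrm{Ric}_g=-(m+n-1)\,g$ and $\mathrm{Ric}_h=-(m+n-1)\,h$. Consider pairs of smooth positive functions $a,b$ on an open interval $I$ such that $-dt^2+a(t)^2g+b(t)^2h$ solves the vacuum Einstein equations $\mathrm{Ric}=0$ on $I\times M\times N$ and cannot be extended to a solution of this form on a larger interval. To such a solution associate its dimensional reduction: the time $\bar t$ (ranging over an interval $J$) with $d\bar t/dt=b^{n/(m-1)}$, the scale factor $\bar a=a\,b^{n/(m-1)}$ as a function of $\bar t$, the $(1+m)$-dimensional metric $\gamma=b^{2n/(m-1)}(-dt^2+a^2g)=-d\bar t^2+\bar a^2 g$ on $J\times M$, and the scalar field $$\varphi=-\sqrt{\frac{(m-1)(m+n-1)}{8\pi n}}\;\phi ,\qquad e^{\phi}=b^{-n/(m-1)} .$$ There is exactly one dimensionally reduced cosmology $(\gamma,\varphi)$ with $d^2\bar a/d\bar t^2>0$ for all $\bar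 t\in J$, up to rescaling by a constant, time translation and time reversal. More precisely: * (Existence.) There is an inextendible vacuum solution $(a,b)$ on $I=(0,\infty)$ whose reduction satisfies $d^2\bar a/d\bar t^2>0$ for all $\bar t\in J$; moreover $(\gamma,\varphi)$ satisfies the Einstein equations $\mathrm{Ric}_\gamma-\tfrac12\mathrm{Scal}_\gamma\gamma=8\pi T$, $T_{\mu\nu}=\nabla_\mu\varphi\nabla_\nu\varphi-\big[\tfrac12\nabla^\sigma\varphi\nabla_\sigma\varphi+V(\varphi)\big]\gamma_{\mu\nu}$, with $$V(\varphi)=\frac{1}{8\pi}\,\frac{n(m+n-1)}{2}\exp\Big[-\sqrt{8\pi}\,\frac{2}{\sqrt{m-1}}\sqrt{\frac{m+n-1}{n}}\;\varphi\Big].$$ With $p=-\dot a/a$, $q=-\dot b/b$, $H=mp+nq$, the scale invariant variables $(A,B,P,Q)=\big(-\tfrac1{aH},-\tfrac1{bH},\tfrac pH,\tfrac qH\big)$ of this solution converge to $F_*=\big(\tfrac1{m+n},\tfrac1{m+n},\tfrac1{m+n},\tfrac1{m+n}\big)$ as $t\to\infty$ and to $F_B=\Big(\sqrt{\tfrac{m-1}{m^2(m+n-1)}},\,0,\,\tfrac1m,\,0\Big)$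 as $t\searrow0$. * (Uniqueness.) If $(J',\bar a',\varphi')$ is the reduction of any inextendible vacuum solution of this form for the same $(M,g)$, $(N,h)$, and $d^2\bar a'/d\bar t^2>0$ on all of $J'$, then there are real constants $\mu\neq0$, $c$ and $k$ with $J'=\mu J+c$, $\bar a'(\mu s+c)=|\mu|\,\bar a(s)$ and $\varphi'(\mu s+c)=\varphi(s)+k$ for all $s\in J$. -/

import Mathlib

open Set Filter Bundle
open scoped Topology Manifold ContDiff

noncomputable section

namespace WarpedCosmology

/-! ### Curvature of a (pseudo-)Riemannian metric in coordinates -/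

section Coordinates

variable {ι : Type*} [Fintype ι] [DecidableEq ι]

/-- The partial derivative `∂ₖ f` at `x`. -/
def pderiv (k : ι) (f : (ι → ℝ) → ℝ) (x : ι → ℝ) : ℝ :=
  deriv (fun s : ℝ => f (Function.update x k s)) (x k)

/-- The Christoffel symbols `Γᵏᵢⱼ` of the metric with components `G`. -/
def christoffel (G : (ι → ℝ) → Matrix ι ι ℝ) (k i j : ι) (x : ι → ℝ) : ℝ :=
  (1 / 2) * ∑ l, (G x)⁻¹ k l *
    (pderiv i (fun y => G y j l) x + pderiv j (fun y => G y i l) x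
      - pderiv l (fun y => G y i j) x)

/-- The components of the Ricci tensor,
`Rᵢⱼ = ∂ₖΓᵏᵢⱼ - ∂ⱼΓᵏᵢₖ + ΓᵏₖₗΓˡᵢⱼ - ΓᵏⱼₗΓˡᵢₖ`, of the metric with components `G`. -/
def ricci (G : (ι → ℝ) → Matrix ι ι ℝ) (x : ι → ℝ) : Matrix ι ι ℝ :=
  Matrix.of fun i j =>
    (∑ k, pderiv k (christoffel G k i j) x) - (∑ k, pderiv j (christoffel G k i k) x)
      + (∑ k, ∑ l, christoffel G k k l x * christoffel G l i j x)
      - (∑ k, ∑ l, christoffel G k j l x * christoffel G l i k x)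

/-- The scalar curvature `Gⁱʲ Rᵢⱼ`. -/
def scalarCurvature (G : (ι → ℝ) → Matrix ι ι ℝ) (x : ι → ℝ) : ℝ :=
  ∑ i, ∑ j, (G x)⁻¹ i j * ricci G x i j

end Coordinates

/-! ### Einstein manifolds -/

section Manifold

variable {d : ℕ} {M : Type*} [TopologicalSpace M]
  [ChartedSpace (EuclideanSpace ℝ (Fin d)) M]
  [IsManifold 𝓘(ℝ, EuclideanSpace ℝ (Fin d)) ∞ M]

/-- Smooth Riemannian metrics on the `d`-dimensional smooth manifold `M`. -/
abbrev SmoothMetric (d : ℕ) (M : Type*) [TopologicalSpace M]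
    [ChartedSpace (EuclideanSpace ℝ (Fin d)) M]
    [IsManifold 𝓘(ℝ, EuclideanSpace ℝ (Fin d)) ∞ M] :=
  ContMDiffRiemannianMetric 𝓘(ℝ, EuclideanSpace ℝ (Fin d)) ∞ (EuclideanSpace ℝ (Fin d))
    (fun x : M => TangentSpace 𝓘(ℝ, EuclideanSpace ℝ (Fin d)) x)

/-- The `i`-th coordinate vector field of the chart `e`, at the point with coordinates `v`. -/
def coordVector (e : OpenPartialHomeomorph M (EuclideanSpace ℝ (Fin d))) (i : Fin d)
    (v : Fin d → ℝ) :
    TangentSpace 𝓘(ℝ, EuclideanSpace ℝ (Fin d)) (e.symm (WithLp.toLp 2 v)) :=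
  mfderiv 𝓘(ℝ, EuclideanSpace ℝ (Fin d)) 𝓘(ℝ, EuclideanSpace ℝ (Fin d)) e.symm
    (WithLp.toLp 2 v) (EuclideanSpace.single i (1 : ℝ))

/-- The components `gᵢⱼ` of the metric `g` in the chart `e`, as functions of the coordinates. -/
def chartMetric (g : SmoothMetric d M) (e : OpenPartialHomeomorph M (EuclideanSpace ℝ (Fin d)))
    (v : Fin d → ℝ) : Matrix (Fin d) (Fin d) ℝ :=
  Matrix.of fun i j =>
    g.inner (e.symm (WithLp.toLp 2 v)) (coordVector e i v) (coordVector e j v)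

/-- The Einstein condition `Ric_g = c g`. -/
def IsEinstein (g : SmoothMetric d M) (c : ℝ) : Prop :=
  ∀ e ∈ atlas (EuclideanSpace ℝ (Fin d)) M, ∀ v : Fin d → ℝ, WithLp.toLp 2 v ∈ e.target →
    ricci (chartMetric g e) v = c • chartMetric g e v

end Manifold

/-! ### Doubly warped vacuum spacetimes and their dimensional reduction -/

section Spacetime

variable {m n : ℕ}

/-- Components of `-dt² + a(t)² g + b(t)² h` in product coordinates `(t, x, y)`, where `G` and `K`
are the components of `g` and `h`. -/
def doublyWarped (a b : ℝ → ℝ) (G : (Fin m → ℝ) → Matrix (Fin m) (Fin m) ℝ)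
    (K : (Fin n → ℝ) → Matrix (Fin n) (Fin n) ℝ) (z : Unit ⊕ (Fin m ⊕ Fin n) → ℝ) :
    Matrix (Unit ⊕ (Fin m ⊕ Fin n)) (Unit ⊕ (Fin m ⊕ Fin n)) ℝ :=
  Matrix.fromBlocks (-1) 0 0
    (Matrix.fromBlocks (a (z (Sum.inl ())) ^ 2 • G (fun i => z (Sum.inr (Sum.inl i)))) 0 0
      (b (z (Sum.inl ())) ^ 2 • K (fun j => z (Sum.inr (Sum.inr j)))))

/-- Components of `-ds² + α(s)² g` in product coordinates `(s, x)`, where `G` are the components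
of `g`. -/
def singlyWarped (α : ℝ → ℝ) (G : (Fin m → ℝ) → Matrix (Fin m) (Fin m) ℝ)
    (z : Unit ⊕ Fin m → ℝ) : Matrix (Unit ⊕ Fin m) (Unit ⊕ Fin m) ℝ :=
  Matrix.fromBlocks (-1) 0 0 (α (z (Sum.inl ())) ^ 2 • G (fun i => z (Sum.inr i)))

variable {M : Type*} [TopologicalSpace M] [ChartedSpace (EuclideanSpace ℝ (Fin m)) M]
  [IsManifold 𝓘(ℝ, EuclideanSpace ℝ (Fin m)) ∞ M]
  {N : Type*} [TopologicalSpace N] [ChartedSpace (EuclideanSpace ℝ (Fin n)) N]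
  [IsManifold 𝓘(ℝ, EuclideanSpace ℝ (Fin n)) ∞ N]

/-- `-dt² + a(t)² g + b(t)² h` is a smooth solution of the vacuum Einstein equations on
`I × M × N`, where `I` is a nonempty open interval and `a, b > 0`. -/
structure IsVacuum (g : SmoothMetric m M) (h : SmoothMetric n N) (I : Set ℝ) (a b : ℝ → ℝ) :
    Prop where
  isOpen : IsOpen I
  nonempty : I.Nonempty
  ordConnected : I.OrdConnected
  smooth_a : ContDiffOn ℝ ∞ a I
  smooth_b : ContDiffOn ℝ ∞ b I
  pos_a : ∀ t ∈ I, 0 < a t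
  pos_b : ∀ t ∈ I, 0 < b t
  ricci_eq_zero : ∀ e ∈ atlas (EuclideanSpace ℝ (Fin m)) M,
    ∀ f ∈ atlas (EuclideanSpace ℝ (Fin n)) N, ∀ t ∈ I,
    ∀ x : Fin m → ℝ, WithLp.toLp 2 x ∈ e.target →
    ∀ y : Fin n → ℝ, WithLp.toLp 2 y ∈ f.target →
      ricci (doublyWarped a b (chartMetric g e) (chartMetric h f))
        (Sum.elim (fun _ => t) (Sum.elim x y)) = 0

/-- A vacuum solution that cannot be extended, within this class, to a larger time interval. -/
structure IsMaximalVacuum (g : SmoothMetric m M) (h : SmoothMetric n N) (I : Set ℝ)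
    (a b : ℝ → ℝ) : Prop where
  isVacuum : IsVacuum g h I a b
  maximal : ∀ (I' : Set ℝ) (a' b' : ℝ → ℝ), IsVacuum g h I' a' b' → I ⊆ I' →
    EqOn a' a I → EqOn b' b I → I' = I

/-- Dimensional reduction over the `n`-dimensional factor, in the Einstein frame: with
`e ^ ϕ = b ^ (-n / (m - 1))`, the metric `e ^ (-2ϕ) (-dt² + a² g)` takes the form `-ds² + α(s)² g`
on `J × M` in terms of the time `s = T(t)` with `ds/dt = b ^ (n / (m - 1))`, and the scalar
field is `Φ = -(8π)^(-1/2) n^(-1/2) (m-1)^(1/2) (m+n-1)^(1/2) ϕ`. -/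
def IsReduction (m n : ℕ) (I : Set ℝ) (a b : ℝ → ℝ) (J : Set ℝ) (α Φ : ℝ → ℝ) : Prop :=
  ∃ T : ℝ → ℝ, BijOn T I J ∧ ∀ t ∈ I,
    HasDerivAt T (b t ^ ((n : ℝ) / ((m : ℝ) - 1))) t ∧
    α (T t) = a t * b t ^ ((n : ℝ) / ((m : ℝ) - 1)) ∧
    Φ (T t) = -(√((m : ℝ) - 1) * √((m : ℝ) + n - 1) / (√(8 * Real.pi) * √(n : ℝ))) *
      Real.log (b t ^ (-((n : ℝ) / ((m : ℝ) - 1))))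

/-- The exponential potential of the scalar field. -/
def potential (m n : ℕ) (φ : ℝ) : ℝ :=
  (8 * Real.pi)⁻¹ * ((n : ℝ) * ((m : ℝ) + n - 1) / 2) *
    Real.exp (-(√(8 * Real.pi) * (2 / √((m : ℝ) - 1)) * √(((m : ℝ) + n - 1) / n) * φ))

/-- The components `T_μν = ∂_μΦ ∂_νΦ - (½ ∂^σΦ ∂_σΦ + V(Φ)) γ_μν` of the energy-momentum tensor
of the scalar field `Φ` with potential `V`, for the metric with components `γ`. -/
def energyMomentum {ι : Type*} [Fintype ι] [DecidableEq ι] (γ : (ι → ℝ) → Matrix ι ι ℝ)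
    (V : ℝ → ℝ) (Φ : (ι → ℝ) → ℝ) (z : ι → ℝ) : Matrix ι ι ℝ :=
  Matrix.of fun μ ν =>
    pderiv μ Φ z * pderiv ν Φ z
      - ((1 / 2) * (∑ σ, ∑ ρ, (γ z)⁻¹ σ ρ * pderiv σ Φ z * pderiv ρ Φ z) + V (Φ z)) * γ z μ ν

/-- `γ = -ds² + α(s)² g` and the scalar field `Φ(s)` satisfy the Einstein equations
`Ric_γ - ½ Scal_γ γ = 8π T` on `J × M`. -/
def IsEinsteinScalar (n : ℕ) (g : SmoothMetric m M) (J : Set ℝ) (α Φ : ℝ → ℝ) : Prop :=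
  ∀ e ∈ atlas (EuclideanSpace ℝ (Fin m)) M, ∀ s ∈ J,
    ∀ x : Fin m → ℝ, WithLp.toLp 2 x ∈ e.target →
      ricci (singlyWarped α (chartMetric g e)) (Sum.elim (fun _ => s) x)
        - ((1 / 2) * scalarCurvature (singlyWarped α (chartMetric g e))
            (Sum.elim (fun _ => s) x)) •
          singlyWarped α (chartMetric g e) (Sum.elim (fun _ => s) x) =
      (8 * Real.pi) • energyMomentum (singlyWarped α (chartMetric g e)) (potential m n)
        (fun z => Φ (z (Sum.inl ()))) (Sum.elim (fun _ => s) x)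

/-- Accelerated expansion at all times: `d²α/ds² > 0` on all of `J`. -/
def EternallyAccelerating (J : Set ℝ) (α : ℝ → ℝ) : Prop :=
  ∀ s ∈ J, 0 < deriv (deriv α) s

/-! ### Scale invariant variables -/

/-- The mean curvature `H = m p + n q`, where `p = -ȧ/a` and `q = -ḃ/b`. -/
def meanCurvature (m n : ℕ) (a b : ℝ → ℝ) (t : ℝ) : ℝ :=
  m * (-(deriv a t / a t)) + n * (-(deriv b t / b t))

/-- The scale invariant variables `(A, B, P, Q) = (-1/(aH), -1/(bH), p/H, q/H)`. -/
def scaleInvariant (m n : ℕ) (a b : ℝ → ℝ) (t : ℝ) : ℝ × ℝ × ℝ × ℝ :=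
  (-(1 / (a t * meanCurvature m n a b t)), -(1 / (b t * meanCurvature m n a b t)),
    -(deriv a t / a t) / meanCurvature m n a b t, -(deriv b t / b t) / meanCurvature m n a b t)

/-- The equilibrium point `F_*`, with `A = B = P = Q = 1/(m+n)`. -/
def pointFstar (m n : ℕ) : ℝ × ℝ × ℝ × ℝ :=
  (1 / ((m : ℝ) + n), 1 / ((m : ℝ) + n), 1 / ((m : ℝ) + n), 1 / ((m : ℝ) + n))

/-- The equilibrium point `F_B`, with `A² = (m-1)/(m²(m+n-1))`, `B = 0`, `P = 1/m`, `Q = 0`. -/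
def pointFB (m n : ℕ) : ℝ × ℝ × ℝ × ℝ :=
  (√(((m : ℝ) - 1) / ((m : ℝ) ^ 2 * ((m : ℝ) + n - 1))), 0, 1 / (m : ℝ), 0)

end Spacetime

end WarpedCosmology

end

/-! Both factors are Einstein, so the vacuum equations are ordinary differential equations for `a`
and `b` (`isVacuum_iff_isSol`). Modulo the Hamiltonian constraint, the acceleration of the reduced
scale factor is a positive multiple of `1 - ḃ²` (`IsSol.acceleration`). Eternal acceleration
therefore means `ḃ² < 1` at all times.

The constraint never lets the expansion vanish. After a time reversal the solution expands, and the
constraint can be solved for `ȧ` as a function of `z = a/b` and `β = ḃ`. Scale invariance leaves a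
planar system in `(z, β)`. An orbit that is a graph over `z` satisfies `z β' + m β = z · orbitRhs z
β`. This is singular at `z = 0`, but `E = z ^ m β` satisfies a Lipschitz equation, so exactly one
solution `B` is regular there. Its limit at `z = 0` is `F_B`; the point `z = β = 1` is `F_*`.

Existence: the orbit `B` has to reach `β = 1` exactly when `z = 1`, and must take infinite time to
do so. Put `N = m + n`. An orbit entering `(1, 1)` with `1 - β ~ σ (1 - z)` has `N σ²/m - (N - 3) σ
+ m = 0`, with discriminant `(N - 1)(N - 9)`, so `N ≥ 9` excludes spiralling. `exists_subsolution`
gives a barrier `L ≤ B` with `L 1 = 1`: the line `L = z`, or a cubic whose slope at `1` is `3m/N`.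
Hence `B → 1` and `ż = O(1 - z)`, so the time grows at least like `-log (1 - z)` (`time_unbounded`).

Uniqueness: the volume `a ^ m b ^ n` of a maximal expanding solution becomes arbitrarily small in
the past, since otherwise the solution stays in a compact set and extends
(`IsMaxSol.exists_volume_lt`). Together with `ḃ² < 1` this gives `ḃ > 0` (`IsFlow.trd_pos`), then `z
< 1` at some time (`IsFlow.exists_ratio_lt_one`), then `z → 0` in the past
(`IsFlow.exists_ratio_lt`). The difference `z ^ m (β - B z)` then tends to zero in the past, and a
Grönwall argument makes it vanish (`IsFlow.exists_eq_orbit`). So the solution lies on the regular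
orbit, and only scale and translation of time remain free. -/

noncomputable section

namespace WarpedCosmology

/-! ### Ricci curvature of product and warped metrics in coordinates -/

section Geometry

set_option linter.unusedSectionVars false

lemma pderiv_congr {ι : Type*} [DecidableEq ι] [Fintype ι] {f g : (ι → ℝ) → ℝ} {x : ι → ℝ} (k : ι)
    (h : f =ᶠ[𝓝 x] g) : pderiv k f x = pderiv k g x := by
  unfold pderiv
  apply Filter.EventuallyEq.deriv_eq
  have : Tendsto (fun s : ℝ => Function.update x k s) (𝓝 (x k)) (𝓝 x) := by
    have h1 : Continuous fun s : ℝ => Function.update x k s :=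
      continuous_const.update k continuous_id
    have := h1.tendsto (x k)
    rwa [Function.update_eq_self] at this
  exact this.eventually h

@[simp] lemma pderiv_const {ι : Type*} [DecidableEq ι] [Fintype ι] (k : ι) (c : ℝ) (x : ι → ℝ) :
    pderiv k (fun _ => c) x = 0 := by
  simp [pderiv]

lemma pderiv_const_mul {ι : Type*} [DecidableEq ι] [Fintype ι] (k : ι) (c : ℝ)
    (f : (ι → ℝ) → ℝ) (x : ι → ℝ) :
    pderiv k (fun y => c * f y) x = c * pderiv k f x := by
  simp [pderiv]

section Sum

variable {κ κ' : Type*} [Fintype κ] [DecidableEq κ] [Fintype κ'] [DecidableEq κ']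

lemma pderiv_sum_inl (k : κ) (F : (κ ⊕ κ' → ℝ) → ℝ) (x : κ → ℝ) (y : κ' → ℝ) :
    pderiv (Sum.inl k) F (Sum.elim x y) = pderiv k (fun x' => F (Sum.elim x' y)) x := by
  simp only [pderiv, Sum.update_elim_inl, Sum.elim_inl]

lemma pderiv_sum_inr (k : κ') (F : (κ ⊕ κ' → ℝ) → ℝ) (x : κ → ℝ) (y : κ' → ℝ) :
    pderiv (Sum.inr k) F (Sum.elim x y) = pderiv k (fun y' => F (Sum.elim x y')) y := by
  simp only [pderiv, Sum.update_elim_inr, Sum.elim_inr]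

/-- The product metric with components `G ⊕ K`. -/
def productMetric (G : (κ → ℝ) → Matrix κ κ ℝ) (K : (κ' → ℝ) → Matrix κ' κ' ℝ)
    (z : κ ⊕ κ' → ℝ) : Matrix (κ ⊕ κ') (κ ⊕ κ') ℝ :=
  Matrix.fromBlocks (G fun i => z (Sum.inl i)) 0 0 (K fun j => z (Sum.inr j))

lemma inv_fromBlocks_diagonal {A : Matrix κ κ ℝ} {B : Matrix κ' κ' ℝ} (hA : IsUnit A.det)
    (hB : IsUnit B.det) :
    (Matrix.fromBlocks A 0 0 B)⁻¹ = Matrix.fromBlocks A⁻¹ 0 0 B⁻¹ := by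
  apply Matrix.inv_eq_right_inv
  simp [Matrix.fromBlocks_multiply, Matrix.mul_nonsing_inv _ hA, Matrix.mul_nonsing_inv _ hB]

variable {G : (κ → ℝ) → Matrix κ κ ℝ} {K : (κ' → ℝ) → Matrix κ' κ' ℝ} {x : κ → ℝ} {y : κ' → ℝ}

lemma christoffel_productMetric (hG : IsUnit (G x).det) (hK : IsUnit (K y).det)
    (k i j : κ ⊕ κ') :
    christoffel (productMetric G K) k i j (Sum.elim x y) =
      match k, i, j with
      | Sum.inl k, Sum.inl i, Sum.inl j => christoffel G k i j x
      | Sum.inr k, Sum.inr i, Sum.inr j => christoffel K k i j y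
      | _, _, _ => 0 := by
  have hinv : (productMetric G K (Sum.elim x y))⁻¹ = Matrix.fromBlocks (G x)⁻¹ 0 0 (K y)⁻¹ :=
    inv_fromBlocks_diagonal hG hK
  unfold christoffel
  rw [hinv]
  rcases k with k | k <;> rcases i with i | i <;> rcases j with j | j <;>
    simp [Fintype.sum_sum_type, pderiv_sum_inl, pderiv_sum_inr, productMetric]

lemma ricci_productMetric (hG : ∀ᶠ x' in 𝓝 x, IsUnit (G x').det)
    (hK : ∀ᶠ y' in 𝓝 y, IsUnit (K y').det) :
    ricci (productMetric G K) (Sum.elim x y) =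
      Matrix.fromBlocks (ricci G x) 0 0 (ricci K y) := by
  have hl : ∀ l k i j : κ ⊕ κ', pderiv l (christoffel (productMetric G K) k i j) (Sum.elim x y) =
      match l, k, i, j with
      | Sum.inl l, Sum.inl k, Sum.inl i, Sum.inl j => pderiv l (christoffel G k i j) x
      | Sum.inr l, Sum.inr k, Sum.inr i, Sum.inr j => pderiv l (christoffel K k i j) y
      | _, _, _, _ => 0 := by
    intro l k i j
    rcases l with l | l
    · rw [pderiv_sum_inl, pderiv_congr l (hG.mono fun x' hx' =>
        christoffel_productMetric hx' hK.self_of_nhds k i j)]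
      rcases k with k | k <;> rcases i with i | i <;> rcases j with j | j <;> simp
    · rw [pderiv_sum_inr, pderiv_congr l (hK.mono fun x' hx' =>
        christoffel_productMetric hG.self_of_nhds hx' k i j)]
      rcases k with k | k <;> rcases i with i | i <;> rcases j with j | j <;> simp
  ext i j
  simp only [ricci, Matrix.of_apply, Fintype.sum_sum_type, hl,
    christoffel_productMetric hG.self_of_nhds hK.self_of_nhds]
  rcases i with i | i <;> rcases j with j | j <;> simp

end Sum

section Warped

variable {κ Λ : Type*} [Fintype κ] [DecidableEq κ]

/-- The metric `-dt² + ∑ f_λ(t)² G_λ`, where the coordinate `i` belongs to the block `c i`. -/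
def warpedMetric (c : κ → Λ) (f : Λ → ℝ → ℝ) (G : (κ → ℝ) → Matrix κ κ ℝ)
    (z : Unit ⊕ κ → ℝ) : Matrix (Unit ⊕ κ) (Unit ⊕ κ) ℝ :=
  Matrix.fromBlocks (-1) 0 0 (Matrix.of fun i j =>
    f (c i) (z (Sum.inl ())) * f (c j) (z (Sum.inl ())) * G (fun i => z (Sum.inr i)) i j)

/-- At `x`, the nondegenerate metric `G` splits into the blocks of `c`. -/
structure IsBlockMetric (c : κ → Λ) (G : (κ → ℝ) → Matrix κ κ ℝ) (x : κ → ℝ) : Prop where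
  symm : ∀ i j, G x i j = G x j i
  unit : IsUnit (G x).det
  zero : ∀ i j, c i ≠ c j → G x i j = 0
  inv_zero : ∀ i j, c i ≠ c j → (G x)⁻¹ i j = 0
  pderiv_zero : ∀ l i j, ¬ (c l = c i ∧ c l = c j) → pderiv l (fun y => G y i j) x = 0

variable {c : κ → Λ} {f : Λ → ℝ → ℝ} {G : (κ → ℝ) → Matrix κ κ ℝ} {x : κ → ℝ} {t : ℝ}

lemma pderiv_time (F : (Unit ⊕ κ → ℝ) → ℝ) (x : κ → ℝ) (t : ℝ) (u : Unit) :
    pderiv (Sum.inl u) F (Sum.elim (fun _ => t) x) =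
      deriv (fun s => F (Sum.elim (fun _ => s) x)) t := by
  rw [pderiv_sum_inl]
  unfold pderiv
  congr 1

/-- The spatial block is `F G F`, with `F` the diagonal matrix of warping factors, so it is inverted
factor by factor. -/
lemma IsBlockMetric.inv_warpedMetric (h : IsBlockMetric c G x) (hf : ∀ l, f l t ≠ 0) :
    (warpedMetric c f G (Sum.elim (fun _ => t) x))⁻¹ =
      Matrix.fromBlocks (-1) 0 0
        (Matrix.of fun i j => (f (c i) t)⁻¹ * (f (c j) t)⁻¹ * (G x)⁻¹ i j) := by
  apply Matrix.inv_eq_right_inv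
  have : (Matrix.of fun i j => f (c i) t * f (c j) t * G x i j) *
      (Matrix.of fun i j => (f (c i) t)⁻¹ * (f (c j) t)⁻¹ * (G x)⁻¹ i j) = 1 := by
    rw [show (Matrix.of fun i j => f (c i) t * f (c j) t * G x i j) =
      Matrix.diagonal (fun i => f (c i) t) * G x * Matrix.diagonal (fun i => f (c i) t) by
        ext i j; simp [Matrix.mul_diagonal, Matrix.diagonal_mul]; ring,
      show (Matrix.of fun i j => (f (c i) t)⁻¹ * (f (c j) t)⁻¹ * (G x)⁻¹ i j) =
      Matrix.diagonal (fun i => (f (c i) t)⁻¹) * (G x)⁻¹ *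
        Matrix.diagonal (fun i => (f (c i) t)⁻¹) by
        ext i j; simp [Matrix.mul_diagonal, Matrix.diagonal_mul]; ring]
    have h1 : Matrix.diagonal (fun i => f (c i) t) * Matrix.diagonal (fun i => (f (c i) t)⁻¹) = 1 := by
      rw [Matrix.diagonal_mul_diagonal, ← Matrix.diagonal_one]
      congr 1; ext i; exact mul_inv_cancel₀ (hf _)
    calc _ = Matrix.diagonal (fun i => f (c i) t) * (G x *
          ((Matrix.diagonal (fun i => f (c i) t) * Matrix.diagonal (fun i => (f (c i) t)⁻¹)) *
            (G x)⁻¹)) * Matrix.diagonal (fun i => (f (c i) t)⁻¹) := by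
            simp only [Matrix.mul_assoc]
      _ = 1 := by rw [h1, Matrix.one_mul, Matrix.mul_nonsing_inv _ h.unit, Matrix.mul_one, h1]
  simp only [warpedMetric, Matrix.fromBlocks_multiply, Sum.elim_inl, Sum.elim_inr]
  rw [this]
  simp

lemma IsBlockMetric.sum_inv_mul (h : IsBlockMetric c G x) (k i : κ) :
    ∑ l, (G x)⁻¹ k l * G x l i = if k = i then 1 else 0 := by
  have := congrFun (congrFun (Matrix.nonsing_inv_mul _ h.unit) k) i
  rwa [Matrix.mul_apply, Matrix.one_apply] at this

/-- The Christoffel symbols of a warped metric. -/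
def warpedChristoffel (c : κ → Λ) (f : Λ → ℝ → ℝ) (G : (κ → ℝ) → Matrix κ κ ℝ)
    (t : ℝ) (x : κ → ℝ) (k i j : Unit ⊕ κ) : ℝ :=
  match k, i, j with
  | Sum.inl _, Sum.inr i, Sum.inr j => f (c i) t * deriv (f (c i)) t * G x i j
  | Sum.inr k, Sum.inl _, Sum.inr j => if k = j then deriv (f (c k)) t / f (c k) t else 0
  | Sum.inr k, Sum.inr j, Sum.inl _ => if k = j then deriv (f (c k)) t / f (c k) t else 0
  | Sum.inr k, Sum.inr i, Sum.inr j => christoffel G k i j x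
  | _, _, _ => 0

/-- Within one block all warping factors coincide and cancel in the spatial symbols. Terms mixing
blocks vanish through the inverse metric or through the derivatives of the metric. -/
lemma IsBlockMetric.christoffel_warpedMetric (h : IsBlockMetric c G x) (hf : ∀ l, f l t ≠ 0)
    (hd : ∀ l, DifferentiableAt ℝ (f l) t) (k i j : Unit ⊕ κ) :
    christoffel (warpedMetric c f G) k i j (Sum.elim (fun _ => t) x) =
      warpedChristoffel c f G t x k i j := by
  have ht : ∀ i j, deriv (fun s => f (c i) s * f (c j) s * G x i j) t =
      2 * f (c i) t * deriv (f (c i)) t * G x i j := by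
    intro i j
    by_cases hij : c i = c j
    · rw [deriv_mul_const_field, deriv_fun_mul (hd _) (hd _), hij]; ring
    · simp [h.zero i j hij]
  have hsum : ∀ k j, 1 / 2 * ∑ l, (f (c k) t)⁻¹ * (f (c l) t)⁻¹ * (G x)⁻¹ k l *
      (2 * f (c j) t * deriv (f (c j)) t * G x j l) =
      if k = j then deriv (f (c k)) t / f (c k) t else 0 := by
    intro k j
    have : ∀ l, (f (c k) t)⁻¹ * (f (c l) t)⁻¹ * (G x)⁻¹ k l *
      (2 * f (c j) t * deriv (f (c j)) t * G x j l) =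
      (2 * (f (c k) t)⁻¹ * deriv (f (c j)) t) * ((G x)⁻¹ k l * G x l j) := by
      intro l
      by_cases hl : c j = c l
      · rw [h.symm j l, hl]
        have := hf (c l)
        field_simp
      · rw [h.symm l j, h.zero j l hl]; ring
    rw [Finset.sum_congr rfl fun l _ => this l, ← Finset.mul_sum, h.sum_inv_mul]
    split_ifs with hkj
    · subst hkj; field_simp
    · ring
  have hspace : ∀ k i j, 1 / 2 * ∑ l, (f (c k) t)⁻¹ * (f (c l) t)⁻¹ * (G x)⁻¹ k l *
      (f (c j) t * f (c l) t * pderiv i (fun y => G y j l) x +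
        f (c i) t * f (c l) t * pderiv j (fun y => G y i l) x -
        f (c i) t * f (c j) t * pderiv l (fun y => G y i j) x) = christoffel G k i j x := by
    intro k i j
    unfold christoffel
    congr 1
    refine Finset.sum_congr rfl fun l _ => ?_
    by_cases hk : c k = c l
    · by_cases hj : c i = c j ∧ c i = c l
      · rw [hk, hj.2, ← hj.1, hj.2]
        have := hf (c l)
        field_simp
      · rw [h.pderiv_zero _ _ _ hj, h.pderiv_zero j i l (by grind), h.pderiv_zero l i j (by grind)]
        ring
    · rw [h.inv_zero k l hk]
      ring
  unfold christoffel
  rw [h.inv_warpedMetric hf]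
  rcases k with k | k <;> rcases i with i | i <;> rcases j with j | j <;>
    simp [Fintype.sum_sum_type, pderiv_time, pderiv_sum_inr, warpedMetric, warpedChristoffel, ht,
      pderiv_const_mul]
  · ring
  · simpa using hsum k j
  · simpa using hsum k i
  · simpa using hspace k i j

lemma christoffel_symm (h : ∀ᶠ y in 𝓝 x, ∀ i j, G y i j = G y j i) (k i j : κ) :
    christoffel G k i j x = christoffel G k j i x := by
  unfold christoffel
  congr 1
  refine Finset.sum_congr rfl fun l _ => ?_
  rw [pderiv_congr l (h.mono fun y hy => hy i j)]
  ring

lemma IsBlockMetric.christoffel_eq_zero (h : IsBlockMetric c G x) {k j : κ} (hkj : c k ≠ c j) :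
    christoffel G k k j x = 0 := by
  unfold christoffel
  rw [mul_eq_zero]
  right
  refine Finset.sum_eq_zero fun l _ => ?_
  by_cases hk : c k = c l
  · rw [h.pderiv_zero _ _ _ (by grind), h.pderiv_zero j k l (by grind), h.pderiv_zero l k j (by grind)]
    ring
  · rw [h.inv_zero k l hk]
    ring

/-- Keeping the block map `c` abstract lets one computation serve twice: with values in `Bool` for
the full spacetime, and in `Unit` for its reduction. -/
lemma ricci_warpedMetric (hG : ∀ᶠ y in 𝓝 x, IsBlockMetric c G y)
    (hf : ∀ᶠ s in 𝓝 t, ∀ l, f l s ≠ 0 ∧ DifferentiableAt ℝ (f l) s)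
    (hf' : ∀ l, DifferentiableAt ℝ (deriv (f l)) t) :
    ricci (warpedMetric c f G) (Sum.elim (fun _ => t) x) =
      Matrix.fromBlocks (Matrix.of fun _ _ => -∑ k, deriv (deriv (f (c k))) t / f (c k) t) 0 0
        (Matrix.of fun i j => ricci G x i j + (f (c i) t * deriv (deriv (f (c i))) t
          - deriv (f (c i)) t ^ 2 + (∑ k, deriv (f (c k)) t / f (c k) t)
            * (f (c i) t * deriv (f (c i)) t)) * G x i j) := by
  have hG0 := hG.self_of_nhds
  have hf0 := hf.self_of_nhds
  have hC : ∀ k i j, christoffel (warpedMetric c f G) k i j (Sum.elim (fun _ => t) x) =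
      warpedChristoffel c f G t x k i j :=
    hG0.christoffel_warpedMetric (fun l => (hf0 l).1) (fun l => (hf0 l).2)
  have hC0 : ∀ u k i j, pderiv (Sum.inl u) (christoffel (warpedMetric c f G) k i j)
      (Sum.elim (fun _ => t) x) = deriv (fun s => warpedChristoffel c f G s x k i j) t := by
    intro u k i j
    rw [pderiv_time]
    apply Filter.EventuallyEq.deriv_eq
    filter_upwards [hf] with s hs
    exact hG0.christoffel_warpedMetric (fun l => (hs l).1) (fun l => (hs l).2) k i j
  have hC1 : ∀ l k i j, pderiv (Sum.inr l) (christoffel (warpedMetric c f G) k i j)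
      (Sum.elim (fun _ => t) x) = pderiv l (fun y => warpedChristoffel c f G t y k i j) x := by
    intro l k i j
    rw [pderiv_sum_inr]
    apply pderiv_congr
    filter_upwards [hG] with y hy
    exact hy.christoffel_warpedMetric (fun l => (hf0 l).1) (fun l => (hf0 l).2) k i j
  have hH : ∀ i j, deriv (fun s => if i = j then deriv (f (c i)) s / f (c i) s else 0) t =
      if i = j then deriv (deriv (f (c i))) t / f (c i) t
        - (deriv (f (c i)) t / f (c i) t) ^ 2 else 0 := by
    intro i j
    by_cases hij : i = j
    · simp only [hij, if_true]
      rw [deriv_fun_div (hf' _) (hf0 _).2 (hf0 _).1]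
      have := (hf0 (c j)).1
      field_simp
    · simp [hij]
  have hff : ∀ i j, deriv (fun s => f (c i) s * deriv (f (c i)) s * G x i j) t =
      (deriv (f (c i)) t ^ 2 + f (c i) t * deriv (deriv (f (c i))) t) * G x i j := by
    intro i j
    rw [deriv_mul_const_field, deriv_fun_mul (hf0 _).2 (hf' _)]
    ring
  have hsymm := fun k i j => christoffel_symm (hG.mono fun y hy => hy.symm) k i j
  -- `Γᵏₖⱼ` is nonzero only for `k` and `j` in the same block, so the factor `ḟ/f` may be taken at
  -- either index. This cancels the mixed time-space components.
  have hmix : ∀ j, ∑ k, christoffel G k k j x * (deriv (f (c j)) t / f (c j) t) =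
      ∑ k, christoffel G k k j x * (deriv (f (c k)) t / f (c k) t) := by
    intro j
    refine Finset.sum_congr rfl fun k _ => ?_
    by_cases hkj : c k = c j
    · rw [hkj]
    · rw [hG0.christoffel_eq_zero hkj]; ring
  ext i j
  rcases i with i | i <;> rcases j with j | j <;>
    simp only [ricci, Matrix.of_apply, Fintype.sum_sum_type, hC, hC0, hC1] <;>
    simp [warpedChristoffel, hff]
  · have hH' : ∀ k, deriv (fun s => deriv (f (c k)) s / f (c k) s) t =
        deriv (deriv (f (c k))) t / f (c k) t - (deriv (f (c k)) t / f (c k) t) ^ 2 :=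
      fun k => by simpa using hH k k
    simp only [hH', Finset.sum_sub_distrib]
    simp only [pow_two]
    ring
  · rw [hmix, sub_eq_zero]
    exact Finset.sum_congr rfl fun k _ => by rw [hsymm k j k]
  · rw [hmix, sub_eq_zero]
    exact Finset.sum_congr rfl fun k _ => by rw [hsymm k i k, mul_comm]
  · have hG' : f (c j) t * deriv (f (c j)) t * G x j i * (deriv (f (c i)) t / f (c i) t) =
        deriv (f (c i)) t ^ 2 * G x i j := by
      by_cases hij : c i = c j
      · rw [hG0.symm j i, hij]
        have := (hf0 (c j)).1
        field_simp
      · rw [hG0.symm j i, hG0.zero i j hij]; ring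
    have hG'' : deriv (f (c j)) t / f (c j) t * (f (c i) t * deriv (f (c i)) t * G x i j) =
        deriv (f (c i)) t ^ 2 * G x i j := by
      by_cases hij : c i = c j
      · rw [hij]
        have := (hf0 (c j)).1
        field_simp
      · rw [hG0.zero i j hij]; ring
    simp only [Finset.sum_add_distrib, Finset.sum_ite_eq', Finset.mem_univ, if_true, hG', hG'',
      ← Finset.sum_mul]
    ring

end Warped

end Geometry

/-! ### Nondegeneracy of a Riemannian metric in a chart -/

section ChartMetric

set_option linter.unusedSectionVars false

variable {d : ℕ} {M : Type*} [TopologicalSpace M]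
  [ChartedSpace (EuclideanSpace ℝ (Fin d)) M]
  [IsManifold 𝓘(ℝ, EuclideanSpace ℝ (Fin d)) ∞ M]

lemma chartMetric_symm (g : SmoothMetric d M)
    (e : OpenPartialHomeomorph M (EuclideanSpace ℝ (Fin d))) (v : Fin d → ℝ) (i j : Fin d) :
    chartMetric g e v i j = chartMetric g e v j i := by
  simp only [chartMetric, Matrix.of_apply]
  exact g.symm _ _ _

lemma sum_coordVector (e : OpenPartialHomeomorph M (EuclideanSpace ℝ (Fin d))) (v w : Fin d → ℝ) :
    ∑ i, w i • coordVector e i v =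
      mfderiv 𝓘(ℝ, EuclideanSpace ℝ (Fin d)) 𝓘(ℝ, EuclideanSpace ℝ (Fin d)) e.symm
        (WithLp.toLp 2 v) (WithLp.toLp 2 w : EuclideanSpace ℝ (Fin d)) := by
  have hw : (WithLp.toLp 2 w : EuclideanSpace ℝ (Fin d)) =
      ∑ i, w i • EuclideanSpace.single i (1 : ℝ) := by
    ext i
    simp [Finset.sum_apply, Pi.single_apply]
  rw [hw]
  simp only [coordVector]
  erw [map_sum]
  refine Finset.sum_congr rfl fun i _ => ?_
  erw [map_smul]

/-- A null vector of the Gram matrix gives a tangent vector of length zero. By positivity this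
tangent vector is zero, and the differential of an inverse chart is injective. -/
lemma isUnit_det_chartMetric (g : SmoothMetric d M)
    {e : OpenPartialHomeomorph M (EuclideanSpace ℝ (Fin d))}
    (he : e ∈ atlas (EuclideanSpace ℝ (Fin d)) M) {v : Fin d → ℝ}
    (hv : WithLp.toLp 2 v ∈ e.target) : IsUnit (chartMetric g e v).det := by
  rw [isUnit_iff_ne_zero]
  intro h0
  obtain ⟨w, hw, hw0⟩ := Matrix.exists_mulVec_eq_zero_iff.mpr h0
  have hinj : (mfderiv 𝓘(ℝ, EuclideanSpace ℝ (Fin d)) 𝓘(ℝ, EuclideanSpace ℝ (Fin d)) e.symm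
        (WithLp.toLp 2 v) (WithLp.toLp 2 w : EuclideanSpace ℝ (Fin d))) ≠ 0 := by
    intro h1
    have hM : IsManifold 𝓘(ℝ, EuclideanSpace ℝ (Fin d)) 1 M :=
      IsManifold.of_le (n := ∞) (by simp)
    have := (mdifferentiable_of_mem_atlas (I := 𝓘(ℝ, EuclideanSpace ℝ (Fin d))) he).comp_symm_deriv hv
    have h2 : mfderiv 𝓘(ℝ, EuclideanSpace ℝ (Fin d)) 𝓘(ℝ, EuclideanSpace ℝ (Fin d)) e
        (e.symm (WithLp.toLp 2 v)) (mfderiv 𝓘(ℝ, EuclideanSpace ℝ (Fin d))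
          𝓘(ℝ, EuclideanSpace ℝ (Fin d)) e.symm (WithLp.toLp 2 v)
          (WithLp.toLp 2 w : EuclideanSpace ℝ (Fin d))) =
        (WithLp.toLp 2 w : EuclideanSpace ℝ (Fin d)) :=
      DFunLike.congr_fun this (WithLp.toLp 2 w : EuclideanSpace ℝ (Fin d))
    apply hw
    have h3 : (WithLp.toLp 2 w : EuclideanSpace ℝ (Fin d)) = 0 :=
      h2.symm.trans ((congrArg _ h1).trans (map_zero _))
    ext i
    exact congrFun (congrArg WithLp.ofLp h3) i
  have hpos := g.pos _ _ hinj
  rw [← sum_coordVector] at hpos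
  have : g.inner (e.symm (WithLp.toLp 2 v)) (∑ i, w i • coordVector e i v)
      (∑ i, w i • coordVector e i v) = ∑ i, w i * ((chartMetric g e v).mulVec w) i := by
    simp only [map_sum, map_smul, sum_apply, smul_apply,
      smul_eq_mul, Matrix.mulVec, dotProduct, chartMetric, Matrix.of_apply, Finset.mul_sum]
    rw [Finset.sum_comm]
    refine Finset.sum_congr rfl fun i _ => Finset.sum_congr rfl fun j _ => ?_
    ring
  rw [this, hw0] at hpos
  simp at hpos

lemma eventually_mem_target (e : OpenPartialHomeomorph M (EuclideanSpace ℝ (Fin d)))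
    {v : Fin d → ℝ} (hv : WithLp.toLp 2 v ∈ e.target) :
    ∀ᶠ w in 𝓝 v, WithLp.toLp 2 w ∈ e.target :=
  (PiLp.continuous_toLp 2 (fun _ : Fin d => ℝ)).continuousAt.eventually (e.open_target.mem_nhds hv)

lemma eventually_isBlockMetric_chartMetric (g : SmoothMetric d M)
    {e : OpenPartialHomeomorph M (EuclideanSpace ℝ (Fin d))}
    (he : e ∈ atlas (EuclideanSpace ℝ (Fin d)) M) {v : Fin d → ℝ}
    (hv : WithLp.toLp 2 v ∈ e.target) :
    ∀ᶠ w in 𝓝 v, IsBlockMetric (fun _ => ()) (chartMetric g e) w := by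
  filter_upwards [eventually_mem_target e hv] with w hw
  exact ⟨chartMetric_symm g e w, isUnit_det_chartMetric g he hw, by simp, by simp, by simp⟩

end ChartMetric

/-! ### The vacuum equations as ordinary differential equations -/

section WarpedRicci

variable {m n : ℕ} {M : Type*} [TopologicalSpace M] [ChartedSpace (EuclideanSpace ℝ (Fin m)) M]
  [IsManifold 𝓘(ℝ, EuclideanSpace ℝ (Fin m)) ∞ M]
  {N : Type*} [TopologicalSpace N] [ChartedSpace (EuclideanSpace ℝ (Fin n)) N]
  [IsManifold 𝓘(ℝ, EuclideanSpace ℝ (Fin n)) ∞ N]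

lemma eventually_isBlockMetric_productMetric (g : SmoothMetric m M) (h : SmoothMetric n N)
    {e : OpenPartialHomeomorph M (EuclideanSpace ℝ (Fin m))}
    (he : e ∈ atlas (EuclideanSpace ℝ (Fin m)) M)
    {f : OpenPartialHomeomorph N (EuclideanSpace ℝ (Fin n))}
    (hf : f ∈ atlas (EuclideanSpace ℝ (Fin n)) N) {x : Fin m → ℝ}
    (hx : WithLp.toLp 2 x ∈ e.target) {y : Fin n → ℝ} (hy : WithLp.toLp 2 y ∈ f.target) :
    ∀ᶠ z in 𝓝 (Sum.elim x y), IsBlockMetric Sum.isLeft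
      (productMetric (chartMetric g e) (chartMetric h f)) z := by
  have h1 : Tendsto (fun z : Fin m ⊕ Fin n → ℝ => fun i => z (Sum.inl i)) (𝓝 (Sum.elim x y))
      (𝓝 x) := (continuous_pi fun i => continuous_apply (Sum.inl i)).tendsto' _ _ rfl
  have h2 : Tendsto (fun z : Fin m ⊕ Fin n → ℝ => fun i => z (Sum.inr i)) (𝓝 (Sum.elim x y))
      (𝓝 y) := (continuous_pi fun i => continuous_apply (Sum.inr i)).tendsto' _ _ rfl
  filter_upwards [h1.eventually (eventually_mem_target e hx),
    h2.eventually (eventually_mem_target f hy)] with z hz1 hz2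
  have hG := isUnit_det_chartMetric g he hz1
  have hK := isUnit_det_chartMetric h hf hz2
  have hinv : (productMetric (chartMetric g e) (chartMetric h f) z)⁻¹ = _ :=
    inv_fromBlocks_diagonal hG hK
  obtain ⟨z1, z2, rfl⟩ : ∃ z1 z2, z = Sum.elim z1 z2 := ⟨_, _, (Sum.elim_comp_inl_inr z).symm⟩
  refine ⟨?_, ?_, ?_, ?_, ?_⟩
  · rintro (i | i) (j | j) <;> simp [productMetric] <;> exact chartMetric_symm _ _ _ i j
  · rw [productMetric, Matrix.det_fromBlocks_zero₁₂]
    exact hG.mul hK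
  · rintro (i | i) (j | j) <;> simp [productMetric]
  · rintro (i | i) (j | j) <;> simp [hinv]
  · rintro (l | l) (i | i) (j | j) <;>
      simp [pderiv_sum_inl, pderiv_sum_inr, productMetric]

lemma doublyWarped_eq (a b : ℝ → ℝ) (G : (Fin m → ℝ) → Matrix (Fin m) (Fin m) ℝ)
    (K : (Fin n → ℝ) → Matrix (Fin n) (Fin n) ℝ) :
    doublyWarped a b G K =
      warpedMetric Sum.isLeft (fun s => bif s then a else b) (productMetric G K) := by
  ext z i j
  rcases i with i | i | i <;> rcases j with j | j | j <;>
    simp [doublyWarped, warpedMetric, productMetric, pow_two]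

lemma singlyWarped_eq (a : ℝ → ℝ) (G : (Fin m → ℝ) → Matrix (Fin m) (Fin m) ℝ) :
    singlyWarped a G = warpedMetric (fun _ => ()) (fun _ => a) G := by
  ext z i j
  rcases i with i | i <;> rcases j with j | j <;>
    simp [singlyWarped, warpedMetric, pow_two]

/-- The vacuum Einstein equations for `-dt² + a(t)² g + b(t)² h`, as ordinary differential
equations, when `Ric_g = -(m+n-1) g` and `Ric_h = -(m+n-1) h`. -/
structure IsSol (m n : ℕ) (I : Set ℝ) (a b : ℝ → ℝ) : Prop where
  isOpen : IsOpen I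
  nonempty : I.Nonempty
  ordConnected : I.OrdConnected
  smooth_a : ContDiffOn ℝ ∞ a I
  smooth_b : ContDiffOn ℝ ∞ b I
  pos_a : ∀ t ∈ I, 0 < a t
  pos_b : ∀ t ∈ I, 0 < b t
  eq_time : ∀ t ∈ I, m * (deriv (deriv a) t / a t) + n * (deriv (deriv b) t / b t) = 0
  eq_a : ∀ t ∈ I, a t * deriv (deriv a) t - deriv a t ^ 2 +
    (m * (deriv a t / a t) + n * (deriv b t / b t)) * (a t * deriv a t) = m + n - 1
  eq_b : ∀ t ∈ I, b t * deriv (deriv b) t - deriv b t ^ 2 +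
    (m * (deriv a t / a t) + n * (deriv b t / b t)) * (b t * deriv b t) = m + n - 1

lemma differentiableAt_of_smooth {I : Set ℝ} (hI : IsOpen I) {a : ℝ → ℝ}
    (ha : ContDiffOn ℝ ∞ a I) {t : ℝ} (ht : t ∈ I) : DifferentiableAt ℝ a t :=
  (ha.contDiffAt (hI.mem_nhds ht)).differentiableAt (by simp)

lemma differentiableAt_deriv_of_smooth {I : Set ℝ} (hI : IsOpen I) {a : ℝ → ℝ}
    (ha : ContDiffOn ℝ ∞ a I) {t : ℝ} (ht : t ∈ I) : DifferentiableAt ℝ (deriv a) t :=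
  differentiableAt_of_smooth hI (ha.deriv_of_isOpen hI (m := ∞) (by simp)) ht

lemma ricci_doublyWarped {g : SmoothMetric m M} {h : SmoothMetric n N}
    (hg : IsEinstein g (-((m : ℝ) + n - 1))) (hh : IsEinstein h (-((m : ℝ) + n - 1)))
    {I : Set ℝ} (hI : IsOpen I) {a b : ℝ → ℝ} (ha : ContDiffOn ℝ ∞ a I) (hb : ContDiffOn ℝ ∞ b I)
    (ha0 : ∀ t ∈ I, 0 < a t) (hb0 : ∀ t ∈ I, 0 < b t)
    {e : OpenPartialHomeomorph M (EuclideanSpace ℝ (Fin m))}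
    (he : e ∈ atlas (EuclideanSpace ℝ (Fin m)) M)
    {f : OpenPartialHomeomorph N (EuclideanSpace ℝ (Fin n))}
    (hf : f ∈ atlas (EuclideanSpace ℝ (Fin n)) N) {t : ℝ} (ht : t ∈ I) {x : Fin m → ℝ}
    (hx : WithLp.toLp 2 x ∈ e.target) {y : Fin n → ℝ} (hy : WithLp.toLp 2 y ∈ f.target) :
    ricci (doublyWarped a b (chartMetric g e) (chartMetric h f))
        (Sum.elim (fun _ => t) (Sum.elim x y)) =
      Matrix.fromBlocks
        (Matrix.of fun _ _ => -(m * (deriv (deriv a) t / a t) + n * (deriv (deriv b) t / b t))) 0 0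
        (Matrix.fromBlocks
          ((a t * deriv (deriv a) t - deriv a t ^ 2 +
            (m * (deriv a t / a t) + n * (deriv b t / b t)) * (a t * deriv a t) - (m + n - 1)) •
            chartMetric g e x) 0 0
          ((b t * deriv (deriv b) t - deriv b t ^ 2 +
            (m * (deriv a t / a t) + n * (deriv b t / b t)) * (b t * deriv b t) - (m + n - 1)) •
            chartMetric h f y)) := by
  have hG := (eventually_mem_target e hx).mono fun w hw => isUnit_det_chartMetric g he hw
  have hK := (eventually_mem_target f hy).mono fun w hw => isUnit_det_chartMetric h hf hw
  rw [doublyWarped_eq, ricci_warpedMetric (eventually_isBlockMetric_productMetric g h he hf hx hy),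
    ricci_productMetric hG hK, hg e he x hx, hh f hf y hy]
  · ext i j
    rcases i with i | i | i <;> rcases j with j | j | j <;>
      simp [productMetric] <;> ring
  · filter_upwards [hI.mem_nhds ht] with s hs
    rintro (_ | _)
    · exact ⟨(hb0 s hs).ne', differentiableAt_of_smooth hI hb hs⟩
    · exact ⟨(ha0 s hs).ne', differentiableAt_of_smooth hI ha hs⟩
  · rintro (_ | _)
    · exact differentiableAt_deriv_of_smooth hI hb ht
    · exact differentiableAt_deriv_of_smooth hI ha ht

/-- An invertible matrix of positive size is nonzero; for size zero the conclusion would fail. -/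
lemma smul_chartMetric_eq_zero (hm : 1 < m) (g : SmoothMetric m M)
    {e : OpenPartialHomeomorph M (EuclideanSpace ℝ (Fin m))}
    (he : e ∈ atlas (EuclideanSpace ℝ (Fin m)) M) {x : Fin m → ℝ}
    (hx : WithLp.toLp 2 x ∈ e.target) {c : ℝ} (h : c • chartMetric g e x = 0) : c = 0 := by
  rcases smul_eq_zero.mp h with h | h
  · exact h
  · have := isUnit_det_chartMetric g he hx
    have hne : Nonempty (Fin m) := ⟨⟨0, by omega⟩⟩
    rw [h, Matrix.det_zero] at this
    simp at this

/-- The Ricci tensor is block diagonal, with spatial blocks multiples of `g` and `h`. One point of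
each manifold is enough to read off the three scalar equations. -/
theorem isVacuum_iff_isSol [Nonempty M] [Nonempty N] (hm : 1 < m) (hn : 1 < n)
    {g : SmoothMetric m M} {h : SmoothMetric n N}
    (hg : IsEinstein g (-((m : ℝ) + n - 1))) (hh : IsEinstein h (-((m : ℝ) + n - 1)))
    {I : Set ℝ} {a b : ℝ → ℝ} : IsVacuum g h I a b ↔ IsSol m n I a b := by
  constructor
  · intro H
    obtain ⟨p⟩ := ‹Nonempty M›
    obtain ⟨q⟩ := ‹Nonempty N›
    have hx : WithLp.toLp 2 (chartAt (EuclideanSpace ℝ (Fin m)) p p).ofLp ∈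
        (chartAt (EuclideanSpace ℝ (Fin m)) p).target := mem_chart_target _ p
    have hy : WithLp.toLp 2 (chartAt (EuclideanSpace ℝ (Fin n)) q q).ofLp ∈
        (chartAt (EuclideanSpace ℝ (Fin n)) q).target := mem_chart_target _ q
    have he := chart_mem_atlas (EuclideanSpace ℝ (Fin m)) p
    have hf := chart_mem_atlas (EuclideanSpace ℝ (Fin n)) q
    have key : ∀ t ∈ I, _ := fun t ht => (ricci_doublyWarped hg hh H.isOpen H.smooth_a H.smooth_b
      H.pos_a H.pos_b he hf ht hx hy).symm.trans (H.ricci_eq_zero _ he _ hf t ht _ hx _ hy)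
    have key' : ∀ t ∈ I, _ := fun t ht => Matrix.fromBlocks_inj.mp
      ((key t ht).trans Matrix.fromBlocks_zero.symm)
    have key'' : ∀ t ∈ I, _ := fun t ht => Matrix.fromBlocks_inj.mp
      ((key' t ht).2.2.2.trans Matrix.fromBlocks_zero.symm)
    refine ⟨H.isOpen, H.nonempty, H.ordConnected, H.smooth_a, H.smooth_b, H.pos_a, H.pos_b,
      fun t ht => ?_, fun t ht => ?_, fun t ht => ?_⟩
    · have := congrFun (congrFun (key' t ht).1 ()) ()
      simp only [Matrix.of_apply, Matrix.zero_apply, neg_eq_zero] at this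
      exact this
    · exact sub_eq_zero.mp (smul_chartMetric_eq_zero hm g he hx (key'' t ht).1)
    · exact sub_eq_zero.mp (smul_chartMetric_eq_zero hn h hf hy (key'' t ht).2.2.2)
  · intro H
    refine ⟨H.isOpen, H.nonempty, H.ordConnected, H.smooth_a, H.smooth_b, H.pos_a, H.pos_b, ?_⟩
    intro e he f hf t ht x hx y hy
    rw [ricci_doublyWarped hg hh H.isOpen H.smooth_a H.smooth_b H.pos_a H.pos_b he hf ht hx hy,
      H.eq_time t ht, H.eq_a t ht, H.eq_b t ht]
    ext i j
    rcases i with i | i | i <;> rcases j with j | j | j <;> simp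

/-- A solution that cannot be extended. -/
structure IsMaxSol (m n : ℕ) (I : Set ℝ) (a b : ℝ → ℝ) : Prop where
  isSol : IsSol m n I a b
  maximal : ∀ (I' : Set ℝ) (a' b' : ℝ → ℝ), IsSol m n I' a' b' → I ⊆ I' →
    EqOn a' a I → EqOn b' b I → I' = I

theorem isMaximalVacuum_iff [Nonempty M] [Nonempty N] (hm : 1 < m) (hn : 1 < n)
    {g : SmoothMetric m M} {h : SmoothMetric n N}
    (hg : IsEinstein g (-((m : ℝ) + n - 1))) (hh : IsEinstein h (-((m : ℝ) + n - 1)))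
    {I : Set ℝ} {a b : ℝ → ℝ} : IsMaximalVacuum g h I a b ↔ IsMaxSol m n I a b := by
  constructor
  · rintro ⟨h1, h2⟩
    exact ⟨(isVacuum_iff_isSol hm hn hg hh).mp h1, fun I' a' b' h' =>
      h2 I' a' b' ((isVacuum_iff_isSol hm hn hg hh).mpr h')⟩
  · rintro ⟨h1, h2⟩
    exact ⟨(isVacuum_iff_isSol hm hn hg hh).mpr h1, fun I' a' b' h' =>
      h2 I' a' b' ((isVacuum_iff_isSol hm hn hg hh).mp h')⟩

end WarpedRicci

/-! ### Solving the Hamiltonian constraint for `ȧ` -/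

section OrbitAlgebra

set_option linter.unusedSectionVars false

/-- The value of `(m-1) ȧ + n ḃ a / b` on an expanding solution, as a function of `z = a / b` and
`β = ḃ`. -/
def orbitD (m n z β : ℝ) : ℝ :=
  √((m + n - 1) / m * (n * β ^ 2 * z ^ 2 + (m - 1) * (m + n * z ^ 2)))

/-- The value of `ȧ` on an expanding solution, as a function of `z = a / b` and `β = ḃ`. -/
def orbitX (m n z β : ℝ) : ℝ := (orbitD m n z β - n * β * z) / (m - 1)

/-- The right hand side of the orbit equation `(z ^ m β)' = z ^ m * orbitRhs z β`. -/
def orbitRhs (m n z β : ℝ) : ℝ :=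
  (m + n - 1) * (m - 1) * (1 - β ^ 2) / (orbitD m n z β - (m + n - 1) * β * z)

variable {m n : ℝ} (hm : 1 < m) (hn : 1 < n)
include hm hn

lemma orbitD_radicand_pos (z β : ℝ) :
    0 < (m + n - 1) / m * (n * β ^ 2 * z ^ 2 + (m - 1) * (m + n * z ^ 2)) := by
  have h1 : 0 < m - 1 := by linarith
  have h2 : 0 < m + n - 1 := by linarith
  have h3 : 0 < m := by linarith
  have h4 : 0 < n := by linarith
  positivity

lemma orbitD_pos (z β : ℝ) : 0 < orbitD m n z β :=
  Real.sqrt_pos.mpr (orbitD_radicand_pos hm hn z β)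

lemma orbitD_sq (z β : ℝ) : m * orbitD m n z β ^ 2 =
    (m + n - 1) * (n * β ^ 2 * z ^ 2 + (m - 1) * (m + n * z ^ 2)) := by
  rw [orbitD, Real.sq_sqrt (orbitD_radicand_pos hm hn z β).le]
  have h3 : m ≠ 0 := by linarith
  field_simp

lemma eq_orbitD {z β y : ℝ} (hy : 0 ≤ y)
    (h : m * y ^ 2 = (m + n - 1) * (n * β ^ 2 * z ^ 2 + (m - 1) * (m + n * z ^ 2))) :
    y = orbitD m n z β := by
  have h3 : 0 < m := by linarith
  have := orbitD_sq hm hn z β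
  have h1 : y ^ 2 = orbitD m n z β ^ 2 := by
    apply mul_left_cancel₀ h3.ne'
    rw [this, h]
  rwa [sq_eq_sq₀ hy (orbitD_pos hm hn z β).le] at h1

lemma orbitX_mul (z β : ℝ) :
    (m - 1) * orbitX m n z β + n * β * z = orbitD m n z β := by
  have h1 : m - 1 ≠ 0 := by linarith
  rw [orbitX]
  field_simp
  ring

lemma orbitX_sub (z β : ℝ) : (m - 1) * (orbitX m n z β - β * z) =
    orbitD m n z β - (m + n - 1) * β * z := by
  linear_combination orbitX_mul hm hn z β

/-- With `orbitX_sub`, this factorisation decides the sign of `ż = (ȧ - β z) / b`: for `z, β ≥ 0` it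
is the sign of `m + n z² - (m + n) β² z²`. -/
lemma orbitD_mul (z β : ℝ) :
    m * ((orbitD m n z β - (m + n - 1) * β * z) * (orbitD m n z β + (m + n - 1) * β * z)) =
      (m + n - 1) * (m - 1) * (m + n * z ^ 2 - (m + n) * β ^ 2 * z ^ 2) := by
  linear_combination orbitD_sq hm hn z β

/-- This is the Hamiltonian constraint times `a²`. Multiplying by `m - 1` and completing the square
turns it into `orbitD_sq`. -/
lemma orbitX_constraint (z β : ℝ) :
    m * (m - 1) * orbitX m n z β ^ 2 + 2 * m * n * orbitX m n z β * (β * z)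
      + n * (n - 1) * (β * z) ^ 2 = (m + n - 1) * (m + n * z ^ 2) := by
  have h1 : m - 1 ≠ 0 := by linarith
  apply mul_left_cancel₀ h1
  have h := orbitD_sq hm hn z β
  rw [← orbitX_mul hm hn] at h
  linear_combination h

lemma orbitX_expanding (z β : ℝ) : 0 < m * orbitX m n z β + n * (β * z) := by
  have h := orbitX_mul hm hn z β
  have h1 : 0 < m - 1 := by linarith
  have hD := orbitD_pos hm hn z β
  have h2 : (m - 1) * (m * orbitX m n z β + n * (β * z)) = m * orbitD m n z β - n * (β * z) := by
    linear_combination m * h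
  have h3 : n * (β * z) < m * orbitD m n z β := by
    apply lt_of_pow_lt_pow_left₀ 2 (by positivity)
    have h4 := orbitD_sq hm hn z β
    have h5 : (m * orbitD m n z β) ^ 2 - (n * (β * z)) ^ 2 =
        n * (m - 1) * (m + n) * (β * z) ^ 2 + m * (m + n - 1) * (m - 1) * (m + n * z ^ 2) := by
      linear_combination m * h4
    have h6 : 0 < m := by linarith
    have h7 : 0 < n := by linarith
    have h8 : 0 < m + n - 1 := by linarith
    have : 0 < (m * orbitD m n z β) ^ 2 - (n * (β * z)) ^ 2 := by rw [h5]; positivity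
    linarith
  by_contra hcon
  push Not at hcon
  nlinarith

/-- Of the two roots of the constraint, expansion selects the larger one. By the constraint `(m x +
n β z)² > x²`, so `(m - 1) x + n β z` is positive and must be the positive root `orbitD`. -/
lemma eq_orbitX {z β x : ℝ} (hx : 0 < m * x + n * (β * z))
    (h : m * (m - 1) * x ^ 2 + 2 * m * n * x * (β * z) + n * (n - 1) * (β * z) ^ 2 =
      (m + n - 1) * (m + n * z ^ 2)) : x = orbitX m n z β := by
  have h1 : 0 < m - 1 := by linarith
  have h2 : 0 < (m + n - 1) * (m + n * z ^ 2) := by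
    have h7 : 0 < n := by linarith
    have h8 : 0 < m + n - 1 := by linarith
    positivity
  have h3 : x < m * x + n * (β * z) := by
    apply lt_of_pow_lt_pow_left₀ 2 hx.le
    nlinarith [sq_nonneg x, sq_nonneg (β * z)]
  have h4 : (m - 1) * x + n * β * z = orbitD m n z β := by
    apply eq_orbitD hm hn (by linarith)
    linear_combination (m - 1) * h
  have h5 := orbitX_mul hm hn z β
  apply mul_left_cancel₀ h1.ne'
  linarith

/-- The strict bound on `z` matters: the quantity vanishes at `z = β = 1`, which is where the orbit
equation degenerates. -/
lemma sub_pos_of_mem_unit {z β : ℝ} (hz : 0 ≤ z) (hz1 : z < 1) (hβ : 0 ≤ β) (hβ1 : β ≤ 1) :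
    0 < orbitD m n z β - (m + n - 1) * β * z := by
  have h := orbitD_mul hm hn z β
  have hD := orbitD_pos hm hn z β
  have h1 : 0 < m + n - 1 := by linarith
  have h2 : 0 < m - 1 := by linarith
  have h3 : 0 < orbitD m n z β + (m + n - 1) * β * z := by positivity
  have h4 : 0 < m + n * z ^ 2 - (m + n) * β ^ 2 * z ^ 2 := by
    have : β ^ 2 ≤ 1 := by nlinarith
    have h5 : z ^ 2 < 1 := by nlinarith
    have h6 : (m + n) * z ^ 2 * β ^ 2 ≤ (m + n) * z ^ 2 * 1 := by
      have : 0 ≤ (m + n) * z ^ 2 := mul_nonneg (by linarith) (sq_nonneg z)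
      gcongr
    nlinarith
  have h5 : 0 < (m + n - 1) * (m - 1) * (m + n * z ^ 2 - (m + n) * β ^ 2 * z ^ 2) := by positivity
  rw [← h] at h5
  have h6 : 0 < m := by linarith
  exact pos_of_mul_pos_left (pos_of_mul_pos_right h5 h6.le) h3.le

lemma orbitD_contDiff : ContDiff ℝ ∞ (fun p : ℝ × ℝ => orbitD m n p.1 p.2) := by
  unfold orbitD
  apply ContDiff.sqrt
  · fun_prop
  · intro p
    exact (orbitD_radicand_pos hm hn p.1 p.2).ne'

lemma orbitX_contDiff : ContDiff ℝ ∞ (fun p : ℝ × ℝ => orbitX m n p.1 p.2) := by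
  unfold orbitX
  have := orbitD_contDiff hm hn
  fun_prop

lemma orbitRhs_contDiffOn (z₁ : ℝ) (hz₁ : z₁ < 1) :
    ContDiffOn ℝ ∞ (fun p : ℝ × ℝ => orbitRhs m n p.1 p.2) (Icc 0 z₁ ×ˢ Icc 0 1) := by
  unfold orbitRhs
  have := orbitD_contDiff hm hn
  apply ContDiffOn.div
  · fun_prop
  · fun_prop
  · rintro ⟨z, β⟩ ⟨hz, hβ⟩
    exact (sub_pos_of_mem_unit hm hn hz.1 (hz.2.trans_lt hz₁) hβ.1 hβ.2).ne'

lemma orbitRhs_nonneg {z β : ℝ} (hz : 0 ≤ z) (hz1 : z < 1) (hβ : 0 ≤ β) (hβ1 : β ≤ 1) :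
    0 ≤ orbitRhs m n z β := by
  have h := sub_pos_of_mem_unit hm hn hz hz1 hβ hβ1
  have h1 : 0 < m + n - 1 := by linarith
  have h2 : 0 < m - 1 := by linarith
  have h3 : 0 ≤ 1 - β ^ 2 := by nlinarith
  unfold orbitRhs
  positivity

lemma orbitRhs_pos {z β : ℝ} (hz : 0 ≤ z) (hz1 : z < 1) (hβ : 0 ≤ β) (hβ1 : β < 1) :
    0 < orbitRhs m n z β := by
  have h := sub_pos_of_mem_unit hm hn hz hz1 hβ hβ1.le
  have h1 : 0 < m + n - 1 := by linarith
  have h2 : 0 < m - 1 := by linarith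
  have h3 : 0 < 1 - β ^ 2 := by nlinarith
  unfold orbitRhs
  positivity

lemma orbitRhs_lipschitz {z₁ : ℝ} (hz₁ : z₁ < 1) : ∃ Λ : NNReal, ∀ z ∈ Icc 0 z₁,
    LipschitzOnWith Λ (orbitRhs m n z) (Icc 0 1) := by
  obtain ⟨Λ, hΛ⟩ := (orbitRhs_contDiffOn hm hn z₁ hz₁).exists_lipschitzOnWith (by simp)
    ((convex_Icc 0 z₁).prod (convex_Icc 0 1)) (isCompact_Icc.prod isCompact_Icc)
  refine ⟨Λ, fun z hz => LipschitzOnWith.of_dist_le_mul fun β hβ β' hβ' => ?_⟩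
  have := hΛ.dist_le_mul (z, β) ⟨hz, hβ⟩ (z, β') ⟨hz, hβ'⟩
  simpa [Prod.dist_eq] using this

lemma orbitRhs_bound {z₁ : ℝ} (hz₁ : z₁ < 1) : ∃ C : ℝ, 0 ≤ C ∧ ∀ z ∈ Icc 0 z₁, ∀ β ∈ Icc (0:ℝ) 1,
    |orbitRhs m n z β| ≤ C := by
  obtain ⟨C, hC⟩ := (isCompact_Icc.prod isCompact_Icc).exists_bound_of_continuousOn
    (orbitRhs_contDiffOn hm hn z₁ hz₁).continuousOn
  exact ⟨max C 0, le_max_right _ _, fun z hz β hβ => (hC (z, β) ⟨hz, hβ⟩).trans (le_max_left _ _)⟩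

end OrbitAlgebra

/-! ### The orbit equation near its singular point `z = 0` -/

section SingularODE

set_option linter.unusedSectionVars false

/-- The orbit equation in terms of `z ^ m * β`, with `β` truncated to `[0, 1]`. -/
def orbitField (m : ℕ) (n : ℝ) (z E : ℝ) : ℝ :=
  z ^ m * orbitRhs m n z (max 0 (min 1 (E / z ^ m)))

lemma clip_mem (x : ℝ) : max 0 (min 1 x) ∈ Icc (0 : ℝ) 1 :=
  ⟨le_max_left _ _, max_le zero_le_one (min_le_left _ _)⟩

lemma clip_eq {x : ℝ} (hx : x ∈ Icc (0 : ℝ) 1) : max 0 (min 1 x) = x := by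
  rw [min_eq_right hx.2, max_eq_right hx.1]

lemma abs_clip_sub_clip_le (x y : ℝ) : |max 0 (min 1 x) - max 0 (min 1 y)| ≤ |x - y| := by
  rw [max_comm 0, max_comm 0]
  exact (abs_max_sub_max_le_abs _ _ _).trans (by
    have := abs_min_sub_min_le_max 1 x 1 y
    simpa using this)

variable {m : ℕ} {n : ℝ} (hm : 1 < m) (hn : 1 < n)
include hm hn

/-- The factor `z ^ m` cancels the division in `E / z ^ m`, so the Lipschitz constant in `E` is
uniform down to `z = 0`, where the field vanishes. This removes the singularity. -/
lemma orbitField_lipschitz {z₁ : ℝ} (hz₁ : z₁ < 1) : ∃ Λ : NNReal, ∀ z ∈ Icc 0 z₁,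
    LipschitzWith Λ (orbitField m n z) := by
  have hm' : (1 : ℝ) < m := by exact_mod_cast hm
  obtain ⟨Λ, hΛ⟩ := orbitRhs_lipschitz hm' hn hz₁
  refine ⟨Λ, fun z hz => LipschitzWith.of_dist_le_mul fun E E' => ?_⟩
  rcases hz.1.eq_or_lt with h0 | h0
  · rw [← h0]
    simp only [orbitField, zero_pow (by omega : m ≠ 0), zero_mul, dist_self]
    positivity
  · have hp : 0 < z ^ m := by positivity
    have h1 := (hΛ z hz).dist_le_mul _ (clip_mem (E / z ^ m)) _ (clip_mem (E' / z ^ m))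
    have h2 := abs_clip_sub_clip_le (E / z ^ m) (E' / z ^ m)
    rw [Real.dist_eq, Real.dist_eq] at h1
    rw [Real.dist_eq, Real.dist_eq, orbitField, orbitField, ← mul_sub, abs_mul, abs_of_pos hp]
    rw [← sub_div, abs_div, abs_of_pos hp] at h2
    calc _ ≤ z ^ m * (Λ * (|E - E'| / z ^ m)) := by gcongr; exact h1.trans (by gcongr)
      _ = Λ * |E - E'| := by field_simp

lemma orbitField_bound {z₁ : ℝ} (hz₁ : z₁ < 1) : ∃ C : ℝ, 0 ≤ C ∧ ∀ z ∈ Icc 0 z₁, ∀ E,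
    0 ≤ orbitField m n z E ∧ orbitField m n z E ≤ C * z ^ m := by
  have hm' : (1 : ℝ) < m := by exact_mod_cast hm
  obtain ⟨C, hC0, hC⟩ := orbitRhs_bound hm' hn hz₁
  refine ⟨C, hC0, fun z hz E => ?_⟩
  have h1 := clip_mem (E / z ^ m)
  have h2 := orbitRhs_nonneg hm' hn hz.1 (hz.2.trans_lt hz₁) h1.1 h1.2
  have h3 := (le_abs_self _).trans (hC z hz _ h1)
  have h4 : 0 ≤ z ^ m := pow_nonneg hz.1 m
  exact ⟨mul_nonneg h4 h2, by rw [orbitField, mul_comm]; gcongr⟩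

lemma orbitField_continuousOn {z₁ : ℝ} (hz₁ : z₁ < 1) (E : ℝ) :
    ContinuousOn (fun z => orbitField m n z E) (Icc 0 z₁) := by
  have hm' : (1 : ℝ) < m := by exact_mod_cast hm
  have hm0 : m ≠ 0 := by omega
  intro z hz
  rcases hz.1.eq_or_lt with h0 | h0
  · obtain ⟨C, hC0, hC⟩ := orbitField_bound hm hn hz₁
    subst h0
    have h00 : orbitField m n 0 E = 0 := by simp [orbitField, hm0]
    rw [ContinuousWithinAt, h00]
    have h1 : Tendsto (fun z : ℝ => C * z ^ m) (𝓝[Icc 0 z₁] 0) (𝓝 0) := by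
      have : Continuous fun z : ℝ => C * z ^ m := by fun_prop
      exact (this.tendsto' 0 0 (by simp [hm0])).mono_left nhdsWithin_le_nhds
    exact tendsto_of_tendsto_of_tendsto_of_le_of_le' tendsto_const_nhds h1
      (eventually_mem_nhdsWithin.mono fun z hz => (hC z hz E).1)
      (eventually_mem_nhdsWithin.mono fun z hz => (hC z hz E).2)
  · have h1 : ContinuousWithinAt (fun z => max 0 (min 1 (E / z ^ m))) (Icc 0 z₁) z := by
      have : ContinuousWithinAt (fun z => E / z ^ m) (Icc 0 z₁) z :=
        (continuousWithinAt_const).div (continuous_pow m).continuousWithinAt (by positivity)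
      exact continuousWithinAt_const.max (continuousWithinAt_const.min this)
    have h2 := (orbitRhs_contDiffOn hm' hn z₁ hz₁).continuousOn (z, max 0 (min 1 (E / z ^ m)))
      ⟨hz, clip_mem _⟩
    have h3 := h2.comp_of_eq (f := fun z => (z, max 0 (min 1 (E / z ^ m)))) (s := Icc 0 z₁) (x := z)
      (continuousWithinAt_id.prodMk h1) (fun z hz => ⟨hz, clip_mem _⟩) rfl
    exact (continuous_pow m).continuousWithinAt.mul h3

/-- Solutions of the orbit equation on `[0, z₁]`. -/
structure IsOrbit (m : ℕ) (n z₁ : ℝ) (E : ℝ → ℝ) : Prop where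
  zero : E 0 = 0
  deriv : ∀ z ∈ Icc 0 z₁, HasDerivWithinAt E (orbitField m n z (E z)) (Icc 0 z₁) z

lemma exists_isOrbit {z₁ : ℝ} (hz₀ : 0 ≤ z₁) (hz₁ : z₁ < 1) : ∃ E, IsOrbit m n z₁ E := by
  obtain ⟨Λ, hΛ⟩ := orbitField_lipschitz hm hn hz₁
  obtain ⟨C, hC0, hC⟩ := orbitField_bound hm hn hz₁
  -- Radius and speed bound are both `C`; this suffices because the interval has length `z₁ < 1`.
  have hP : IsPicardLindelof (orbitField m n) (tmin := 0) (tmax := z₁) ⟨0, le_rfl, hz₀⟩ 0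
      ⟨C, hC0⟩ 0 ⟨C, hC0⟩ Λ := by
    refine ⟨fun z hz => (hΛ z hz).lipschitzOnWith, fun E _ => orbitField_continuousOn hm hn hz₁ E,
      fun z hz E _ => ?_, ?_⟩
    · rw [Real.norm_of_nonneg (hC z hz E).1]
      refine (hC z hz E).2.trans ?_
      have : z ^ m ≤ 1 := pow_le_one₀ hz.1 (hz.2.trans hz₁.le)
      exact mul_le_of_le_one_right hC0 this
    · simp only [sub_zero, max_eq_left hz₀, NNReal.coe_zero, sub_self]
      exact mul_le_of_le_one_right hC0 hz₁.le
  obtain ⟨E, hE0, hE⟩ := hP.exists_eq_forall_mem_Icc_hasDerivWithinAt₀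
  exact ⟨E, hE0, hE⟩

omit hm hn in
lemma IsOrbit.mono {z₁ z₂ : ℝ} (hz : z₁ ≤ z₂) {E : ℝ → ℝ} (h : IsOrbit m n z₂ E) :
    IsOrbit m n z₁ E :=
  ⟨h.zero, fun z hz' => (h.deriv z ⟨hz'.1, hz'.2.trans hz⟩).mono (Icc_subset_Icc_right hz)⟩

omit hm hn in
lemma IsOrbit.continuousOn {z₁ : ℝ} {E : ℝ → ℝ} (h : IsOrbit m n z₁ E) :
    ContinuousOn E (Icc 0 z₁) := fun z hz => (h.deriv z hz).continuousWithinAt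

omit hm hn in
lemma IsOrbit.hasDerivWithinAt_Ici {z₁ : ℝ} {E : ℝ → ℝ} (h : IsOrbit m n z₁ E) {z : ℝ}
    (hz : z ∈ Ico 0 z₁) : HasDerivWithinAt E (orbitField m n z (E z)) (Ici z) z :=
  ((h.deriv z ⟨hz.1, hz.2.le⟩).mono (Icc_subset_Icc_left hz.1)).mono_of_mem_nhdsWithin
    (Icc_mem_nhdsGE hz.2)

lemma IsOrbit.eqOn {z₁ : ℝ} (hz₁ : z₁ < 1) {E E' : ℝ → ℝ} (h : IsOrbit m n z₁ E)
    (h' : IsOrbit m n z₁ E') : EqOn E E' (Icc 0 z₁) := by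
  obtain ⟨Λ, hΛ⟩ := orbitField_lipschitz hm hn hz₁
  exact ODE_solution_unique_of_mem_Icc_right (v := orbitField m n) (s := fun _ => univ)
    (fun z hz => (hΛ z ⟨hz.1, hz.2.le⟩).lipschitzOnWith)
    h.continuousOn (fun z hz => h.hasDerivWithinAt_Ici hz) (fun _ _ => mem_univ _)
    h'.continuousOn (fun z hz => h'.hasDerivWithinAt_Ici hz) (fun _ _ => mem_univ _)
    (h.zero.trans h'.zero.symm)

lemma IsOrbit.nonneg {z₁ : ℝ} (hz₁ : z₁ < 1) {E : ℝ → ℝ} (h : IsOrbit m n z₁ E) {z : ℝ}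
    (hz : z ∈ Icc 0 z₁) : 0 ≤ E z := by
  obtain ⟨C, hC0, hC⟩ := orbitField_bound hm hn hz₁
  have hmono : MonotoneOn E (Icc 0 z₁) := by
    apply monotoneOn_of_deriv_nonneg (convex_Icc _ _) h.continuousOn
    · rw [interior_Icc]
      exact fun w hw => ((h.deriv w (Ioo_subset_Icc_self hw)).hasDerivAt
        (Icc_mem_nhds hw.1 hw.2)).differentiableAt.differentiableWithinAt
    · rw [interior_Icc]
      intro w hw
      rw [((h.deriv w (Ioo_subset_Icc_self hw)).hasDerivAt (Icc_mem_nhds hw.1 hw.2)).deriv]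
      exact (hC w (Ioo_subset_Icc_self hw) _).1
  rw [← h.zero]
  exact hmono ⟨le_rfl, hz.1.trans hz.2⟩ hz hz.1

lemma IsOrbit.le_pow {z₁ : ℝ} {E : ℝ → ℝ} (h : IsOrbit m n z₁ E) {z : ℝ}
    (hz : z ∈ Icc 0 z₁) : E z ≤ z ^ m := by
  have hm0 : m ≠ 0 := by omega
  apply le_of_forall_pos_le_add
  intro ε hε
  have hz2 : 0 < 1 + z := by linarith [hz.1]
  -- The perturbation has positive slope and equals `ε` at `w = z`. Where `E` exceeds `w ^ m`, the
  -- truncation puts `β = 1` and the field is zero, so `E` cannot cross.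
  have key : ∀ ⦃w⦄, w ∈ Icc 0 z₁ → E w ≤ w ^ m + ε / (1 + z) * (1 + w) := by
    apply image_le_of_deriv_right_lt_deriv_boundary' (f' := fun w => orbitField m n w (E w))
      (B' := fun w => m * w ^ (m - 1) + ε / (1 + z)) h.continuousOn
      (fun w hw => h.hasDerivWithinAt_Ici hw)
    · rw [h.zero]; positivity
    · fun_prop
    · intro w hw
      have h1 := ((hasDerivAt_pow m w).fun_add (((hasDerivAt_id w).const_add 1).const_mul
        (ε / (1 + z)))).hasDerivWithinAt (s := Ici w)
      simpa using h1
    · intro w hw hEw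
      have h0 : 0 ≤ m * w ^ (m - 1) := by have := hw.1; positivity
      have h1 : 0 < ε / (1 + z) := by positivity
      have h2 : orbitField m n w (E w) = 0 := by
        rcases hw.1.eq_or_lt with h3 | h3
        · simp [orbitField, ← h3, hm0]
        · have hp : 0 < w ^ m := by positivity
          have : 1 ≤ E w / w ^ m := by
            rw [le_div_iff₀ hp, hEw]
            have : 0 ≤ ε / (1 + z) * (1 + w) := by positivity
            linarith
          simp [orbitField, min_eq_left this, orbitRhs]
      rw [h2]
      linarith
  have := key hz
  rwa [div_mul_cancel₀ _ hz2.ne'] at this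

/-- A subsolution of the orbit equation lies below the orbit. -/
lemma IsOrbit.subsolution_le {z₁ : ℝ} (hz₁ : z₁ < 1) {E W W' : ℝ → ℝ} (h : IsOrbit m n z₁ E)
    (hW : ∀ z ∈ Icc 0 z₁, HasDerivAt W (W' z) z) (hW0 : W 0 ≤ 0)
    (hW' : ∀ z ∈ Icc 0 z₁, W' z ≤ orbitField m n z (W z)) {z : ℝ} (hz : z ∈ Icc 0 z₁) :
    W z ≤ E z := by
  obtain ⟨Λ, hΛ⟩ := orbitField_lipschitz hm hn hz₁
  apply le_of_forall_pos_le_add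
  intro ε hε
  -- The margin grows at rate `Λ + 1`, faster than the Lipschitz constant `Λ` lets two solutions
  -- separate, and it equals `ε` at `w = z`.
  have key : ∀ ⦃w⦄, w ∈ Icc 0 z₁ → W w ≤ E w + ε * Real.exp ((Λ + 1) * (w - z)) := by
    apply image_le_of_deriv_right_lt_deriv_boundary' (f' := W')
      (B' := fun w => orbitField m n w (E w) + ε * (Real.exp ((Λ + 1) * (w - z)) * (Λ + 1)))
      (fun w hw => (hW w hw).continuousAt.continuousWithinAt)
      (fun w hw => (hW w ⟨hw.1, hw.2.le⟩).hasDerivWithinAt)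
    · rw [h.zero, zero_add]
      exact hW0.trans (by positivity)
    · exact h.continuousOn.add (by fun_prop)
    · intro w hw
      have h1 : HasDerivAt (fun w => ε * Real.exp ((Λ + 1) * (w - z)))
          (ε * (Real.exp ((Λ + 1) * (w - z)) * (Λ + 1))) w := by
        have := ((((hasDerivAt_id w).sub_const z).const_mul ((Λ : ℝ) + 1)).exp).const_mul ε
        simpa using this
      exact (h.hasDerivWithinAt_Ici hw).add h1.hasDerivWithinAt
    · intro w hw hEw
      have h1 := (hΛ w ⟨hw.1, hw.2.le⟩).dist_le_mul (W w) (E w)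
      have h2 := hW' w ⟨hw.1, hw.2.le⟩
      set e := ε * Real.exp ((Λ + 1) * (w - z)) with he
      have h3 : 0 < e := by positivity
      rw [Real.dist_eq, Real.dist_eq, hEw, add_sub_cancel_left, abs_of_pos h3] at h1
      rw [hEw] at h2
      have h4 := (le_abs_self _).trans h1
      have h5 : ε * (Real.exp ((Λ + 1) * (w - z)) * (Λ + 1)) = e * Λ + e := by rw [he]; ring
      linarith
  simpa using key hz

end SingularODE

/-! ### The regular orbit `β = B(z)` on `(0, 1)` -/

section OrbitFunction

/-- A solution of the orbit equation `z B' + m B = z * orbitRhs z B` on `(0, 1)`, regular at `0`. -/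
structure IsOrbitFunction (m : ℕ) (n : ℝ) (B : ℝ → ℝ) : Prop where
  pos : ∀ z ∈ Ioo (0 : ℝ) 1, 0 < B z
  lt_one : ∀ z ∈ Ioo (0 : ℝ) 1, B z < 1
  deriv : ∀ z ∈ Ioo (0 : ℝ) 1, HasDerivAt B (orbitRhs m n z (B z) - m * B z / z) z
  tendsto : Tendsto B (𝓝[>] 0) (𝓝 0)

variable {m : ℕ} {n : ℝ} (hm : 1 < m) (hn : 1 < n)
include hm hn

/-- At a contact point `z ^ m - E` would have a local minimum, but its derivative there is `m z ^ (m
- 1) > 0` because the field vanishes at `β = 1`. -/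
lemma IsOrbit.lt_pow {z₁ : ℝ} {E : ℝ → ℝ} (h : IsOrbit m n z₁ E) {z : ℝ}
    (hz : z ∈ Ioo 0 z₁) : E z < z ^ m := by
  have hz' : z ∈ Icc 0 z₁ := ⟨hz.1.le, hz.2.le⟩
  refine lt_of_le_of_ne (h.le_pow hm hn hz') fun heq => ?_
  have hmin : IsLocalMin (fun w => w ^ m - E w) z := by
    filter_upwards [Ioo_mem_nhds hz.1 hz.2] with w hw
    have := h.le_pow hm hn (Ioo_subset_Icc_self hw)
    linarith
  have hp : 0 < z ^ m := pow_pos hz.1 m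
  have hd := (hasDerivAt_pow m z).sub ((h.deriv z hz').hasDerivAt (Icc_mem_nhds hz.1 hz.2))
  have h0 := hmin.hasDerivAt_eq_zero hd
  have h1 : orbitField m n z (E z) = 0 := by
    rw [heq, orbitField, div_self hp.ne']
    simp [orbitRhs]
  rw [h1, sub_zero] at h0
  have : (0 : ℝ) < m * z ^ (m - 1) := by
    have : (0 : ℝ) < m := by exact_mod_cast (by omega : 0 < m)
    have := pow_pos hz.1 (m - 1)
    positivity
  linarith

omit hm hn in
lemma div_pow_mem {z E : ℝ} (hz : 0 < z) (h0 : 0 ≤ E) (h1 : E ≤ z ^ m) :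
    E / z ^ m ∈ Icc (0 : ℝ) 1 :=
  ⟨by positivity, (div_le_one (by positivity)).mpr h1⟩

lemma IsOrbit.pos {z₁ : ℝ} (hz₁ : z₁ < 1) {E : ℝ → ℝ} (h : IsOrbit m n z₁ E) {z : ℝ}
    (hz : z ∈ Ioo 0 z₁) : 0 < E z := by
  have hm' : (1 : ℝ) < m := by exact_mod_cast hm
  have hmono : StrictMonoOn E (Icc 0 z) := by
    apply strictMonoOn_of_deriv_pos (convex_Icc _ _)
      (h.continuousOn.mono (Icc_subset_Icc_right hz.2.le))
    rw [interior_Icc]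
    intro w hw
    have hw' : w ∈ Ioo 0 z₁ := ⟨hw.1, hw.2.trans hz.2⟩
    have hw'' := Ioo_subset_Icc_self hw'
    rw [((h.deriv w hw'').hasDerivAt (Icc_mem_nhds hw'.1 hw'.2)).deriv]
    have hp : 0 < w ^ m := pow_pos hw.1 m
    have h1 := div_pow_mem hw.1 (h.nonneg hm hn hz₁ hw'') (h.le_pow hm hn hw'')
    rw [orbitField, clip_eq h1]
    exact mul_pos hp (orbitRhs_pos hm' hn hw.1.le (hw'.2.trans hz₁) h1.1
      ((div_lt_one hp).mpr (h.lt_pow hm hn hw')))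
  rw [← h.zero]
  exact hmono ⟨le_rfl, hz.1.le⟩ ⟨hz.1.le, le_rfl⟩ hz.1

/-- The regular orbit function exists, and every subsolution lies below it. -/
theorem exists_isOrbitFunction : ∃ B : ℝ → ℝ, IsOrbitFunction m n B ∧
    ∀ L L' : ℝ → ℝ, (∀ z, HasDerivAt L (L' z) z) → (∀ z ∈ Ioo (0 : ℝ) 1, 0 ≤ L z ∧ L z ≤ 1) →
      (∀ z ∈ Ioo (0 : ℝ) 1, z * L' z + m * L z ≤ z * orbitRhs m n z (L z)) →
      ∀ z ∈ Ioo (0 : ℝ) 1, L z ≤ B z := by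
  have hm' : (1 : ℝ) < m := by exact_mod_cast hm
  have hm0 : m ≠ 0 := by omega
  -- Each orbit lives on `[0, (1 + z) / 2]`, a little beyond `z`. By uniqueness the diagonal `z ↦ F
  -- z z` glues them and has two-sided derivatives.
  have hex : ∀ z : ℝ, ∃ E, z ∈ Ioo (0 : ℝ) 1 → IsOrbit m n ((1 + z) / 2) E := by
    intro z
    by_cases hz : z ∈ Ioo (0 : ℝ) 1
    · obtain ⟨E, hE⟩ := exists_isOrbit (m := m) hm hn (z₁ := (1 + z) / 2)
        (by linarith [hz.1]) (by linarith [hz.2])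
      exact ⟨E, fun _ => hE⟩
    · exact ⟨0, fun h => absurd h hz⟩
  choose F hF using hex
  have hagree : ∀ z ∈ Ioo (0 : ℝ) 1, ∀ w ∈ Ioo (0 : ℝ) ((1 + z) / 2), F w w = F z w := by
    intro z hz w hw
    have hw1 : w ∈ Ioo (0 : ℝ) 1 := ⟨hw.1, by linarith [hw.2, hz.2]⟩
    have h1 := hF w hw1
    have h2 := hF z hz
    rcases le_total w z with hwz | hwz
    · exact h1.eqOn hm hn (by linarith [hw1.2]) (h2.mono (by linarith)) ⟨hw.1.le, by linarith [hw1.2]⟩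
    · exact (h1.mono (by linarith)).eqOn hm hn (by linarith [hz.2]) h2 ⟨hw.1.le, hw.2.le⟩
  have hd : ∀ z ∈ Ioo (0 : ℝ) 1,
      HasDerivAt (fun w => F w w) (orbitField m n z (F z z)) z := by
    intro z hz
    have hz' : z < (1 + z) / 2 := by linarith [hz.2]
    have h1 := ((hF z hz).deriv z ⟨hz.1.le, hz'.le⟩).hasDerivAt (Icc_mem_nhds hz.1 hz')
    apply h1.congr_of_eventuallyEq
    filter_upwards [Ioo_mem_nhds hz.1 hz'] with w hw
    exact hagree z hz w hw
  have hmem : ∀ z ∈ Ioo (0 : ℝ) 1, z ∈ Ioo (0 : ℝ) ((1 + z) / 2) :=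
    fun z hz => ⟨hz.1, by linarith [hz.2]⟩
  have hpos : ∀ z ∈ Ioo (0 : ℝ) 1, 0 < F z z := fun z hz =>
    (hF z hz).pos hm hn (by linarith [hz.2]) (hmem z hz)
  have hlt : ∀ z ∈ Ioo (0 : ℝ) 1, F z z < z ^ m := fun z hz =>
    (hF z hz).lt_pow hm hn (hmem z hz)
  refine ⟨fun z => F z z / z ^ m, ⟨fun z hz => ?_, fun z hz => ?_, fun z hz => ?_, ?_⟩, ?_⟩
  · exact div_pos (hpos z hz) (pow_pos hz.1 m)
  · exact (div_lt_one (pow_pos hz.1 m)).mpr (hlt z hz)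
  · have hz0 : z ≠ 0 := hz.1.ne'
    have hp : z ^ m ≠ 0 := pow_ne_zero m hz0
    have h1 := (hd z hz).fun_div (hasDerivAt_pow m z) hp
    have h2 : orbitField m n z (F z z) = z ^ m * orbitRhs m n z (F z z / z ^ m) := by
      rw [orbitField, clip_eq (div_pow_mem hz.1 (hpos z hz).le (hlt z hz).le)]
    rw [h2] at h1
    refine h1.congr_deriv ?_
    obtain ⟨k, rfl⟩ : ∃ k, m = k + 1 := ⟨m - 1, by omega⟩
    simp only [Nat.add_sub_cancel]
    field_simp
    ring
  · obtain ⟨C, hC0, hC⟩ := orbitField_bound (m := m) hm hn (z₁ := 3 / 4) (by norm_num)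
    -- Integrating the bound on the field gives `E = O(z ^ (m + 1))`, hence `B = E / z ^ m = O(z)`.
    have hbd : ∀ z ∈ Ioo (0 : ℝ) (1 / 2), F z z ≤ C * z ^ (m + 1) := by
      intro z hz
      have hz1 : z ∈ Ioo (0 : ℝ) 1 := ⟨hz.1, by linarith [hz.2]⟩
      have h1 := (hF z hz1).mono (z₁ := z) (by linarith [hz.2])
      have h2 : ∀ ⦃w⦄, w ∈ Icc 0 z → F z w ≤ C * z ^ m * w := by
        apply image_le_of_deriv_right_le_deriv_boundary (f' := fun w => orbitField m n w (F z w))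
          (B' := fun w => C * z ^ m) h1.continuousOn (fun w hw => h1.hasDerivWithinAt_Ici hw)
        · rw [h1.zero, mul_zero]
        · fun_prop
        · intro w hw
          simpa using ((hasDerivAt_id w).const_mul (C * z ^ m)).hasDerivWithinAt (s := Ici w)
        · intro w hw
          refine ((hC w ⟨hw.1, by linarith [hw.2, hz.2]⟩ _).2).trans ?_
          have := hw.1
          gcongr
          exact hw.2.le
      have := h2 ⟨hz.1.le, le_rfl⟩
      rw [pow_succ]
      linarith
    have h1 : Tendsto (fun z : ℝ => C * z) (𝓝[>] 0) (𝓝 0) :=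
      ((continuous_const.mul continuous_id).tendsto' 0 0 (by simp)).mono_left nhdsWithin_le_nhds
    refine tendsto_of_tendsto_of_tendsto_of_le_of_le' tendsto_const_nhds h1 ?_ ?_
    · filter_upwards [Ioo_mem_nhdsGT (zero_lt_one' ℝ)] with z hz
      exact (div_pos (hpos z hz) (pow_pos hz.1 m)).le
    · filter_upwards [Ioo_mem_nhdsGT (show (0 : ℝ) < 1 / 2 by norm_num)] with z hz
      rw [div_le_iff₀ (pow_pos hz.1 m)]
      have := hbd z hz
      rw [pow_succ] at this
      linarith
  · intro L L' hL hL01 hsub z hz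
    have hp : 0 < z ^ m := pow_pos hz.1 m
    rw [le_div_iff₀ hp]
    have hz1 : (1 + z) / 2 < 1 := by linarith [hz.2]
    -- Multiplication by `w ^ (m - 1)` turns the inequality for `L` into the subsolution inequality
    -- for `w ^ m L`.
    have h1 := (hF z hz).subsolution_le hm hn hz1
      (W := fun w => L w * w ^ m) (W' := fun w => L' w * w ^ m + L w * (m * w ^ (m - 1)))
      (fun w _ => (hL w).fun_mul (hasDerivAt_pow m w)) (by simp [hm0]) ?_
      (z := z) ⟨hz.1.le, (hmem z hz).2.le⟩
    · exact h1
    · intro w hw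
      rcases hw.1.eq_or_lt with h0 | h0
      · have h2 : m - 1 ≠ 0 := by omega
        simp [← h0, orbitField, hm0, h2]
      · have hw1 : w ∈ Ioo (0 : ℝ) 1 := ⟨h0, hw.2.trans_lt hz1⟩
        have hpw : 0 < w ^ m := pow_pos h0 m
        have h2 : L w * w ^ m / w ^ m = L w := by field_simp
        rw [orbitField, h2, clip_eq (hL01 w hw1)]
        have h3 := hsub w hw1
        obtain ⟨k, rfl⟩ : ∃ k, m = k + 1 := ⟨m - 1, by omega⟩
        simp only [Nat.add_sub_cancel]
        have hk : 0 < w ^ k := pow_pos h0 k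
        have h4 := mul_le_mul_of_nonneg_left h3 hk.le
        rw [pow_succ]
        linarith

end OrbitFunction

/-! ### Subsolutions reaching `β = 1` at `z = 1` -/

section Barrier

/-- The polynomial in `w = z ^ 2` whose sign decides whether
`z * (3 n + (2 m - n) z ^ 2) / (2 (m + n))` is a subsolution of the orbit equation. -/
def barrierPoly (m n w : ℝ) : ℝ :=
  (m + n - 1) * m * (w * (3 * n + (2 * m - n) * w) *
      ((m + 1) * (3 * n + (2 * m - n) * w) + 2 * w * (2 * m - n)) +
      (m - 1) * ((2 * (m + n)) ^ 2 - w * (3 * n + (2 * m - n) * w) ^ 2)) ^ 2 -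
    (n * w ^ 2 * (3 * n + (2 * m - n) * w) ^ 2 + (m - 1) * (m + n * w) * (2 * (m + n)) ^ 2) *
      ((m + 1) * (3 * n + (2 * m - n) * w) + 2 * w * (2 * m - n)) ^ 2

/-- Positivity certificate: after the factor `1 - w` is removed, the polynomial is a combination of
`1 - w`, `w` and the `w - w ^ k` with nonnegative coefficients. The coefficient of `w` is the value
of the cofactor at `w = 1`. It vanishes at `j = 0`, that is `m + n = 9`, where the characteristic
equation at `z = β = 1` has a double root. The cases `n = 3` and `n = 4` have the same form. -/
lemma barrier_poly_two {j w : ℝ} (hj : 0 ≤ j) (hw : 0 ≤ w) (hw1 : w ≤ 1) :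
    0 ≤ barrierPoly (j + 7) 2 w := by
  have h (k : ℕ) (hk : k ≠ 0) : 0 ≤ w - w ^ k := by
    have := pow_le_of_le_one hw hw1 hk
    linarith
  have h2 := h 2 (by norm_num)
  have h3 := h 3 (by norm_num)
  have h4 := h 4 (by norm_num)
  have h5 := h 5 (by norm_num)
  have h1 : 0 ≤ 1 - w := by linarith
  have key : barrierPoly (j + 7) 2 w = (1 - w) *
      ((16 * j ^ 8 + 1008 * j ^ 7 + 27536 * j ^ 6 + 425904 * j ^ 5 + 4078080 * j ^ 4 + 24741792
          * j ^ 3 + 92829024 * j ^ 2 + 196779456 * j + 180278784) * (1 - w)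
                + (32 * j ^ 8 + 1824 * j ^ 7 + 44160 * j ^ 6 + 588992 * j ^ 5 + 4676256 * j ^ 4
          + 22109472 * j ^ 3 + 57661632 * j ^ 2 + 64012032 * j) * w
                + (96 * j ^ 7 + 4960 * j ^ 6 + 109792 * j ^ 5 + 1350720 * j ^ 4 + 9981504 * j ^
          3 + 44330112 * j ^ 2 + 109589760 * j + 116328960) * (w - w ^ 2)
                + (224 * j ^ 6 + 10496 * j ^ 5 + 203904 * j ^ 4 + 2094912 * j ^ 3 + 11981952 * j
          ^ 2 + 36142848 * j + 44914176) * (w - w ^ 3)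
                + (224 * j ^ 6 + 10496 * j ^ 5 + 198144 * j ^ 4 + 1944576 * j ^ 3 + 10520064 * j
          ^ 2 + 29859840 * j + 34836480) * (w - w ^ 4)
                + (224 * j ^ 6 + 8576 * j ^ 5 + 136320 * j ^ 4 + 1152000 * j ^ 3 + 5460480 * j ^
          2 + 13768704 * j + 14432256) * (w - w ^ 5)) := by
    unfold barrierPoly
    ring
  rw [key]
  positivity

lemma barrier_poly_three {j w : ℝ} (hj : 0 ≤ j) (hw : 0 ≤ w) (hw1 : w ≤ 1) :
    0 ≤ barrierPoly (j + 6) 3 w := by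
  have h (k : ℕ) (hk : k ≠ 0) : 0 ≤ w - w ^ k := by
    have := pow_le_of_le_one hw hw1 hk
    linarith
  have h2 := h 2 (by norm_num)
  have h3 := h 3 (by norm_num)
  have h4 := h 4 (by norm_num)
  have h5 := h 5 (by norm_num)
  have h1 : 0 ≤ 1 - w := by linarith
  have key : barrierPoly (j + 6) 3 w = (1 - w) *
      ((16 * j ^ 8 + 960 * j ^ 7 + 24684 * j ^ 6 + 355316 * j ^ 5 + 3130752 * j ^ 4 + 17276760
          * j ^ 3 + 58231548 * j ^ 2 + 109376244 * j + 87392520) * (1 - w)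
                + (32 * j ^ 8 + 1696 * j ^ 7 + 37920 * j ^ 6 + 463968 * j ^ 5 + 3357504 * j ^ 4
          + 14380416 * j ^ 3 + 33778944 * j ^ 2 + 33592320 * j) * w
                + (80 * j ^ 7 + 3696 * j ^ 6 + 72868 * j ^ 5 + 796884 * j ^ 4 + 5236056 * j ^ 3
          + 20718423 * j ^ 2 + 45738918 * j + 43401015) * (w - w ^ 2)
                + (208 * j ^ 6 + 9056 * j ^ 5 + 162336 * j ^ 4 + 1515240 * j ^ 3 + 7723755 * j ^
          2 + 20369718 * j + 21749715) * (w - w ^ 3)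
                + (208 * j ^ 6 + 9056 * j ^ 5 + 151320 * j ^ 4 + 1273536 * j ^ 3 + 5780241 * j ^
          2 + 13546278 * j + 12892365) * (w - w ^ 4)
                + (208 * j ^ 6 + 6464 * j ^ 5 + 82632 * j ^ 4 + 557496 * j ^ 3 + 2097333 * j ^ 2
          + 4177170 * j + 3444525) * (w - w ^ 5)) := by
    unfold barrierPoly
    ring
  rw [key]
  positivity

lemma barrier_poly_four {j w : ℝ} (hj : 0 ≤ j) (hw : 0 ≤ w) (hw1 : w ≤ 1) :
    0 ≤ barrierPoly (j + 5) 4 w := by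
  have h (k : ℕ) (hk : k ≠ 0) : 0 ≤ w - w ^ k := by
    have := pow_le_of_le_one hw hw1 hk
    linarith
  have h2 := h 2 (by norm_num)
  have h3 := h 3 (by norm_num)
  have h4 := h 4 (by norm_num)
  have h5 := h 5 (by norm_num)
  have h1 : 0 ≤ 1 - w := by linarith
  have key : barrierPoly (j + 5) 4 w = (1 - w) *
      ((16 * j ^ 8 + 912 * j ^ 7 + 21856 * j ^ 6 + 288096 * j ^ 5 + 2284432 * j ^ 4 + 11138832
          * j ^ 3 + 32493312 * j ^ 2 + 51508224 * j + 33592320) * (1 - w)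
                + (32 * j ^ 8 + 1568 * j ^ 7 + 32064 * j ^ 6 + 354880 * j ^ 5 + 2298016 * j ^ 4
          + 8718240 * j ^ 3 + 17971200 * j ^ 2 + 15552000 * j) * w
                + (64 * j ^ 7 + 2624 * j ^ 6 + 45440 * j ^ 5 + 433792 * j ^ 4 + 2487360 * j ^ 3
          + 8633664 * j ^ 2 + 16754688 * j + 13851648) * (w - w ^ 2)
                + (192 * j ^ 6 + 7680 * j ^ 5 + 124800 * j ^ 4 + 1024512 * j ^ 3 + 4404672 * j ^
          2 + 9414144 * j + 7879680) * (w - w ^ 3)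
                + (192 * j ^ 6 + 7680 * j ^ 5 + 108672 * j ^ 4 + 731904 * j ^ 3 + 2559168 * j ^
          2 + 4499712 * j + 3151872) * (w - w ^ 4)
                + (192 * j ^ 6 + 4608 * j ^ 5 + 44160 * j ^ 4 + 218880 * j ^ 3 + 596160 * j ^ 2
          + 850176 * j + 497664) * (w - w ^ 5)) := by
    unfold barrierPoly
    ring
  rw [key]
  positivity

/-- For `n = 5` the line `L = z` covers everything except `m = 4`. There `m + n = 9`, so the
certificate has no `w` term. -/
lemma barrier_poly_five {w : ℝ} (hw : 0 ≤ w) (hw1 : w ≤ 1) :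
    0 ≤ barrierPoly (4) 5 w := by
  have h (k : ℕ) (hk : k ≠ 0) : 0 ≤ w - w ^ k := by
    have := pow_le_of_le_one hw hw1 hk
    linarith
  have h2 := h 2 (by norm_num)
  have h3 := h 3 (by norm_num)
  have h4 := h 4 (by norm_num)
  have h5 := h 5 (by norm_num)
  have h1 : 0 ≤ 1 - w := by linarith
  have key : barrierPoly (4) 5 w = (1 - w) *
      ((8363088) * (1 - w)
        + (3303585) * (w - w ^ 2)
        + (1506357) * (w - w ^ 3)
        + (303507) * (w - w ^ 4)
        + (21627) * (w - w ^ 5)) := by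
    unfold barrierPoly
    ring
  rw [key]
  positivity

/-- Clearing the positive denominator isolates the square root `orbitD` between nonnegative
quantities. Squaring then makes the subsolution condition polynomial, with `p` standing for `z L' +
m L`. -/
lemma le_orbitRhs {m n z L p : ℝ} (hm : 1 < m) (hn : 1 < n) (hz : 0 < z) (hz1 : z < 1)
    (hL : 0 ≤ L) (hL1 : L ≤ 1) (hp : 0 ≤ p)
    (h : p ^ 2 * (n * L ^ 2 * z ^ 2 + (m - 1) * (m + n * z ^ 2)) ≤
      m * (m + n - 1) * (L * z * p + (m - 1) * z * (1 - L ^ 2)) ^ 2) :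
    p ≤ z * orbitRhs m n z L := by
  have hpos := sub_pos_of_mem_unit hm hn hz.le hz1 hL hL1
  have h1 : 0 < m + n - 1 := by linarith
  have h2 : 0 < m - 1 := by linarith
  have h3 : 0 < m := by linarith
  have hL2 : 0 ≤ 1 - L ^ 2 := by nlinarith
  have h4 : p * orbitD m n z L ≤ (m + n - 1) * (L * z * p + (m - 1) * z * (1 - L ^ 2)) := by
    apply le_of_sq_le_sq _ (by positivity)
    apply le_of_mul_le_mul_left _ h3
    calc m * (p * orbitD m n z L) ^ 2 = p ^ 2 * (m * orbitD m n z L ^ 2) := by ring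
      _ = (m + n - 1) * (p ^ 2 * (n * L ^ 2 * z ^ 2 + (m - 1) * (m + n * z ^ 2))) := by
          rw [orbitD_sq hm hn]; ring
      _ ≤ (m + n - 1) * (m * (m + n - 1) * (L * z * p + (m - 1) * z * (1 - L ^ 2)) ^ 2) := by
          gcongr
      _ = _ := by ring
  rw [orbitRhs, ← mul_div_assoc, le_div_iff₀ hpos]
  linarith

/-- In the admissible dimensions there is a subsolution of the orbit equation that reaches `1`. -/
theorem exists_subsolution {m n : ℕ} (hm : 1 < m) (hn : 1 < n) (hmn : 9 ≤ m + n)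
    (hne : (m, n) ≠ (2, 7)) : ∃ L L' : ℝ → ℝ, (∀ z, HasDerivAt L (L' z) z) ∧
      (∀ z ∈ Ioo (0 : ℝ) 1, 0 ≤ L z ∧ L z ≤ 1) ∧
      (∀ z ∈ Ioo (0 : ℝ) 1, z * L' z + m * L z ≤ z * orbitRhs m n z (L z)) ∧ L 1 = 1 := by
  have hm' : (1 : ℝ) < m := by exact_mod_cast hm
  have hn' : (1 : ℝ) < n := by exact_mod_cast hn
  -- Linearised at `z = β = 1`, a subsolution of slope `σ` needs `(m+n) σ²/m - (m+n-3) σ + m ≤ 0`.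
  -- For `σ = 1` this is exactly the case condition.
  by_cases hcase : 4 * m ≤ n * (m - 1)
  · have hcase' : (4 : ℝ) * m ≤ n * (m - 1) := by
      have : ((4 * m : ℕ) : ℝ) ≤ ((n * (m - 1) : ℕ) : ℝ) := by exact_mod_cast hcase
      rw [Nat.cast_mul, Nat.cast_mul, Nat.cast_sub hm.le] at this
      exact_mod_cast this
    refine ⟨fun z => z, fun _ => 1, fun z => hasDerivAt_id z, fun z hz => ⟨hz.1.le, hz.2.le⟩,
      fun z hz => ?_, rfl⟩
    have hz0 := hz.1
    apply le_orbitRhs hm' hn' hz.1 hz.2 hz.1.le hz.2.le (by positivity)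
    have hz2 : 0 ≤ 1 - z ^ 2 := by nlinarith [hz.1, hz.2]
    have h1 : (0 : ℝ) ≤ m - 1 := by linarith
    have h2 : (0 : ℝ) ≤ n * (m - 1) - 4 * m := by linarith
    have key : m * ((m : ℝ) + n - 1) * (z * z * (z * 1 + m * z) + (m - 1) * z * (1 - z ^ 2)) ^ 2 -
        (z * 1 + m * z) ^ 2 * (n * z ^ 2 * z ^ 2 + (m - 1) * (m + n * z ^ 2)) =
        z ^ 2 * (1 - z ^ 2) * (m - 1) * (n * (m - 1) - 4 * m) * (m + z ^ 2) := by ring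
    have : 0 ≤ z ^ 2 * (1 - z ^ 2) * (m - 1) * (n * (m - 1) - 4 * m) * ((m : ℝ) + z ^ 2) := by
      positivity
    linarith
  · have hpoly : ∀ w : ℝ, 0 ≤ w → w ≤ 1 → 0 ≤ barrierPoly m n w := by
      intro w hw hw1
      -- If `n ≥ 6`, then `4 m ≤ n (m - 1)` can fail only for `m = 2` and `n = 6` or `7`. The first
      -- has `m + n < 9`; the second is excluded by hypothesis.
      have hn5 : n ≤ 5 := by
        by_contra h6
        obtain ⟨k, rfl⟩ : ∃ k, m = k + 2 := ⟨m - 2, by omega⟩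
        obtain ⟨l, rfl⟩ : ∃ l, n = l + 6 := ⟨n - 6, by omega⟩
        apply hcase
        rw [show k + 2 - 1 = k + 1 by omega]
        rcases Nat.eq_zero_or_pos k with rfl | hk
        · have : l ≠ 1 := fun h => hne (by rw [h])
          omega
        · nlinarith
      have hcast : ∀ M : ℕ, M ≤ m → ∃ j : ℝ, 0 ≤ j ∧ (m : ℝ) = j + M := fun M hM =>
        ⟨m - M, by simpa using hM, by ring⟩
      interval_cases n
      · obtain ⟨j, hj, hmj⟩ := hcast 7 (by omega)
        rw [hmj]; exact_mod_cast barrier_poly_two hj hw hw1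
      · obtain ⟨j, hj, hmj⟩ := hcast 6 (by omega)
        rw [hmj]; exact_mod_cast barrier_poly_three hj hw hw1
      · obtain ⟨j, hj, hmj⟩ := hcast 5 (by omega)
        rw [hmj]; exact_mod_cast barrier_poly_four hj hw hw1
      · have : m = 4 := by omega
        rw [this]; exact_mod_cast barrier_poly_five hw hw1
    -- This keeps both coefficients of the cubic barrier nonnegative, so the barrier lies between
    -- `0` and `1` and is increasing.
    have h2mn : (n : ℝ) ≤ 2 * m := by
      by_contra hcon
      push Not at hcon
      have h2 : 2 * m < n := by exact_mod_cast hcon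
      apply hcase
      obtain ⟨k, rfl⟩ : ∃ k, m = k + 2 := ⟨m - 2, by omega⟩
      rw [show k + 2 - 1 = k + 1 by omega]
      rcases Nat.eq_zero_or_pos k with rfl | hk
      · have : n ≠ 7 := fun h => hne (by rw [h])
        omega
      · nlinarith
    have hm0 : (0 : ℝ) < m := by linarith
    have hn0 : (0 : ℝ) < n := by linarith
    have hc : (0 : ℝ) ≤ 2 * m - n := by linarith
    have hd : (0 : ℝ) < 2 * (m + n) := by positivity
    -- The odd cubic with value `1` and slope `3 m / (m + n)` at `z = 1`. For `m + n = 9` this slope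
    -- is the double root `m / 3` of the linearised condition; for larger `m + n` it lies between
    -- the two roots.
    refine ⟨fun z => z * (3 * n + (2 * m - n) * z ^ 2) / (2 * (m + n)),
      fun z => (3 * n + 3 * (2 * m - n) * z ^ 2) / (2 * (m + n)), fun z => ?_, fun z hz => ?_,
      fun z hz => ?_, ?_⟩
    · have h1 := ((hasDerivAt_id z).fun_mul (((hasDerivAt_pow 2 z).const_mul
        (2 * (m : ℝ) - n)).const_add (3 * (n : ℝ)))).div_const (2 * ((m : ℝ) + n))
      refine h1.congr_deriv ?_
      simp only [id]
      push_cast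
      ring
    · have hz0 := hz.1
      refine ⟨by positivity, ?_⟩
      rw [div_le_one hd]
      have hz2 : z ^ 2 ≤ 1 := by nlinarith [hz.1, hz.2]
      calc z * (3 * n + (2 * m - n) * z ^ 2) ≤ 1 * (3 * n + (2 * m - n) * 1) := by
            gcongr
            exact hz.2.le
        _ = 2 * (m + n) := by ring
    · have hz0 := hz.1
      have hz2 : z ^ 2 ≤ 1 := by nlinarith [hz.1, hz.2]
      apply le_orbitRhs hm' hn' hz.1 hz.2 (by positivity) _ (by positivity)
      · have h1 := hpoly (z ^ 2) (by positivity) hz2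
        have key : m * ((m : ℝ) + n - 1) * (z * (3 * n + (2 * m - n) * z ^ 2) / (2 * (m + n)) * z *
            (z * ((3 * n + 3 * (2 * m - n) * z ^ 2) / (2 * (m + n))) +
              m * (z * (3 * n + (2 * m - n) * z ^ 2) / (2 * (m + n)))) +
            (m - 1) * z * (1 - (z * (3 * n + (2 * m - n) * z ^ 2) / (2 * (m + n))) ^ 2)) ^ 2 -
          (z * ((3 * n + 3 * (2 * m - n) * z ^ 2) / (2 * (m + n))) +
              m * (z * (3 * n + (2 * m - n) * z ^ 2) / (2 * (m + n)))) ^ 2 *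
            (n * (z * (3 * n + (2 * m - n) * z ^ 2) / (2 * (m + n))) ^ 2 * z ^ 2 +
              (m - 1) * (m + n * z ^ 2)) =
          z ^ 2 * barrierPoly m n (z ^ 2) / (2 * (m + n)) ^ 4 := by
          unfold barrierPoly
          field_simp
          ring
        have : 0 ≤ z ^ 2 * barrierPoly m n (z ^ 2) / (2 * (m + n)) ^ 4 := by positivity
        linarith
      · rw [div_le_one hd]
        calc z * (3 * n + (2 * m - n) * z ^ 2) ≤ 1 * (3 * n + (2 * m - n) * 1) := by
              gcongr
              exact hz.2.le
          _ = 2 * (m + n) := by ring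
    · simp only
      field_simp
      ring

end Barrier

/-! ### Expanding solutions as a first order system for `(a, b, ḃ)` -/

section Flow

/-- The first order system satisfied by `(a, b, ḃ)` on an expanding vacuum solution. -/
def flowField (m n : ℕ) (s : ℝ × ℝ × ℝ) : ℝ × ℝ × ℝ :=
  (orbitX m n (s.1 / s.2.1) s.2.2, s.2.2,
    ((m : ℝ) + n - 1 - s.2.2 * (m * orbitX m n (s.1 / s.2.1) s.2.2 * s.2.1 / s.1
      + (n - 1) * s.2.2)) / s.2.1)

/-- The region in which the scale factors are positive. -/
def flowDomain : Set (ℝ × ℝ × ℝ) := {s | 0 < s.1 ∧ 0 < s.2.1}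

/-- The curve `s = (a, b, ḃ)` describes an expanding solution on the open interval `I`. -/
structure IsFlow (m n : ℕ) (I : Set ℝ) (s : ℝ → ℝ × ℝ × ℝ) : Prop where
  isOpen : IsOpen I
  nonempty : I.Nonempty
  ordConnected : I.OrdConnected
  mem : ∀ t ∈ I, s t ∈ flowDomain
  hasDerivAt : ∀ t ∈ I, HasDerivAt s (flowField m n (s t)) t

lemma isOpen_flowDomain : IsOpen flowDomain :=
  (isOpen_lt continuous_const continuous_fst).inter
    (isOpen_lt continuous_const (continuous_fst.comp continuous_snd))

lemma flowField_contDiffOn {m n : ℕ} (hm : 1 < m) (hn : 1 < n) :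
    ContDiffOn ℝ ∞ (flowField m n) flowDomain := by
  have hm' : (1 : ℝ) < m := by exact_mod_cast hm
  have hn' : (1 : ℝ) < n := by exact_mod_cast hn
  have hz : ContDiffOn ℝ ∞ (fun s : ℝ × ℝ × ℝ => (s.1 / s.2.1, s.2.2)) flowDomain := by
    refine ContDiffOn.prodMk (ContDiffOn.div (by fun_prop) (by fun_prop) ?_) (by fun_prop)
    exact fun s hs => hs.2.ne'
  have hX : ContDiffOn ℝ ∞ (fun s : ℝ × ℝ × ℝ => orbitX m n (s.1 / s.2.1) s.2.2) flowDomain :=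
    (orbitX_contDiff hm' hn').comp_contDiffOn hz
  refine hX.prodMk (ContDiffOn.prodMk (by fun_prop) ?_)
  refine ContDiffOn.div ?_ (by fun_prop) fun s hs => hs.2.ne'
  have h1 : ContDiffOn ℝ ∞ (fun s : ℝ × ℝ × ℝ =>
      m * orbitX m n (s.1 / s.2.1) s.2.2 * s.2.1 / s.1) flowDomain :=
    ContDiffOn.div (by fun_prop) (by fun_prop) fun s hs => hs.1.ne'
  fun_prop

/-- Solutions of a smooth autonomous differential equation are smooth. -/
lemma contDiffOn_of_hasDerivAt {E : Type*} [NormedAddCommGroup E] [NormedSpace ℝ E]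
    {F : E → E} {U : Set E} (hF : ContDiffOn ℝ ∞ F U) {I : Set ℝ} (hI : IsOpen I) {s : ℝ → E}
    (hs : ∀ t ∈ I, s t ∈ U) (hd : ∀ t ∈ I, HasDerivAt s (F (s t)) t) : ContDiffOn ℝ ∞ s I := by
  rw [contDiffOn_infty]
  intro k
  induction k with
  | zero =>
    rw [Nat.cast_zero, contDiffOn_zero]
    exact fun t ht => (hd t ht).continuousAt.continuousWithinAt
  | succ k ih =>
    have h1 : ((k + 1 : ℕ) : WithTop ℕ∞) = (k : WithTop ℕ∞) + 1 := by push_cast; rfl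
    rw [h1, contDiffOn_succ_iff_deriv_of_isOpen hI]
    refine ⟨fun t ht => (hd t ht).differentiableAt.differentiableWithinAt, by simp, ?_⟩
    have h2 : ContDiffOn ℝ k (F ∘ s) I := (hF.of_le (by exact_mod_cast le_top)).comp ih hs
    exact h2.congr fun t ht => (hd t ht).deriv

section

variable {m n : ℕ} {I : Set ℝ} {s : ℝ → ℝ × ℝ × ℝ}

lemma IsFlow.hasDerivAt_fst (h : IsFlow m n I s) {t : ℝ} (ht : t ∈ I) :
    HasDerivAt (fun t => (s t).1) (orbitX m n ((s t).1 / (s t).2.1) (s t).2.2) t :=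
  (ContinuousLinearMap.fst ℝ ℝ (ℝ × ℝ)).hasFDerivAt.comp_hasDerivAt t (h.hasDerivAt t ht)

lemma IsFlow.hasDerivAt_snd (h : IsFlow m n I s) {t : ℝ} (ht : t ∈ I) :
    HasDerivAt (fun t => (s t).2.1) (s t).2.2 t :=
  ((ContinuousLinearMap.fst ℝ ℝ ℝ).comp
    (ContinuousLinearMap.snd ℝ ℝ (ℝ × ℝ))).hasFDerivAt.comp_hasDerivAt t (h.hasDerivAt t ht)

lemma IsFlow.hasDerivAt_trd (h : IsFlow m n I s) {t : ℝ} (ht : t ∈ I) :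
    HasDerivAt (fun t => (s t).2.2) (((m : ℝ) + n - 1 - (s t).2.2 *
      (m * orbitX m n ((s t).1 / (s t).2.1) (s t).2.2 * (s t).2.1 / (s t).1
      + (n - 1) * (s t).2.2)) / (s t).2.1) t :=
  ((ContinuousLinearMap.snd ℝ ℝ ℝ).comp
    (ContinuousLinearMap.snd ℝ ℝ (ℝ × ℝ))).hasFDerivAt.comp_hasDerivAt t (h.hasDerivAt t ht)

lemma IsFlow.hasDerivAt_ratio (h : IsFlow m n I s) {t : ℝ} (ht : t ∈ I) :
    HasDerivAt (fun t => (s t).1 / (s t).2.1)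
      ((orbitX m n ((s t).1 / (s t).2.1) (s t).2.2 - (s t).2.2 * ((s t).1 / (s t).2.1))
        / (s t).2.1) t := by
  have hb := (h.mem t ht).2.ne'
  refine ((h.hasDerivAt_fst ht).fun_div (h.hasDerivAt_snd ht) hb).congr_deriv ?_
  field_simp

/-- `orbitD` is `m - 1` times the first derivative of the reduced scale factor, so its time
derivative is proportional to the acceleration and carries the factor `1 - ḃ²`. -/
lemma IsFlow.hasDerivAt_orbitD (hm : 1 < m) (hn : 1 < n) (h : IsFlow m n I s) {t : ℝ}
    (ht : t ∈ I) : HasDerivAt (fun t => orbitD m n ((s t).1 / (s t).2.1) (s t).2.2)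
      (n * ((m : ℝ) + n - 1) / m * ((s t).1 / (s t).2.1) ^ 2 * (1 - (s t).2.2 ^ 2) / (s t).1) t := by
  have hm' : (1 : ℝ) < m := by exact_mod_cast hm
  have hn' : (1 : ℝ) < n := by exact_mod_cast hn
  have ha := (h.mem t ht).1
  have hb := (h.mem t ht).2
  have hz := h.hasDerivAt_ratio ht
  have hβ := h.hasDerivAt_trd ht
  have hz0 : (s t).1 = (s t).1 / (s t).2.1 * (s t).2.1 := by field_simp
  have hzpos : 0 < (s t).1 / (s t).2.1 := div_pos ha hb
  have hrad := orbitD_radicand_pos hm' hn' ((s t).1 / (s t).2.1) (s t).2.2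
  have hD := orbitD_pos hm' hn' ((s t).1 / (s t).2.1) (s t).2.2
  have hX := orbitX_mul hm' hn' ((s t).1 / (s t).2.1) (s t).2.2
  have h1 := ((((hβ.fun_pow 2).const_mul (n : ℝ)).fun_mul (hz.fun_pow 2)).fun_add
    ((((hz.fun_pow 2).const_mul (n : ℝ)).const_add (m : ℝ)).const_mul ((m : ℝ) - 1))).const_mul
      (((m : ℝ) + n - 1) / m)
  have h2 := h1.sqrt hrad.ne'
  refine h2.congr_deriv ?_
  rw [← orbitD]
  generalize hx : orbitX m n ((s t).1 / (s t).2.1) (s t).2.2 = x at *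
  generalize hDD : orbitD m n ((s t).1 / (s t).2.1) (s t).2.2 = D at *
  generalize (s t).1 / (s t).2.1 = z at *
  generalize (s t).2.2 = β at *
  rw [hz0]
  generalize (s t).2.1 = b at *
  have hm0 : (m : ℝ) ≠ 0 := by positivity
  rw [div_eq_iff (by positivity)]
  have hD0 := hD.ne'
  field_simp
  push_cast
  ring_nf
  rw [← hX]
  ring

lemma IsFlow.expanding (hm : 1 < m) (hn : 1 < n) (h : IsFlow m n I s) {t : ℝ} (ht : t ∈ I) :
    0 < m * (deriv (fun t => (s t).1) t / (s t).1) +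
      n * (deriv (fun t => (s t).2.1) t / (s t).2.1) := by
  have hm' : (1 : ℝ) < m := by exact_mod_cast hm
  have hn' : (1 : ℝ) < n := by exact_mod_cast hn
  have ha := (h.mem t ht).1
  have hb := (h.mem t ht).2
  have h1 := orbitX_expanding hm' hn' ((s t).1 / (s t).2.1) (s t).2.2
  rw [(h.hasDerivAt_fst ht).deriv, (h.hasDerivAt_snd ht).deriv]
  have h2 : 0 < (m * orbitX m n ((s t).1 / (s t).2.1) (s t).2.2 +
    n * ((s t).2.2 * ((s t).1 / (s t).2.1))) / (s t).1 := by positivity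
  convert h2 using 1
  field_simp

/-- The flow contains no equation for `ä`. It is recovered by differentiating `ȧ = (D - n β z) / (m
- 1)`, that is, by propagating the constraint. -/
lemma IsFlow.hasDerivAt_deriv_fst (hm : 1 < m) (hn : 1 < n) (h : IsFlow m n I s) {t : ℝ}
    (ht : t ∈ I) : HasDerivAt (deriv fun t => (s t).1)
      (((m : ℝ) + n - 1 - orbitX m n ((s t).1 / (s t).2.1) (s t).2.2 *
        orbitD m n ((s t).1 / (s t).2.1) (s t).2.2) / (s t).1) t := by
  have hm' : (1 : ℝ) < m := by exact_mod_cast hm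
  have hn' : (1 : ℝ) < n := by exact_mod_cast hn
  have ha := (h.mem t ht).1
  have hb := (h.mem t ht).2
  have h1 : deriv (fun t => (s t).1) =ᶠ[𝓝 t]
      fun t => orbitX m n ((s t).1 / (s t).2.1) (s t).2.2 := by
    filter_upwards [h.isOpen.mem_nhds ht] with u hu
    exact (h.hasDerivAt_fst hu).deriv
  have h2 := ((h.hasDerivAt_orbitD hm hn ht).fun_sub
    (((h.hasDerivAt_trd ht).const_mul (n : ℝ)).fun_mul (h.hasDerivAt_ratio ht))).div_const
      ((m : ℝ) - 1)
  refine (h2.congr_of_eventuallyEq h1).congr_deriv ?_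
  have hC := orbitX_constraint hm' hn' ((s t).1 / (s t).2.1) (s t).2.2
  have hX := orbitX_mul hm' hn' ((s t).1 / (s t).2.1) (s t).2.2
  have hz0 : (s t).1 = (s t).1 / (s t).2.1 * (s t).2.1 := by field_simp
  have hzpos : 0 < (s t).1 / (s t).2.1 := div_pos ha hb
  rw [← hX]
  generalize hx : orbitX m n ((s t).1 / (s t).2.1) (s t).2.2 = x at *
  generalize (s t).1 / (s t).2.1 = z at *
  generalize (s t).2.2 = β at *
  rw [hz0]
  generalize (s t).2.1 = b at *
  have hm0 : (m : ℝ) ≠ 0 := by positivity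
  have hm1 : (m : ℝ) - 1 ≠ 0 := by linarith
  field_simp
  linear_combination ((m : ℝ) - 1) * hC

/-- Once `ä` and `b̈` are substituted, the two spatial equations are identities and the time
equation is the constraint. -/
theorem IsFlow.isSol (hm : 1 < m) (hn : 1 < n) (h : IsFlow m n I s) :
    IsSol m n I (fun t => (s t).1) (fun t => (s t).2.1) := by
  have hm' : (1 : ℝ) < m := by exact_mod_cast hm
  have hn' : (1 : ℝ) < n := by exact_mod_cast hn
  have hs := contDiffOn_of_hasDerivAt (flowField_contDiffOn hm hn) h.isOpen h.mem h.hasDerivAt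
  have hbb : ∀ t ∈ I, HasDerivAt (deriv fun t => (s t).2.1) _ t := fun t ht =>
    (h.hasDerivAt_trd ht).congr_of_eventuallyEq (by
      filter_upwards [h.isOpen.mem_nhds ht] with u hu
      exact (h.hasDerivAt_snd hu).deriv)
  refine ⟨h.isOpen, h.nonempty, h.ordConnected, contDiff_fst.comp_contDiffOn hs,
    contDiff_fst.comp_contDiffOn (contDiff_snd.comp_contDiffOn hs), fun t ht => (h.mem t ht).1,
    fun t ht => (h.mem t ht).2, fun t ht => ?_, fun t ht => ?_, fun t ht => ?_⟩
  all_goals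
    have ha := (h.mem t ht).1
    have hb := (h.mem t ht).2
    have hC := orbitX_constraint hm' hn' ((s t).1 / (s t).2.1) (s t).2.2
    have hX := orbitX_mul hm' hn' ((s t).1 / (s t).2.1) (s t).2.2
    simp only [(h.hasDerivAt_deriv_fst hm hn ht).deriv, (hbb t ht).deriv,
      (h.hasDerivAt_fst ht).deriv, (h.hasDerivAt_snd ht).deriv, ← hX]
    generalize orbitX m n ((s t).1 / (s t).2.1) (s t).2.2 = x at *
    generalize (s t).2.2 = β at *
    field_simp
    try field_simp at hC
  · linear_combination -hC
  · ring
  · ring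

/-- An expanding solution satisfies the first order system. -/
theorem IsSol.isFlow (hm : 1 < m) (hn : 1 < n) {a b : ℝ → ℝ} (h : IsSol m n I a b)
    (hS : ∀ t ∈ I, 0 < m * (deriv a t / a t) + n * (deriv b t / b t)) :
    IsFlow m n I (fun t => (a t, b t, deriv b t)) := by
  have hm' : (1 : ℝ) < m := by exact_mod_cast hm
  have hn' : (1 : ℝ) < n := by exact_mod_cast hn
  refine ⟨h.isOpen, h.nonempty, h.ordConnected, fun t ht => ⟨h.pos_a t ht, h.pos_b t ht⟩,
    fun t ht => ?_⟩
  have ha := h.pos_a t ht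
  have hb := h.pos_b t ht
  have da := (differentiableAt_of_smooth h.isOpen h.smooth_a ht).hasDerivAt
  have db := (differentiableAt_of_smooth h.isOpen h.smooth_b ht).hasDerivAt
  have ddb := (differentiableAt_deriv_of_smooth h.isOpen h.smooth_b ht).hasDerivAt
  have e1 := h.eq_time t ht
  have e2 := h.eq_a t ht
  have e3 := h.eq_b t ht
  have hSt := hS t ht
  -- A combination of the three equations eliminates the second derivatives and leaves the
  -- constraint; expansion then picks the root.
  have hx : deriv a t = orbitX m n (a t / b t) (deriv b t) := by
    apply eq_orbitX hm' hn'
    · have : m * deriv a t + n * (deriv b t * (a t / b t)) =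
        a t * (m * (deriv a t / a t) + n * (deriv b t / b t)) := by field_simp
      rw [this]
      positivity
    · field_simp at e1 e2 e3 ⊢
      linear_combination m * b t * e2 + n * a t * e3 - a t * b t * e1
  refine (da.prodMk (db.prodMk ddb)).congr_deriv ?_
  simp only [flowField, ← hx]
  refine Prod.ext rfl (Prod.ext rfl ?_)
  field_simp at e3 ⊢
  linear_combination e3

end

end Flow

/-! ### Inverse functions and primitives on an interval -/

section Calculus

/-- The inverse of a function with positive derivative on an open interval. -/
lemma exists_inverse_of_deriv_pos {T T' : ℝ → ℝ} {I : Set ℝ} (hI : IsOpen I) (hc : I.OrdConnected)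
    (hT : ∀ t ∈ I, HasDerivAt T (T' t) t) (hpos : ∀ t ∈ I, 0 < T' t) :
    StrictMonoOn T I ∧ IsOpen (T '' I) ∧ ∃ S : ℝ → ℝ, ∀ t ∈ I, S (T t) = t ∧
      HasDerivAt S (T' t)⁻¹ (T t) := by
  have hcont : ContinuousOn T I := fun t ht => (hT t ht).continuousAt.continuousWithinAt
  have hmono : StrictMonoOn T I := by
    apply strictMonoOn_of_deriv_pos hc.convex hcont
    rw [hI.interior_eq]
    intro t ht
    rw [(hT t ht).deriv]
    exact hpos t ht
  have hnhds : ∀ t ∈ I, T '' I ∈ 𝓝 (T t) := by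
    intro t ht
    obtain ⟨ε, hε, hball⟩ := Metric.isOpen_iff.mp hI t ht
    rw [Real.ball_eq_Ioo] at hball
    have h1 : t - ε / 2 ∈ I := hball ⟨by linarith, by linarith⟩
    have h2 : t + ε / 2 ∈ I := hball ⟨by linarith, by linarith⟩
    have hsub : Icc (t - ε / 2) (t + ε / 2) ⊆ I := hc.out h1 h2
    have h3 := intermediate_value_Ioo (by linarith : t - ε / 2 ≤ t + ε / 2) (hcont.mono hsub)
    exact mem_of_superset (Ioo_mem_nhds (hmono h1 ht (by linarith)) (hmono ht h2 (by linarith)))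
      (h3.trans (image_mono (Ioo_subset_Icc_self.trans hsub)))
  have hopen : IsOpen (T '' I) := by
    rw [isOpen_iff_mem_nhds]
    rintro _ ⟨t, ht, rfl⟩
    exact hnhds t ht
  refine ⟨hmono, hopen, Function.invFunOn T I, fun t ht => ?_⟩
  have hS : ∀ u ∈ I, Function.invFunOn T I (T u) = u := fun u hu =>
    hmono.injOn.leftInvOn_invFunOn hu
  refine ⟨hS t ht, ?_⟩
  have himage : Function.invFunOn T I '' (T '' I) = I := by
    ext u
    constructor
    · rintro ⟨_, ⟨v, hv, rfl⟩, rfl⟩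
      rwa [hS v hv]
    · exact fun hu => ⟨T u, ⟨u, hu, rfl⟩, hS u hu⟩
  have hSmono : StrictMonoOn (Function.invFunOn T I) (T '' I) := by
    rintro _ ⟨u, hu, rfl⟩ _ ⟨v, hv, rfl⟩ huv
    rw [hS u hu, hS v hv]
    exact (hmono.lt_iff_lt hu hv).mp huv
  have hScont : ContinuousAt (Function.invFunOn T I) (T t) := by
    apply hSmono.continuousAt_of_image_mem_nhds (hnhds t ht)
    rw [himage, hS t ht]
    exact hI.mem_nhds ht
  apply HasDerivAt.of_local_left_inverse hScont (by rw [hS t ht]; exact hT t ht) (hpos t ht).ne'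
  filter_upwards [hnhds t ht] with y hy
  obtain ⟨u, hu, rfl⟩ := hy
  rw [hS u hu]

/-- No control at `1` is assumed, since the integrands used for `b` and `T` have a denominator that
tends to zero there. Continuity at `0` is kept for the initial values. -/
lemma integral_Ico {f : ℝ → ℝ} (hf : ContinuousOn f (Ico 0 1)) :
    ContinuousOn (fun z => ∫ s in (0 : ℝ)..z, f s) (Ico 0 1) ∧
      ∀ z ∈ Ioo (0 : ℝ) 1, HasDerivAt (fun z => ∫ s in (0 : ℝ)..z, f s) (f z) z := by
  have hint : ∀ z ∈ Ico (0 : ℝ) 1, IntervalIntegrable f MeasureTheory.volume 0 z := by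
    intro z hz
    apply ContinuousOn.intervalIntegrable
    rw [uIcc_of_le hz.1]
    exact hf.mono fun w hw => ⟨hw.1, hw.2.trans_lt hz.2⟩
  constructor
  · intro z hz
    have hz' : (1 + z) / 2 ∈ Ico (0 : ℝ) 1 := ⟨by linarith [hz.1], by linarith [hz.2]⟩
    have h1 := intervalIntegral.continuousOn_primitive_interval'
      (hint _ hz') (left_mem_uIcc)
    rw [uIcc_of_le hz'.1] at h1
    refine (h1 z ⟨hz.1, by linarith [hz.2]⟩).mono_of_mem_nhdsWithin ?_
    have : Iio ((1 + z) / 2) ∈ 𝓝[Ico 0 1] z :=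
      mem_nhdsWithin_of_mem_nhds (Iio_mem_nhds (by linarith [hz.2]))
    filter_upwards [this, self_mem_nhdsWithin] with w hw hw'
    exact ⟨hw'.1, le_of_lt hw⟩
  · intro z hz
    have hc : ∀ w ∈ Ioo (0 : ℝ) 1, ContinuousAt f w := fun w hw =>
      hf.continuousAt (Ico_mem_nhds hw.1 hw.2)
    apply intervalIntegral.integral_hasDerivAt_right (hint z ⟨hz.1.le, hz.2⟩) _ (hc z hz)
    exact ContinuousOn.stronglyMeasurableAtFilter isOpen_Ioo
      (fun w hw => (hc w hw).continuousWithinAt) z hz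

end Calculus

/-! ### The solution carried by the regular orbit -/

section Construction

/-- The expanding solution whose orbit is the regular one. -/
structure IsRegularFlow (m n : ℕ) (B : ℝ → ℝ) (s : ℝ → ℝ × ℝ × ℝ) : Prop where
  orbit : IsOrbitFunction m n B
  flow : IsFlow m n (Ioi 0) s
  ratio_mem : ∀ t ∈ Ioi (0 : ℝ), (s t).1 / (s t).2.1 ∈ Ioo (0 : ℝ) 1
  eq_orbit : ∀ t ∈ Ioi (0 : ℝ), (s t).2.2 = B ((s t).1 / (s t).2.1)
  surj : ∀ z ∈ Ioo (0 : ℝ) 1, ∃ t ∈ Ioi (0 : ℝ), (s t).1 / (s t).2.1 = z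
  ratio_zero : Tendsto (fun t => (s t).1 / (s t).2.1) (𝓝[>] 0) (𝓝 0)
  fst_zero : Tendsto (fun t => (s t).1) (𝓝[>] 0) (𝓝 0)
  ratio_top : Tendsto (fun t => (s t).1 / (s t).2.1) atTop (𝓝 1)
  trd_top : Tendsto (fun t => (s t).2.2) atTop (𝓝 1)

/-- This is the factorisation `orbitD_mul` with `orbitD` bounded below by its value at `z = β = 0`.
It bounds `ż` near `z = β = 1`. -/
lemma exists_orbitX_sub_le {m n : ℝ} (hm : 1 < m) (hn : 1 < n) : ∃ C : ℝ, 0 < C ∧ ∀ z β : ℝ, 0 ≤ z →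
    0 ≤ β → 0 < orbitX m n z β - β * z →
      orbitX m n z β - β * z ≤ C * (m + n * z ^ 2 - (m + n) * β ^ 2 * z ^ 2) := by
  have h1 : 0 < m - 1 := by linarith
  have h2 : 0 < m + n - 1 := by linarith
  have h3 : 0 < m := by linarith
  have hD0 : 0 < √((m + n - 1) * (m - 1)) := Real.sqrt_pos.mpr (by positivity)
  refine ⟨(m + n - 1) / (m * √((m + n - 1) * (m - 1))), by positivity, fun z β hz hβ hpos => ?_⟩
  have hD : √((m + n - 1) * (m - 1)) ≤ orbitD m n z β := by
    apply Real.sqrt_le_sqrt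
    rw [div_mul_eq_mul_div, le_div_iff₀ h3]
    have : 0 ≤ n * β ^ 2 * z ^ 2 + (m - 1) * (n * z ^ 2) := by
      have : 0 < n := by linarith
      positivity
    nlinarith
  have h4 := orbitD_mul hm hn z β
  rw [← orbitX_sub hm hn] at h4
  rw [div_mul_eq_mul_div, le_div_iff₀ (by positivity)]
  have h5 : (orbitX m n z β - β * z) * (m * (orbitD m n z β + (m + n - 1) * β * z)) =
      (m + n - 1) * (m + n * z ^ 2 - (m + n) * β ^ 2 * z ^ 2) := by
    apply mul_left_cancel₀ h1.ne'
    linarith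
  rw [← h5]
  have h6 : 0 ≤ (m + n - 1) * β * z := by positivity
  gcongr
  linarith

/-- The scale factor `b` and the time `T` along the regular orbit, as functions of `a / b`. -/
lemma exists_time {m : ℕ} {n : ℝ} (hm : 1 < m) (hn : 1 < n) {B : ℝ → ℝ}
    (hB : IsOrbitFunction m n B) : ∃ b T : ℝ → ℝ, (∀ z, 0 < b z) ∧ ContinuousOn b (Ico 0 1) ∧
      (∀ z ∈ Ioo (0 : ℝ) 1, 1 ≤ b z) ∧ T 0 = 0 ∧ ContinuousOn T (Ico 0 1) ∧
      ∀ z ∈ Ioo (0 : ℝ) 1, HasDerivAt b (b z * (B z / (orbitX m n z (B z) - B z * z))) z ∧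
        HasDerivAt T (b z / (orbitX m n z (B z) - B z * z)) z := by
  have hm' : (1 : ℝ) < m := by exact_mod_cast hm
  -- The value of `B` at `0` is arbitrary, so it is replaced by the limit `0` to have integrands
  -- continuous on `[0, 1)`.
  obtain ⟨B₀, hB₀eq, hB₀0⟩ : ∃ B₀ : ℝ → ℝ, (∀ z ∈ Ioo (0 : ℝ) 1, B₀ z = B z) ∧
      ContinuousOn B₀ (Ico 0 1) ∧ ∀ z ∈ Ico (0 : ℝ) 1, B₀ z ∈ Ico (0 : ℝ) 1 := by
    have hB₀eq : ∀ z ∈ Ioo (0 : ℝ) 1, Function.update B 0 0 z = B z := fun z hz =>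
      Function.update_of_ne hz.1.ne' _ _
    refine ⟨Function.update B 0 0, hB₀eq, fun z hz => ?_, fun z hz => ?_⟩
    · rcases hz.1.eq_or_lt with h | h
      · rw [← h, continuousWithinAt_update_same]
        exact hB.tendsto.mono_left
          (nhdsWithin_mono _ fun w hw => lt_of_le_of_ne hw.1.1 (Ne.symm hw.2))
      · have h1 : Function.update B 0 0 =ᶠ[𝓝 z] B := by
          filter_upwards [Ioo_mem_nhds h hz.2] with w hw using hB₀eq w hw
        exact ((hB.deriv z ⟨h, hz.2⟩).continuousAt.congr h1.symm).continuousWithinAt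
    · rcases hz.1.eq_or_lt with h | h
      · simp [← h]
      · rw [hB₀eq z ⟨h, hz.2⟩]
        exact ⟨(hB.pos z ⟨h, hz.2⟩).le, hB.lt_one z ⟨h, hz.2⟩⟩
  obtain ⟨hB₀cont, hB₀mem⟩ := hB₀0
  have hδpos : ∀ z ∈ Ico (0 : ℝ) 1, 0 < orbitX m n z (B₀ z) - B₀ z * z := by
    intro z hz
    have h1 := sub_pos_of_mem_unit hm' hn hz.1 hz.2 (hB₀mem z hz).1 (hB₀mem z hz).2.le
    rw [← orbitX_sub hm' hn] at h1
    exact pos_of_mul_pos_right h1 (by linarith)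
  have hδcont : ContinuousOn (fun z => orbitX m n z (B₀ z) - B₀ z * z) (Ico 0 1) := by
    have hXc : Continuous fun p : ℝ × ℝ => orbitX m n p.1 p.2 := (orbitX_contDiff hm' hn).continuous
    have h0 : ContinuousOn (fun z => (z, B₀ z)) (Ico 0 1) := (continuousOn_id' _).prodMk hB₀cont
    have h1 := hXc.comp_continuousOn h0
    have h2 := hB₀cont.mul (continuousOn_id' _)
    exact (h1.sub h2).congr fun z _ => rfl
  obtain ⟨δ, hδ⟩ : ∃ δ : ℝ → ℝ, δ = fun z => orbitX m n z (B₀ z) - B₀ z * z := ⟨_, rfl⟩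
  rw [← hδ] at hδcont
  have hδpos' : ∀ z ∈ Ico (0 : ℝ) 1, 0 < δ z := by rw [hδ]; exact hδpos
  have hBδ : ContinuousOn (fun z => B₀ z / δ z) (Ico 0 1) :=
    hB₀cont.div hδcont fun z hz => (hδpos' z hz).ne'
  obtain ⟨hb1, hb2⟩ := integral_Ico hBδ
  -- With `ż = δ / b` and `ḃ = B`, one has `d log b / dz = B / δ` and `dT / dz = b / δ`. The
  -- primitives are normalised by `b = 1` and `T = 0` at `z = 0`.
  obtain ⟨G, hG⟩ : ∃ G : ℝ → ℝ, G = fun z => ∫ s in (0 : ℝ)..z, B₀ s / δ s := ⟨_, rfl⟩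
  rw [← hG] at hb1 hb2
  have hbcont : ContinuousOn (fun z => Real.exp (G z)) (Ico 0 1) :=
    Real.continuous_exp.comp_continuousOn hb1
  have hbδ : ContinuousOn (fun z => Real.exp (G z) / δ z) (Ico 0 1) :=
    hbcont.div hδcont fun z hz => (hδpos' z hz).ne'
  obtain ⟨hT1, hT2⟩ := integral_Ico hbδ
  refine ⟨fun z => Real.exp (G z), fun z => ∫ s in (0 : ℝ)..z, Real.exp (G s) / δ s,
    fun z => Real.exp_pos _, hbcont, fun z hz => ?_, by simp, hT1, fun z hz => ?_⟩
  · rw [Real.one_le_exp_iff, hG]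
    apply intervalIntegral.integral_nonneg hz.1.le
    intro w hw
    have hw' : w ∈ Ico (0 : ℝ) 1 := ⟨hw.1, hw.2.trans_lt hz.2⟩
    exact div_nonneg (hB₀mem w hw').1 (hδpos' w hw').le
  · have h1 : orbitX m n z (B z) - B z * z = δ z := by rw [hδ, ← hB₀eq z hz]
    rw [h1, ← hB₀eq z hz]
    exact ⟨(hb2 z hz).exp, hT2 z hz⟩

/-- The time along the regular orbit is unbounded. -/
lemma time_unbounded {m : ℕ} {n : ℝ} (hm : 1 < m) (hn : 1 < n) {B L : ℝ → ℝ} {L' : ℝ}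
    (hB : IsOrbitFunction m n B) (hL : HasDerivAt L L' 1) (hL1 : L 1 = 1)
    (hL0 : ∀ z ∈ Ioo (0 : ℝ) 1, 0 ≤ L z) (hLB : ∀ z ∈ Ioo (0 : ℝ) 1, L z ≤ B z)
    {b T : ℝ → ℝ} (hb : ∀ z ∈ Ioo (0 : ℝ) 1, 1 ≤ b z)
    (hT : ∀ z ∈ Ioo (0 : ℝ) 1, HasDerivAt T (b z / (orbitX m n z (B z) - B z * z)) z) (y : ℝ) :
    ∃ z ∈ Ioo (0 : ℝ) 1, y < T z := by
  have hm' : (1 : ℝ) < m := by exact_mod_cast hm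
  obtain ⟨C, hC0, hC⟩ := exists_orbitX_sub_le hm' hn
  -- This function vanishes at `z = 1` because `L 1 = 1`, so differentiability makes it `O(1 - z)`.
  -- As `L ≤ B`, the same upper bound holds with `B` in place of `L`.
  have hφ : HasDerivAt (fun z => (m : ℝ) + n * z ^ 2 - (m + n) * L z ^ 2 * z ^ 2)
      (n * (2 * 1) - ((m + n) * (2 * 1 * L') * 1 + (m + n) * 1 * (2 * 1))) 1 := by
    have h1 := (((hasDerivAt_pow 2 (1 : ℝ)).const_mul n).const_add (m : ℝ)).fun_sub
      (((hL.fun_pow 2).const_mul ((m : ℝ) + n)).fun_mul (hasDerivAt_pow 2 (1 : ℝ)))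
    simpa [hL1] using h1
  have hO := hφ.isBigO_sub
  obtain ⟨c, hc⟩ := hO.bound
  obtain ⟨ε, hε, hball⟩ := Metric.eventually_nhds_iff.mp hc
  obtain ⟨z₀, hz₀, hz₀1⟩ : ∃ z₀ ∈ Ioo (0 : ℝ) 1, 1 - z₀ < ε :=
    ⟨max (1 / 2) (1 - ε / 2), ⟨lt_max_of_lt_left (by norm_num), max_lt (by norm_num) (by linarith)⟩,
      by linarith [le_max_right (1 / 2 : ℝ) (1 - ε / 2)]⟩
  set c' := max c 1 with hc'
  have hc'0 : 0 < c' := lt_of_lt_of_le one_pos (le_max_right _ _)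
  have hδ : ∀ z ∈ Ico z₀ 1, 0 < orbitX m n z (B z) - B z * z ∧
      orbitX m n z (B z) - B z * z ≤ C * c' * (1 - z) := by
    intro z hz
    have hz' : z ∈ Ioo (0 : ℝ) 1 := ⟨hz₀.1.trans_le hz.1, hz.2⟩
    have hBz := (hB.pos z hz').le
    have hpos : 0 < orbitX m n z (B z) - B z * z := by
      have h1 := sub_pos_of_mem_unit hm' hn hz'.1.le hz.2 hBz (hB.lt_one z hz').le
      rw [← orbitX_sub hm' hn] at h1
      exact pos_of_mul_pos_right h1 (by linarith)
    refine ⟨hpos, (hC z (B z) hz'.1.le hBz hpos).trans ?_⟩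
    rw [mul_assoc C c']
    gcongr
    have h1 := hball (y := z) (by rw [Real.dist_eq, abs_sub_comm, abs_of_pos (by linarith [hz.2])]; linarith [hz.1])
    rw [hL1, Real.norm_eq_abs, Real.norm_eq_abs, abs_sub_comm z 1, abs_of_pos (by linarith [hz.2] : 0 < 1 - z)] at h1
    have h2 := (le_abs_self _).trans h1
    have h3 : L z ^ 2 ≤ B z ^ 2 := pow_le_pow_left₀ (hL0 z hz') (hLB z hz') 2
    have h4 : c * (1 - z) ≤ c' * (1 - z) := by
      have := le_max_left c 1
      have h5 : 0 ≤ 1 - z := by linarith [hz.2]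
      gcongr
    have h5 : (m + n) * L z ^ 2 * z ^ 2 ≤ (m + n) * B z ^ 2 * z ^ 2 := by
      have : 0 ≤ (m : ℝ) + n := by linarith
      gcongr
    linarith
  -- Since `b ≥ 1` and `δ ≤ C c' (1 - z)`, the time grows at least as fast as `-(C c')⁻¹ log (1 -
  -- z)`.
  have hmono : MonotoneOn (fun z => T z + (C * c')⁻¹ * Real.log (1 - z)) (Ico z₀ 1) := by
    have hd : ∀ z ∈ Ico z₀ 1, HasDerivAt (fun z => T z + (C * c')⁻¹ * Real.log (1 - z))
        (b z / (orbitX m n z (B z) - B z * z) + (C * c')⁻¹ * (-1 / (1 - z))) z := by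
      intro z hz
      have hz' : z ∈ Ioo (0 : ℝ) 1 := ⟨hz₀.1.trans_le hz.1, hz.2⟩
      have h1 : HasDerivAt (fun z : ℝ => 1 - z) (-1) z := by
        simpa using (hasDerivAt_id z).const_sub 1
      exact (hT z hz').fun_add ((h1.log (by linarith [hz.2])).const_mul _)
    apply monotoneOn_of_deriv_nonneg (convex_Ico _ _)
      (fun z hz => (hd z hz).continuousAt.continuousWithinAt)
      (fun z hz => (hd z (interior_subset hz)).differentiableAt.differentiableWithinAt)
    intro z hz
    have hz := interior_subset hz
    rw [(hd z hz).deriv]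
    have hz' : z ∈ Ioo (0 : ℝ) 1 := ⟨hz₀.1.trans_le hz.1, hz.2⟩
    obtain ⟨h1, h2⟩ := hδ z hz
    have h3 : 0 < 1 - z := by linarith [hz.2]
    have h4 : (C * c' * (1 - z))⁻¹ ≤ b z / (orbitX m n z (B z) - B z * z) := by
      rw [inv_eq_one_div]
      have := hb z hz'
      gcongr
    have h5 : (C * c')⁻¹ * (-1 / (1 - z)) = -(C * c' * (1 - z))⁻¹ := by
      field_simp
    rw [h5]
    linarith
  have hlim : Tendsto (fun u : ℝ => -(C * c')⁻¹ * Real.log u) (𝓝[>] 0) atTop := by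
    apply Tendsto.const_mul_atBot_of_neg (by have : 0 < (C * c')⁻¹ := by positivity
                                             linarith) Real.tendsto_log_nhdsGT_zero
  have h1 := (hlim.eventually_gt_atTop (y - (T z₀ + (C * c')⁻¹ * Real.log (1 - z₀)))).and
    (Ioo_mem_nhdsGT (show (0 : ℝ) < 1 - z₀ by linarith [hz₀.2]))
  obtain ⟨u, hu1, hu2⟩ := h1.exists
  refine ⟨1 - u, ⟨by linarith [hu2.2, hz₀.1], by linarith [hu2.1]⟩, ?_⟩
  have h2 := hmono (a := z₀) (b := 1 - u) ⟨le_rfl, hz₀.2⟩ ⟨by linarith [hu2.2], by linarith [hu2.1]⟩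
    (by linarith [hu2.2])
  simp only [sub_sub_cancel] at h2
  linarith

/-- The restrictions on the dimensions enter only through the subsolution `L`. It makes the time
unbounded and, with `L ≤ B < 1`, forces `ḃ → 1`. -/
theorem exists_isRegularFlow {m n : ℕ} (hm : 1 < m) (hn : 1 < n) (hmn : 9 ≤ m + n)
    (hne : (m, n) ≠ (2, 7)) : ∃ B s, IsRegularFlow m n B s := by
  have hm' : (1 : ℝ) < m := by exact_mod_cast hm
  have hn' : (1 : ℝ) < n := by exact_mod_cast hn
  obtain ⟨B, hB, hBL⟩ := exists_isOrbitFunction (m := m) hm hn'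
  obtain ⟨L, L', hL, hL01, hLsub, hL1⟩ := exists_subsolution hm hn hmn hne
  have hLB := hBL L L' hL hL01 hLsub
  obtain ⟨b, T, hbpos, hbcont, hb_ge, hT0, hT1, hbT⟩ := exists_time hm hn' hB
  have hTtop := time_unbounded hm hn' hB (hL 1) hL1 (fun z hz => (hL01 z hz).1) hLB hb_ge
    (fun z hz => (hbT z hz).2)
  obtain ⟨δ, hδ⟩ : ∃ δ : ℝ → ℝ, ∀ z, δ z = orbitX m n z (B z) - B z * z := ⟨_, fun _ => rfl⟩
  simp only [← hδ] at hbT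
  have hbd : ∀ z ∈ Ioo (0 : ℝ) 1, HasDerivAt b (b z * (B z / δ z)) z := fun z hz => (hbT z hz).1
  have hTd : ∀ z ∈ Ioo (0 : ℝ) 1, HasDerivAt T (b z / δ z) z := fun z hz => (hbT z hz).2
  have hδpos : ∀ z ∈ Ioo (0 : ℝ) 1, 0 < δ z := by
    intro z hz
    have h1 := sub_pos_of_mem_unit hm' hn' hz.1.le hz.2 (hB.pos z hz).le (hB.lt_one z hz).le
    rw [← orbitX_sub hm' hn', ← hδ] at h1
    exact pos_of_mul_pos_right h1 (by linarith)
  have hTpos : ∀ z ∈ Ioo (0 : ℝ) 1, 0 < b z / δ z := fun z hz =>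
    div_pos (hbpos z) (hδpos z hz)
  obtain ⟨hTmono', -, S, hS⟩ := exists_inverse_of_deriv_pos isOpen_Ioo ordConnected_Ioo hTd hTpos
  have hTmono : StrictMonoOn T (Ico 0 1) := by
    apply strictMonoOn_of_deriv_pos (convex_Ico _ _) hT1
    rw [interior_Ico]
    intro z hz
    rw [(hTd z hz).deriv]
    exact hTpos z hz
  have hTimage : ∀ t ∈ Ioi (0 : ℝ), ∃ z ∈ Ioo (0 : ℝ) 1, T z = t := by
    intro t ht
    obtain ⟨z, hz, hzt⟩ := hTtop t
    have h1 := intermediate_value_Ioo hz.1.le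
      (hT1.mono fun w hw => ⟨hw.1, hw.2.trans_lt hz.2⟩)
    rw [hT0] at h1
    obtain ⟨w, hw, hwt⟩ := h1 ⟨ht, hzt⟩
    exact ⟨w, ⟨hw.1, hw.2.trans hz.2⟩, hwt⟩
  have hTmem : ∀ z ∈ Ioo (0 : ℝ) 1, 0 < T z := fun z hz => by
    rw [← hT0]
    exact hTmono ⟨le_rfl, zero_lt_one⟩ ⟨hz.1.le, hz.2⟩ hz.1
  have hSmem : ∀ t ∈ Ioi (0 : ℝ), S t ∈ Ioo (0 : ℝ) 1 ∧ T (S t) = t := by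
    intro t ht
    obtain ⟨z, hz, rfl⟩ := hTimage t ht
    rw [(hS z hz).1]
    exact ⟨hz, rfl⟩
  have hSd : ∀ t ∈ Ioi (0 : ℝ), HasDerivAt S (δ (S t) / b (S t)) t := by
    intro t ht
    obtain ⟨z, hz, rfl⟩ := hTimage t ht
    have h1 := (hS z hz).2
    rw [inv_div] at h1
    rwa [(hS z hz).1]
  have hSlt : ∀ z ∈ Ioo (0 : ℝ) 1, ∀ t ∈ Ioi (0 : ℝ), (t < T z → S t < z) ∧ (T z < t → z < S t) := by
    intro z hz t ht
    obtain ⟨w, hw, rfl⟩ := hTimage t ht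
    rw [(hS w hw).1]
    exact ⟨(hTmono'.lt_iff_lt hw hz).mp, (hTmono'.lt_iff_lt hz hw).mp⟩
  have hS0 : Tendsto S (𝓝[>] 0) (𝓝[Ico 0 1] 0) := by
    rw [tendsto_nhdsWithin_iff]
    constructor
    · rw [(nhdsGT_basis (0 : ℝ)).tendsto_iff (nhds_basis_abs_sub_lt (0 : ℝ))]
      intro ε hε
      have hz : min ε (1 / 2) ∈ Ioo (0 : ℝ) 1 :=
        ⟨lt_min hε (by norm_num), (min_le_right _ _).trans_lt (by norm_num)⟩
      refine ⟨T (min ε (1 / 2)), hTmem _ hz, fun t ht => ?_⟩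
      have h1 := (hSlt _ hz t ht.1).1 ht.2
      have h2 := (hSmem t ht.1).1.1
      change |S t - 0| < ε
      rw [sub_zero, abs_of_pos h2]
      exact h1.trans_le (min_le_left _ _)
    · filter_upwards [self_mem_nhdsWithin] with t ht
      exact Ioo_subset_Ico_self (hSmem t ht).1
  have hS1 : Tendsto S atTop (𝓝 1) := by
    rw [(atTop_basis' (1 : ℝ)).tendsto_iff (nhds_basis_abs_sub_lt (1 : ℝ))]
    intro ε hε
    have hz : 1 - min ε (1 / 2) ∈ Ioo (0 : ℝ) 1 := by
      have h1 : 0 < min ε (1 / 2) := lt_min hε (by norm_num)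
      have h2 : min ε (1 / 2) ≤ 1 / 2 := min_le_right _ _
      constructor <;> linarith
    refine ⟨T (1 - min ε (1 / 2)) + 1, by linarith [hTmem _ hz], fun t ht => ?_⟩
    have ht' : T (1 - min ε (1 / 2)) + 1 ≤ t := ht
    have ht0 : t ∈ Ioi (0 : ℝ) := by
      have := hTmem _ hz
      change 0 < t
      linarith
    have h1 := (hSlt _ hz t ht0).2 (by linarith)
    have h2 := (hSmem t ht0).1.2
    have h3 : min ε (1 / 2) ≤ ε := min_le_left _ _
    change |S t - 1| < ε
    rw [abs_lt]
    constructor <;> linarith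
  have hratio : ∀ t, S t * b (S t) / b (S t) = S t := fun t =>
    mul_div_cancel_right₀ _ (hbpos _).ne'
  refine ⟨B, fun t => (S t * b (S t), b (S t), B (S t)), hB, ⟨isOpen_Ioi, ⟨1, mem_Ioi.mpr one_pos⟩,
    ordConnected_Ioi, fun t ht => ⟨mul_pos (hSmem t ht).1.1 (hbpos _), hbpos _⟩, fun t ht => ?_⟩,
    fun t ht => ?_, fun t ht => ?_, fun z hz => ?_, ?_, ?_, ?_, ?_⟩
  · have hz := (hSmem t ht).1
    have hdb : HasDerivAt (fun t => b (S t)) (B (S t)) t := by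
      refine ((hbd _ hz).comp t (hSd t ht)).congr_deriv ?_
      have h1 := (hδpos _ hz).ne'
      have h2 := (hbpos (S t)).ne'
      field_simp
    refine (((hSd t ht).fun_mul hdb).prodMk (hdb.prodMk ((hB.deriv _ hz).comp t (hSd t ht)))).congr_deriv ?_
    have h1 := hδpos _ hz
    have h2 := (hbpos (S t))
    have h3 := hδ (S t)
    have h4 := orbitX_sub hm' hn' (S t) (B (S t))
    rw [← h3] at h4
    simp only [flowField, hratio]
    refine Prod.ext ?_ (Prod.ext rfl ?_)
    · simp only
      rw [h3]
      field_simp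
      ring
    · simp only [orbitRhs]
      rw [← h4, eq_div_iff h2.ne']
      have hm1 : (m : ℝ) - 1 ≠ 0 := by linarith
      have hS0 := hz.1.ne'
      generalize δ (S t) = d at *
      generalize b (S t) = bb at *
      have h5 : orbitX m n (S t) (B (S t)) = d + B (S t) * S t := by linarith
      rw [h5]
      field_simp
      ring
  · simp only [hratio]
    exact (hSmem t ht).1
  · simp only [hratio]
  · refine ⟨T z, hTmem z hz, ?_⟩
    simp only [hratio]
    exact (hS z hz).1
  · simp only [hratio]
    exact hS0.mono_right nhdsWithin_le_nhds
  · have h1 : Tendsto (fun z => z * b z) (𝓝[Ico 0 1] 0) (𝓝 (0 * b 0)) :=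
      (continuousWithinAt_id.mul (hbcont 0 ⟨le_rfl, one_pos⟩))
    rw [zero_mul] at h1
    exact h1.comp hS0
  · simp only [hratio]
    exact hS1
  · have h1 : Tendsto (fun t => L (S t)) atTop (𝓝 1) := by
      rw [← hL1]
      exact (hL 1).continuousAt.tendsto.comp hS1
    refine tendsto_of_tendsto_of_tendsto_of_le_of_le' h1 tendsto_const_nhds ?_ ?_
    · filter_upwards [Ioi_mem_atTop 0] with t ht using hLB _ (hSmem t ht).1
    · filter_upwards [Ioi_mem_atTop 0] with t ht using (hB.lt_one _ (hSmem t ht).1).le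

end Construction

/-! ### Dimensional reduction and its acceleration -/

section Reduction

/-- The Hamiltonian constraint of the vacuum equations. -/
lemma IsSol.constraint {m n : ℕ} {I : Set ℝ} {a b : ℝ → ℝ} (h : IsSol m n I a b) {t : ℝ}
    (ht : t ∈ I) : (m : ℝ) * (m - 1) * (deriv a t / a t) ^ 2
      + 2 * m * n * (deriv a t / a t) * (deriv b t / b t) + n * (n - 1) * (deriv b t / b t) ^ 2
      = (m + n - 1) * (m / a t ^ 2 + n / b t ^ 2) := by
  have ha := (h.pos_a t ht).ne'
  have hb := (h.pos_b t ht).ne'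
  have e1 := h.eq_time t ht
  have e2 := h.eq_a t ht
  have e3 := h.eq_b t ht
  field_simp at e1 e2 e3 ⊢
  linear_combination m * b t * e2 + n * a t * e3 - a t * b t * e1

/-- The second derivative of the reduced scale factor. -/
lemma IsSol.acceleration {m n : ℕ} (hm : 1 < m) {I : Set ℝ} {a b : ℝ → ℝ}
    (h : IsSol m n I a b) {t : ℝ} (ht : t ∈ I) :
    deriv (deriv a) t + (n : ℝ) / (m - 1) * (deriv a t * (deriv b t / b t)
      + a t * (deriv (deriv b) t / b t - (deriv b t / b t) ^ 2)) =
      a t * n * (m + n - 1) * (1 - deriv b t ^ 2) / (m * (m - 1) * b t ^ 2) := by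
  have hm' : (1 : ℝ) < m := by exact_mod_cast hm
  have ha := (h.pos_a t ht).ne'
  have hb := (h.pos_b t ht).ne'
  have e2 := h.eq_a t ht
  have e3 := h.eq_b t ht
  have hC := h.constraint ht
  have hm0 : (m : ℝ) ≠ 0 := by positivity
  have hm1 : (m : ℝ) - 1 ≠ 0 := by linarith
  have e2' : deriv (deriv a) t = (m + n - 1 + deriv a t ^ 2 -
    (m * (deriv a t / a t) + n * (deriv b t / b t)) * (a t * deriv a t)) / a t := by
    rw [eq_div_iff ha]; linarith
  have e3' : deriv (deriv b) t = (m + n - 1 + deriv b t ^ 2 -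
    (m * (deriv a t / a t) + n * (deriv b t / b t)) * (b t * deriv b t)) / b t := by
    rw [eq_div_iff hb]; linarith
  rw [e2', e3']
  generalize deriv a t = x at *
  generalize deriv b t = y at *
  generalize a t = a at *
  generalize b t = b at *
  -- After the second derivatives are eliminated, the two sides differ by `-a/m` times the
  -- Hamiltonian constraint.
  have key : (m + n - 1 + x ^ 2 - (m * (x / a) + n * (y / b)) * (a * x)) / a + (n : ℝ) / (m - 1) *
      (x * (y / b) + a * ((m + n - 1 + y ^ 2 - (m * (x / a) + n * (y / b)) * (b * y)) / b / b
        - (y / b) ^ 2)) - a * n * (m + n - 1) * (1 - y ^ 2) / (m * (m - 1) * b ^ 2) =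
      -(a / m) * (m * (m - 1) * (x / a) ^ 2 + 2 * m * n * (x / a) * (y / b) + n * (n - 1) * (y / b) ^ 2
        - (m + n - 1) * (m / a ^ 2 + n / b ^ 2)) := by
    field_simp
    ring
  rw [hC, sub_self, mul_zero] at key
  exact sub_eq_zero.mp key

variable {m n : ℕ} {I J : Set ℝ} {a b α Φ : ℝ → ℝ}

/-- The derivatives of the reduced scale factor and of the scalar field. -/
theorem IsReduction.derivatives (hm : 1 < m) (h : IsSol m n I a b)
    (hr : IsReduction m n I a b J α Φ) : ∃ T : ℝ → ℝ, BijOn T I J ∧ IsOpen J ∧ ∀ t ∈ I,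
      HasDerivAt T (b t ^ ((n : ℝ) / ((m : ℝ) - 1))) t ∧
      α (T t) = a t * b t ^ ((n : ℝ) / ((m : ℝ) - 1)) ∧
      Φ (T t) = -(√((m : ℝ) - 1) * √((m : ℝ) + n - 1) / (√(8 * Real.pi) * √(n : ℝ))) *
        Real.log (b t ^ (-((n : ℝ) / ((m : ℝ) - 1)))) ∧
      HasDerivAt α (deriv a t + (n : ℝ) / (m - 1) * (a t * (deriv b t / b t))) (T t) ∧
      HasDerivAt (deriv α) (a t * n * (m + n - 1) * (1 - deriv b t ^ 2) /
        (m * (m - 1) * b t ^ 2) / b t ^ ((n : ℝ) / ((m : ℝ) - 1))) (T t) ∧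
      HasDerivAt Φ (√((m : ℝ) - 1) * √((m : ℝ) + n - 1) / (√(8 * Real.pi) * √(n : ℝ)) *
        ((n : ℝ) / (m - 1)) * (deriv b t / b t) / b t ^ ((n : ℝ) / ((m : ℝ) - 1))) (T t) := by
  have hm' : (1 : ℝ) < m := by exact_mod_cast hm
  obtain ⟨T, hT, hTt⟩ := hr
  obtain ⟨k, hk⟩ : ∃ k : ℝ, k = (n : ℝ) / (m - 1) := ⟨_, rfl⟩
  obtain ⟨C, hCd⟩ : ∃ C : ℝ, C = √((m : ℝ) - 1) * √((m : ℝ) + n - 1) / (√(8 * Real.pi) * √(n : ℝ)) :=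
    ⟨_, rfl⟩
  simp only [← hk, ← hCd] at hTt ⊢
  have hpos : ∀ t ∈ I, 0 < b t ^ k := fun t ht => Real.rpow_pos_of_pos (h.pos_b t ht) _
  obtain ⟨-, hopen, S, hS⟩ := exists_inverse_of_deriv_pos h.isOpen h.ordConnected
    (fun t ht => (hTt t ht).1) hpos
  rw [hT.image_eq] at hopen
  have da := fun t ht => (differentiableAt_of_smooth h.isOpen h.smooth_a (t := t) ht).hasDerivAt
  have db := fun t ht => (differentiableAt_of_smooth h.isOpen h.smooth_b (t := t) ht).hasDerivAt
  have dda := fun t ht => (differentiableAt_deriv_of_smooth h.isOpen h.smooth_a (t := t) ht).hasDerivAt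
  have ddb := fun t ht => (differentiableAt_deriv_of_smooth h.isOpen h.smooth_b (t := t) ht).hasDerivAt
  -- derivatives of functions given along the curve
  have push : ∀ {f F : ℝ → ℝ} {F' : ℝ}, (∀ t ∈ I, f (T t) = F t) → ∀ t ∈ I, HasDerivAt F F' t →
      HasDerivAt f (F' / b t ^ k) (T t) := by
    intro f F F' hf t ht hF
    have h1 : HasDerivAt (fun y => F (S y)) (F' / b t ^ k) (T t) := by
      rw [div_eq_mul_inv]
      have hF' : HasDerivAt F F' (S (T t)) := by rwa [(hS t ht).1]
      exact hF'.comp (T t) (hS t ht).2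
    apply h1.congr_of_eventuallyEq
    filter_upwards [hopen.mem_nhds (hT.mapsTo ht)] with y hy
    obtain ⟨u, hu, rfl⟩ := hT.surjOn hy
    rw [hf u hu, (hS u hu).1]
  have hα : ∀ t ∈ I, HasDerivAt α (deriv a t + k * (a t * (deriv b t / b t))) (T t) := by
    intro t ht
    have h1 := push (fun t ht => (hTt t ht).2.1) t ht
      ((da t ht).fun_mul ((db t ht).rpow_const (p := k) (Or.inl (h.pos_b t ht).ne')))
    refine h1.congr_deriv ?_
    have h2 := h.pos_b t ht
    rw [Real.rpow_sub_one h2.ne']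
    have h3 := hpos t ht
    field_simp
  refine ⟨T, hT, hopen, fun t ht => ⟨(hTt t ht).1, (hTt t ht).2.1, (hTt t ht).2.2, hα t ht, ?_, ?_⟩⟩
  · have hb := (h.pos_b t ht).ne'
    have h1 := push (fun t ht => (hα t ht).deriv) t ht
      ((dda t ht).fun_add (((da t ht).fun_mul ((ddb t ht).fun_div (db t ht) hb)).const_mul k))
    rw [← h.acceleration hm ht, ← hk]
    refine h1.congr_deriv ?_
    field_simp
  · have hb := h.pos_b t ht
    have h1 := push (F := fun t => C * k * Real.log (b t)) (f := Φ) (fun t ht => by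
      rw [(hTt t ht).2.2, Real.log_rpow (h.pos_b t ht)]; ring) t ht
      (((db t ht).log hb.ne').const_mul (C * k))
    exact h1

/-- Acceleration is equivalent to `|ḃ| < 1`. -/
theorem IsReduction.accelerating_iff (hm : 1 < m) (hn : 1 < n) (h : IsSol m n I a b)
    (hr : IsReduction m n I a b J α Φ) :
    EternallyAccelerating J α ↔ ∀ t ∈ I, deriv b t ^ 2 < 1 := by
  have hm' : (1 : ℝ) < m := by exact_mod_cast hm
  have hn' : (1 : ℝ) < n := by exact_mod_cast hn
  obtain ⟨T, hT, -, hd⟩ := hr.derivatives hm h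
  have key : ∀ t ∈ I, 0 < deriv (deriv α) (T t) ↔ deriv b t ^ 2 < 1 := by
    intro t ht
    rw [(hd t ht).2.2.2.2.1.deriv]
    have ha := h.pos_a t ht
    have hb := h.pos_b t ht
    have hbk : 0 < b t ^ ((n : ℝ) / ((m : ℝ) - 1)) := Real.rpow_pos_of_pos hb _
    have hm1 : (0 : ℝ) < m - 1 := by linarith
    have hK : (0 : ℝ) < m + n - 1 := by linarith
    have e : a t * n * (m + n - 1) * (1 - deriv b t ^ 2) / (m * (m - 1) * b t ^ 2) /
        b t ^ ((n : ℝ) / ((m : ℝ) - 1)) = (a t * n * (m + n - 1) / (m * (m - 1) * b t ^ 2) /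
        b t ^ ((n : ℝ) / ((m : ℝ) - 1))) * (1 - deriv b t ^ 2) := by ring
    rw [e, mul_pos_iff_of_pos_left (by positivity), sub_pos]
  constructor
  · intro hacc t ht
    exact (key t ht).mp (hacc _ (hT.mapsTo ht))
  · intro hacc s hs
    obtain ⟨t, ht, rfl⟩ := hT.surjOn hs
    exact (key t ht).mpr (hacc t ht)

/-- Every solution has a reduction. -/
theorem exists_isReduction (h : IsSol m n I a b) : ∃ J α Φ, IsReduction m n I a b J α Φ := by
  obtain ⟨k, hk⟩ : ∃ k : ℝ, k = (n : ℝ) / (m - 1) := ⟨_, rfl⟩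
  obtain ⟨t₀, ht₀⟩ := h.nonempty
  have hbc : ContinuousOn (fun t => b t ^ k) I :=
    h.smooth_b.continuousOn.rpow_const fun t ht => Or.inl (h.pos_b t ht).ne'
  have hT : ∀ t ∈ I, HasDerivAt (fun t => ∫ u in t₀..t, b u ^ k) (b t ^ k) t := by
    intro t ht
    apply intervalIntegral.integral_hasDerivAt_right
    · apply ContinuousOn.intervalIntegrable
      exact hbc.mono (h.ordConnected.uIcc_subset ht₀ ht)
    · exact hbc.stronglyMeasurableAtFilter h.isOpen t ht
    · exact hbc.continuousAt (h.isOpen.mem_nhds ht)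
  obtain ⟨hmono, -, S, hS⟩ := exists_inverse_of_deriv_pos h.isOpen h.ordConnected hT
    fun t ht => Real.rpow_pos_of_pos (h.pos_b t ht) _
  refine ⟨_, fun s => a (S s) * b (S s) ^ k, fun s =>
    -(√((m : ℝ) - 1) * √((m : ℝ) + n - 1) / (√(8 * Real.pi) * √(n : ℝ))) *
      Real.log (b (S s) ^ (-k)), fun t => ∫ u in t₀..t, b u ^ k, hmono.injOn.bijOn_image,
      fun t ht => ?_⟩
  rw [← hk]
  refine ⟨hT t ht, ?_, ?_⟩ <;> simp only [(hS t ht).1]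

end Reduction

/-! ### The reduced Einstein-scalar equations -/

section EinsteinScalar

variable {m n : ℕ} {M : Type*} [TopologicalSpace M] [ChartedSpace (EuclideanSpace ℝ (Fin m)) M]
  [IsManifold 𝓘(ℝ, EuclideanSpace ℝ (Fin m)) ∞ M]

/-- The left hand side of the Einstein equations for `-ds² + α² g`. -/
lemma einstein_singlyWarped {g : SmoothMetric m M} (hg : IsEinstein g (-((m : ℝ) + n - 1)))
    {e : OpenPartialHomeomorph M (EuclideanSpace ℝ (Fin m))}
    (he : e ∈ atlas (EuclideanSpace ℝ (Fin m)) M) {x : Fin m → ℝ}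
    (hx : WithLp.toLp 2 x ∈ e.target) {α : ℝ → ℝ} {s : ℝ}
    (hα : ∀ᶠ r in 𝓝 s, α r ≠ 0 ∧ DifferentiableAt ℝ α r) (hα' : DifferentiableAt ℝ (deriv α) s)
    {Φ : ℝ → ℝ} {V : ℝ → ℝ} {κ : ℝ}
    (h0 : -(m * (deriv (deriv α) s / α s)) + 1 / 2 * (m * (deriv (deriv α) s / α s) +
      m * (-((m : ℝ) + n - 1) + α s * deriv (deriv α) s + (m - 1) * deriv α s ^ 2) / α s ^ 2) =
      κ * (1 / 2 * deriv Φ s ^ 2 + V (Φ s)))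
    (h1 : (-((m : ℝ) + n - 1) + α s * deriv (deriv α) s + (m - 1) * deriv α s ^ 2)
      - 1 / 2 * (m * (deriv (deriv α) s / α s) +
      m * (-((m : ℝ) + n - 1) + α s * deriv (deriv α) s + (m - 1) * deriv α s ^ 2) / α s ^ 2)
        * α s ^ 2 = κ * (1 / 2 * deriv Φ s ^ 2 - V (Φ s)) * α s ^ 2) :
    ricci (singlyWarped α (chartMetric g e)) (Sum.elim (fun _ => s) x)
        - ((1 / 2) * scalarCurvature (singlyWarped α (chartMetric g e))
            (Sum.elim (fun _ => s) x)) •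
          singlyWarped α (chartMetric g e) (Sum.elim (fun _ => s) x) =
      κ • energyMomentum (singlyWarped α (chartMetric g e)) V
        (fun z => Φ (z (Sum.inl ()))) (Sum.elim (fun _ => s) x) := by
  have hB := eventually_isBlockMetric_chartMetric g he hx
  have hα0 := hα.self_of_nhds.1
  obtain ⟨c, hc⟩ : ∃ c : ℝ, c = -((m : ℝ) + n - 1) + α s * deriv (deriv α) s +
    (m - 1) * deriv α s ^ 2 := ⟨_, rfl⟩
  rw [← hc] at h0 h1
  have hR : ricci (singlyWarped α (chartMetric g e)) (Sum.elim (fun _ => s) x) =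
      Matrix.fromBlocks (Matrix.of fun _ _ => -(m * (deriv (deriv α) s / α s))) 0 0
        (c • chartMetric g e x) := by
    rw [singlyWarped_eq, ricci_warpedMetric hB (hα.mono fun r hr _ => hr) (fun _ => hα'),
      hg e he x hx]
    ext i j
    rcases i with i | i <;> rcases j with j | j <;> simp
    rw [hc]
    field_simp
    ring
  have hinv := hB.self_of_nhds.inv_warpedMetric (f := fun _ => α) (t := s) (fun _ => hα0)
  rw [← singlyWarped_eq] at hinv
  have htr : ∑ i, ∑ j, (chartMetric g e x)⁻¹ i j * chartMetric g e x i j = m := by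
    have : ∀ i, ∑ j, (chartMetric g e x)⁻¹ i j * chartMetric g e x i j = 1 := by
      intro i
      have := hB.self_of_nhds.sum_inv_mul i i
      simp only [if_true] at this
      rw [← this]
      exact Finset.sum_congr rfl fun j _ => by rw [chartMetric_symm]
    simp [this]
  have hS : scalarCurvature (singlyWarped α (chartMetric g e)) (Sum.elim (fun _ => s) x) =
      m * (deriv (deriv α) s / α s) + m * c / α s ^ 2 := by
    rw [scalarCurvature, hinv, hR]
    simp only [Fintype.sum_sum_type, Matrix.fromBlocks_apply₁₁, Matrix.fromBlocks_apply₁₂,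
      Matrix.fromBlocks_apply₂₁, Matrix.fromBlocks_apply₂₂, Matrix.of_apply, Matrix.smul_apply,
      Matrix.zero_apply, smul_eq_mul]
    have : ∀ i j, (α s)⁻¹ * (α s)⁻¹ * (chartMetric g e x)⁻¹ i j * (c * chartMetric g e x i j) =
        c / α s ^ 2 * ((chartMetric g e x)⁻¹ i j * chartMetric g e x i j) := by
      intro i j
      field_simp
    simp only [this, ← Finset.mul_sum]
    simp
    rw [← Finset.mul_sum, htr]
    ring
  rw [hS, hR]
  have hp0 : ∀ u, pderiv (Sum.inl u) (fun z : Unit ⊕ Fin m → ℝ => Φ (z (Sum.inl ())))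
      (Sum.elim (fun _ => s) x) = deriv Φ s := fun u => by rw [pderiv_time]; rfl
  have hp1 : ∀ i, pderiv (Sum.inr i) (fun z : Unit ⊕ Fin m → ℝ => Φ (z (Sum.inl ())))
      (Sum.elim (fun _ => s) x) = 0 := fun i => by rw [pderiv_sum_inr]; simp
  ext i j
  simp only [Matrix.sub_apply, Matrix.smul_apply, energyMomentum, Matrix.of_apply, hinv,
    Fintype.sum_sum_type, smul_eq_mul]
  rcases i with i | i <;> rcases j with j | j <;>
    simp [hp0, hp1, singlyWarped]
  · linear_combination h0
  · linear_combination (chartMetric g e x i j) * h1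

/-- The reduction of a vacuum solution solves the Einstein equations with a scalar field. -/
theorem IsReduction.isEinsteinScalar (hm : 1 < m) (hn : 1 < n) {g : SmoothMetric m M}
    (hg : IsEinstein g (-((m : ℝ) + n - 1))) {I J : Set ℝ} {a b α Φ : ℝ → ℝ}
    (h : IsSol m n I a b) (hr : IsReduction m n I a b J α Φ) : IsEinsteinScalar n g J α Φ := by
  have hm' : (1 : ℝ) < m := by exact_mod_cast hm
  have hn' : (1 : ℝ) < n := by exact_mod_cast hn
  obtain ⟨T, hT, hJ, hd⟩ := hr.derivatives hm h
  intro e he s hs x hx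
  have hev : ∀ᶠ r in 𝓝 s, α r ≠ 0 ∧ DifferentiableAt ℝ α r := by
    filter_upwards [hJ.mem_nhds hs] with r hr
    obtain ⟨u, hu, rfl⟩ := hT.surjOn hr
    obtain ⟨-, h2, -, h4, -⟩ := hd u hu
    refine ⟨?_, h4.differentiableAt⟩
    rw [h2]
    exact (mul_pos (h.pos_a u hu) (Real.rpow_pos_of_pos (h.pos_b u hu) _)).ne'
  obtain ⟨t, ht, rfl⟩ := hT.surjOn hs
  obtain ⟨-, h2, h3, h4, h5, h6⟩ := hd t ht
  have hC := h.constraint ht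
  have ha := h.pos_a t ht
  have hb := h.pos_b t ht
  have hm1 : (0 : ℝ) < m - 1 := by linarith
  have hn0 : (0 : ℝ) < n := by linarith
  have hm0 : (0 : ℝ) < m := by linarith
  have hK : (0 : ℝ) < m + n - 1 := by linarith
  have hπ := Real.pi_pos
  -- The constants are normalised so that the exponential equals `b ^ (-2n/(m-1) - 2)`: the
  -- curvature term `b⁻²` of the internal space times the conformal factor.
  have hV : 8 * Real.pi * potential m n (Φ (T t)) = n * (m + n - 1) / 2 /
      ((b t ^ ((n : ℝ) / (m - 1))) ^ 2 * b t ^ 2) := by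
    have hexp : -(√(8 * Real.pi) * (2 / √((m : ℝ) - 1)) * √(((m : ℝ) + n - 1) / n) * Φ (T t)) =
        -(2 * (Real.log (b t) * ((n : ℝ) / (m - 1))) + 2 * Real.log (b t)) := by
      rw [h3, Real.log_rpow hb, Real.sqrt_div hK.le]
      have s1 : √((m : ℝ) - 1) ≠ 0 := (Real.sqrt_pos.mpr hm1).ne'
      have s2 : √(8 * Real.pi) ≠ 0 := (Real.sqrt_pos.mpr (by positivity)).ne'
      have s3 : √(n : ℝ) ≠ 0 := (Real.sqrt_pos.mpr hn0).ne'
      have s4 : √((m : ℝ) + n - 1) ^ 2 = m + n - 1 := Real.sq_sqrt hK.le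
      have s5 : √(n : ℝ) ^ 2 = n := Real.sq_sqrt hn0.le
      field_simp
      rw [s4, s5]
      ring
    rw [potential, hexp, Real.exp_neg, Real.exp_add, two_mul, two_mul, Real.exp_add, Real.exp_add,
      ← Real.rpow_def_of_pos hb, Real.exp_log hb]
    field_simp
  have hP : 8 * Real.pi * deriv Φ (T t) ^ 2 = n * (m + n - 1) / (m - 1) * (deriv b t / b t) ^ 2 /
      (b t ^ ((n : ℝ) / (m - 1))) ^ 2 := by
    rw [h6.deriv]
    have hbk : 0 < b t ^ ((n : ℝ) / ((m : ℝ) - 1)) := Real.rpow_pos_of_pos hb _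
    have s1 : √((m : ℝ) - 1) ^ 2 = m - 1 := Real.sq_sqrt hm1.le
    have s2 : √(8 * Real.pi) ^ 2 = 8 * Real.pi := Real.sq_sqrt (by positivity)
    have s4 : √((m : ℝ) + n - 1) ^ 2 = m + n - 1 := Real.sq_sqrt hK.le
    have s5 : √(n : ℝ) ^ 2 = n := Real.sq_sqrt hn0.le
    rw [div_pow, mul_pow, mul_pow, div_pow, mul_pow, mul_pow, s1, s2, s4, s5]
    field_simp
  have hbk : 0 < b t ^ ((n : ℝ) / ((m : ℝ) - 1)) := Real.rpow_pos_of_pos hb _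
  have hm1' := hm1.ne'
  apply einstein_singlyWarped hg he hx hev h5.differentiableAt
  · have e1 : 8 * Real.pi * (1 / 2 * deriv Φ (T t) ^ 2 + potential m n (Φ (T t))) =
        1 / 2 * (8 * Real.pi * deriv Φ (T t) ^ 2) + 8 * Real.pi * potential m n (Φ (T t)) := by
      ring
    rw [e1, hP, hV, h4.deriv, h5.deriv, h2]
    generalize b t ^ ((n : ℝ) / ((m : ℝ) - 1)) = r at *
    generalize deriv a t = x' at *
    generalize deriv b t = y' at *
    generalize a t = a at *
    generalize b t = b at *
    rw [← sub_eq_zero] at hC ⊢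
    -- The time component is the constraint divided by `2 r²`. The spatial component below is
    -- another multiple of it, with factor `(2 - m) a² / (2 m)`.
    calc _ = 1 / (2 * r ^ 2) * (m * (m - 1) * (x' / a) ^ 2 + 2 * m * n * (x' / a) * (y' / b)
          + n * (n - 1) * (y' / b) ^ 2 - (m + n - 1) * (m / a ^ 2 + n / b ^ 2)) := by
          field_simp
          ring
      _ = 0 := by rw [hC, mul_zero]
  · have e1 : 8 * Real.pi * (1 / 2 * deriv Φ (T t) ^ 2 - potential m n (Φ (T t))) =
        1 / 2 * (8 * Real.pi * deriv Φ (T t) ^ 2) - 8 * Real.pi * potential m n (Φ (T t)) := by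
      ring
    rw [e1, hP, hV, h4.deriv, h5.deriv, h2]
    generalize b t ^ ((n : ℝ) / ((m : ℝ) - 1)) = r at *
    generalize deriv a t = x' at *
    generalize deriv b t = y' at *
    generalize a t = a at *
    generalize b t = b at *
    rw [← sub_eq_zero] at hC ⊢
    calc _ = (2 - m) / (2 * m) * a ^ 2 * (m * (m - 1) * (x' / a) ^ 2
          + 2 * m * n * (x' / a) * (y' / b)
          + n * (n - 1) * (y' / b) ^ 2 - (m + n - 1) * (m / a ^ 2 + n / b ^ 2)) := by
          field_simp
          ring
      _ = 0 := by rw [hC, mul_zero]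

end EinsteinScalar

/-! ### Local existence, uniqueness and gluing of flows -/

section Continuation

/-- Local existence for a smooth autonomous differential equation, uniformly near a point. -/
lemma exists_local_flow {E : Type*} [NormedAddCommGroup E] [NormedSpace ℝ E] [CompleteSpace E]
    {F : E → E} {U : Set E} (hU : IsOpen U) (hF : ContDiffOn ℝ 1 F U) {x₀ : E} (hx₀ : x₀ ∈ U) :
    ∃ V ∈ 𝓝 x₀, ∃ ε > (0 : ℝ), ∀ x ∈ V, ∃ γ : ℝ → E, γ 0 = x ∧
      ∀ t ∈ Ioo (-ε) ε, γ t ∈ U ∧ HasDerivAt γ (F (γ t)) t := by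
  obtain ⟨ε, hε, _, r, _, _, hr, hP⟩ :=
    IsPicardLindelof.of_contDiffAt_one (hF.contDiffAt (hU.mem_nhds hx₀))
  obtain ⟨γ, hγ, hc⟩ := (hP 0).exists_forall_mem_closedBall_eq_hasDerivWithinAt_continuousOn
  simp only [zero_sub, zero_add] at hγ hc
  have hnhds : Metric.closedBall x₀ r ×ˢ Icc (-ε) ε ∈ 𝓝 (x₀, (0 : ℝ)) :=
    prod_mem_nhds (Metric.closedBall_mem_nhds _ hr) (Icc_mem_nhds (by linarith) hε)
  have h0 : γ (x₀, 0) = x₀ := (hγ x₀ (Metric.mem_closedBall_self hr.le)).1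
  have h1 : ∀ᶠ p in 𝓝 (x₀, (0 : ℝ)), γ p ∈ U :=
    (hc.continuousAt hnhds).eventually (by rw [h0]; exact hU.mem_nhds hx₀)
  obtain ⟨V, hV, W, hW, hVW⟩ := mem_nhds_prod_iff.mp (inter_mem h1 hnhds)
  obtain ⟨δ, hδ, hδW⟩ := Metric.mem_nhds_iff.mp hW
  have hball : ∀ t ∈ Ioo (-(min δ ε)) (min δ ε), t ∈ W := by
    intro t ht
    apply hδW
    rw [Metric.mem_ball, Real.dist_eq, sub_zero, abs_lt]
    exact ⟨by linarith [ht.1, min_le_left δ ε], by linarith [ht.2, min_le_left δ ε]⟩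
  have hpos : 0 < min δ ε := lt_min hδ hε
  refine ⟨V, hV, min δ ε, hpos, fun x hx => ⟨fun t => γ (x, t), ?_, fun t ht => ?_⟩⟩
  · exact (hγ x (hVW (mk_mem_prod hx (hball 0 ⟨by linarith, hpos⟩))).2.1).1
  · have h2 := hVW (mk_mem_prod hx (hball t ht))
    refine ⟨h2.1, ((hγ x h2.2.1).2 t h2.2.2).hasDerivAt (Icc_mem_nhds ?_ ?_)⟩
    · linarith [ht.1, min_le_right δ ε]
    · linarith [ht.2, min_le_right δ ε]

/-- Solutions starting in a compact set exist for a uniform time. -/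
lemma exists_uniform_flow {E : Type*} [NormedAddCommGroup E] [NormedSpace ℝ E] [CompleteSpace E]
    {F : E → E} {U : Set E} (hU : IsOpen U) (hF : ContDiffOn ℝ 1 F U) {K : Set E}
    (hK : IsCompact K) (hKU : K ⊆ U) :
    ∃ ε > (0 : ℝ), ∀ x ∈ K, ∃ γ : ℝ → E, γ 0 = x ∧
      ∀ t ∈ Ioo (-ε) ε, γ t ∈ U ∧ HasDerivAt γ (F (γ t)) t := by
  refine hK.induction_on (p := fun A => ∃ ε > (0 : ℝ), ∀ x ∈ A, ∃ γ : ℝ → E, γ 0 = x ∧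
      ∀ t ∈ Ioo (-ε) ε, γ t ∈ U ∧ HasDerivAt γ (F (γ t)) t) ⟨1, one_pos, by simp⟩ ?_ ?_ ?_
  · rintro A A' hA ⟨ε, hε, h⟩
    exact ⟨ε, hε, fun x hx => h x (hA hx)⟩
  · rintro A A' ⟨ε, hε, h⟩ ⟨ε', hε', h'⟩
    refine ⟨min ε ε', lt_min hε hε', ?_⟩
    rintro x (hx | hx)
    · obtain ⟨γ, h0, h1⟩ := h x hx
      exact ⟨γ, h0, fun t ht => h1 t (Ioo_subset_Ioo (neg_le_neg (min_le_left _ _))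
        (min_le_left _ _) ht)⟩
    · obtain ⟨γ, h0, h1⟩ := h' x hx
      exact ⟨γ, h0, fun t ht => h1 t (Ioo_subset_Ioo (neg_le_neg (min_le_right _ _))
        (min_le_right _ _) ht)⟩
  · intro x hx
    obtain ⟨V, hV, ε, hε, h⟩ := exists_local_flow hU hF (hKU hx)
    exact ⟨V, mem_nhdsWithin_of_mem_nhds hV, ε, hε, h⟩

variable {m n : ℕ} {I I' : Set ℝ} {s s' : ℝ → ℝ × ℝ × ℝ}

lemma IsFlow.continuousOn (h : IsFlow m n I s) : ContinuousOn s I :=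
  fun t ht => (h.hasDerivAt t ht).continuousAt.continuousWithinAt

/-- A compact subset of the domain is contained in a compact convex one. -/
lemma exists_convex_flowDomain {C : Set (ℝ × ℝ × ℝ)} (hC : IsCompact C) (hCU : C ⊆ flowDomain) :
    ∃ C', C ⊆ C' ∧ IsCompact C' ∧ Convex ℝ C' ∧ C' ⊆ flowDomain := by
  rcases C.eq_empty_or_nonempty with rfl | hne
  · exact ⟨∅, le_rfl, isCompact_empty, convex_empty, empty_subset _⟩
  obtain ⟨p, hp, hpmin⟩ := hC.exists_isMinOn hne
    (f := fun s : ℝ × ℝ × ℝ => min s.1 s.2.1) (by fun_prop)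
  obtain ⟨R, hR⟩ := hC.isBounded.subset_closedBall 0
  have hmin : ∀ s ∈ C, min p.1 p.2.1 ≤ min s.1 s.2.1 := hpmin
  have hpos : 0 < min p.1 p.2.1 := lt_min (hCU hp).1 (hCU hp).2
  refine ⟨Metric.closedBall 0 R ∩ {s | min p.1 p.2.1 ≤ s.1} ∩ {s | min p.1 p.2.1 ≤ s.2.1},
    fun s hs => ⟨⟨hR hs, (hmin s hs).trans (min_le_left _ _)⟩,
      (hmin s hs).trans (min_le_right _ _)⟩, ?_, ?_, fun s hs => ⟨hpos.trans_le hs.1.2, hpos.trans_le hs.2⟩⟩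
  · exact ((isCompact_closedBall _ _).inter_right (isClosed_le continuous_const
      continuous_fst)).inter_right (isClosed_le continuous_const
      (continuous_fst.comp continuous_snd))
  · exact ((convex_closedBall _ _).inter (convex_halfSpace_ge (IsLinearMap.mk (by simp) (by simp)) _)).inter
      (convex_halfSpace_ge (IsLinearMap.mk (by simp) (by simp)) _)

/-- Two expanding solutions with the same data at one time agree. -/
lemma IsFlow.eqOn (hm : 1 < m) (hn : 1 < n) (h : IsFlow m n I s) (h' : IsFlow m n I' s') {t₀ : ℝ}
    (ht₀ : t₀ ∈ I ∩ I') (heq : s t₀ = s' t₀) : EqOn s s' (I ∩ I') := by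
  intro t ht
  have hopen := h.isOpen.inter h'.isOpen
  have hord := h.ordConnected.inter h'.ordConnected
  obtain ⟨p, q, hpq, hsub⟩ : ∃ p q, (t ∈ Ioo p q ∧ t₀ ∈ Ioo p q) ∧ Icc p q ⊆ I ∩ I' := by
    obtain ⟨δ, hδ, hb⟩ := Metric.isOpen_iff.mp hopen t ht
    obtain ⟨δ', hδ', hb'⟩ := Metric.isOpen_iff.mp hopen t₀ ht₀
    have e : ∀ {x y r : ℝ}, |y - x| < r → y ∈ Metric.ball x r := fun h => by
      rwa [Metric.mem_ball, Real.dist_eq]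
    have h1 : t - δ / 2 ∈ I ∩ I' := hb (e (by rw [abs_lt]; constructor <;> linarith))
    have h2 : t + δ / 2 ∈ I ∩ I' := hb (e (by rw [abs_lt]; constructor <;> linarith))
    have h3 : t₀ - δ' / 2 ∈ I ∩ I' := hb' (e (by rw [abs_lt]; constructor <;> linarith))
    have h4 : t₀ + δ' / 2 ∈ I ∩ I' := hb' (e (by rw [abs_lt]; constructor <;> linarith))
    refine ⟨min (t - δ / 2) (t₀ - δ' / 2), max (t + δ / 2) (t₀ + δ' / 2), ⟨⟨?_, ?_⟩, ?_, ?_⟩, ?_⟩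
    · exact (min_le_left _ _).trans_lt (by linarith)
    · exact lt_of_lt_of_le (by linarith) (le_max_left _ _)
    · exact (min_le_right _ _).trans_lt (by linarith)
    · exact lt_of_lt_of_le (by linarith) (le_max_right _ _)
    · apply hord.out
      · rcases min_choice (t - δ / 2) (t₀ - δ' / 2) with h | h <;> rw [h] <;> assumption
      · rcases max_choice (t + δ / 2) (t₀ + δ' / 2) with h | h <;> rw [h] <;> assumption
  have hc1 := isCompact_Icc.image_of_continuousOn (h.continuousOn.mono (hsub.trans inter_subset_left))
  have hc2 := isCompact_Icc.image_of_continuousOn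
    (h'.continuousOn.mono (hsub.trans inter_subset_right))
  have hsubU : s '' Icc p q ∪ s' '' Icc p q ⊆ flowDomain := by
    rintro _ (⟨u, hu, rfl⟩ | ⟨u, hu, rfl⟩)
    · exact h.mem u (hsub hu).1
    · exact h'.mem u (hsub hu).2
  -- Convexity is what turns smoothness on a compact set into a Lipschitz bound there.
  obtain ⟨C, hCsub, hC, hCc, hCU⟩ := exists_convex_flowDomain (hc1.union hc2) hsubU
  obtain ⟨Λ, hΛ⟩ := (((flowField_contDiffOn hm hn).of_le (by simp)).mono hCU).exists_lipschitzOnWith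
    one_ne_zero hCc hC
  exact ODE_solution_unique_of_mem_Ioo (v := fun _ => flowField m n)
    (s := fun _ => C) (fun _ _ => hΛ) hpq.2
    (fun u hu => ⟨h.hasDerivAt u (hsub (Ioo_subset_Icc_self hu)).1, hCsub
      (Or.inl (mem_image_of_mem s (Ioo_subset_Icc_self hu)))⟩)
    (fun u hu => ⟨h'.hasDerivAt u (hsub (Ioo_subset_Icc_self hu)).2, hCsub
      (Or.inr (mem_image_of_mem s' (Ioo_subset_Icc_self hu)))⟩) heq hpq.1

/-- Two expanding solutions with the same data at one time have a common extension. -/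
lemma IsFlow.exists_union (hm : 1 < m) (hn : 1 < n) (h : IsFlow m n I s) (h' : IsFlow m n I' s')
    {t₀ : ℝ} (ht₀ : t₀ ∈ I ∩ I') (heq : s t₀ = s' t₀) :
    ∃ r, IsFlow m n (I ∪ I') r ∧ EqOn r s I ∧ EqOn r s' I' := by
  classical
  have hE := h.eqOn hm hn h' ht₀ heq
  have h1 : EqOn (I.piecewise s s') s I := fun t ht => piecewise_eq_of_mem _ _ _ ht
  have h2 : EqOn (I.piecewise s s') s' I' := fun t ht => by
    by_cases hI : t ∈ I
    · rw [piecewise_eq_of_mem _ _ _ hI, hE ⟨hI, ht⟩]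
    · rw [piecewise_eq_of_notMem _ _ _ hI]
  refine ⟨I.piecewise s s', ⟨h.isOpen.union h'.isOpen, h.nonempty.inl, ?_, ?_, ?_⟩, h1, h2⟩
  · exact (isPreconnected_iff_ordConnected.mp (IsPreconnected.union t₀ ht₀.1 ht₀.2
      (isPreconnected_iff_ordConnected.mpr h.ordConnected)
      (isPreconnected_iff_ordConnected.mpr h'.ordConnected)))
  · rintro t (ht | ht)
    · rw [h1 ht]; exact h.mem t ht
    · rw [h2 ht]; exact h'.mem t ht
  · rintro t (ht | ht)
    · rw [h1 ht]
      exact (h.hasDerivAt t ht).congr_of_eventuallyEq (h1.eventuallyEq_of_mem (h.isOpen.mem_nhds ht))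
    · rw [h2 ht]
      exact (h'.hasDerivAt t ht).congr_of_eventuallyEq
        (h2.eventuallyEq_of_mem (h'.isOpen.mem_nhds ht))

end Continuation

/-! ### Affine changes of time and rescaling -/

section Symmetry

variable {m n : ℕ} {I : Set ℝ} {a b : ℝ → ℝ}

/-- Time translation, time reversal and rescaling of a solution. -/
theorem IsSol.comp_affine (h : IsSol m n I a b) {μ : ℝ} (hμ : μ ≠ 0) (c : ℝ) :
    IsSol m n ((fun t => μ * t + c) ⁻¹' I) (fun t => |μ|⁻¹ * a (μ * t + c))
      (fun t => |μ|⁻¹ * b (μ * t + c)) := by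
  have hφ : ContDiff ℝ ∞ (fun t : ℝ => μ * t + c) := by fun_prop
  have hφd : ∀ t, HasDerivAt (fun t : ℝ => μ * t + c) μ t := fun t => by
    simpa using ((hasDerivAt_id t).const_mul μ).add_const c
  have hopen := h.isOpen.preimage hφ.continuous
  have hμ' : 0 < |μ|⁻¹ := inv_pos.mpr (abs_pos.mpr hμ)
  have hl2 : |μ|⁻¹ ^ 2 * μ ^ 2 = 1 := by
    rw [inv_pow, sq_abs]
    field_simp
  have key : ∀ {f : ℝ → ℝ}, ContDiffOn ℝ ∞ f I → ∀ t, μ * t + c ∈ I →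
      deriv (fun t => |μ|⁻¹ * f (μ * t + c)) t = |μ|⁻¹ * (deriv f (μ * t + c) * μ) ∧
      deriv (deriv (fun t => |μ|⁻¹ * f (μ * t + c))) t =
        |μ|⁻¹ * (deriv (deriv f) (μ * t + c) * μ * μ) := by
    intro f hf t ht
    have h1 : ∀ t, μ * t + c ∈ I → HasDerivAt (fun t => |μ|⁻¹ * f (μ * t + c))
        (|μ|⁻¹ * (deriv f (μ * t + c) * μ)) t := fun t ht =>
      ((differentiableAt_of_smooth h.isOpen hf ht).hasDerivAt.comp t (hφd t)).const_mul _
    refine ⟨(h1 t ht).deriv, ?_⟩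
    have h2 : deriv (fun t => |μ|⁻¹ * f (μ * t + c)) =ᶠ[𝓝 t]
        fun t => |μ|⁻¹ * (deriv f (μ * t + c) * μ) := by
      filter_upwards [hopen.mem_nhds ht] with u hu
      exact (h1 u hu).deriv
    rw [h2.deriv_eq]
    have h3 := (((differentiableAt_deriv_of_smooth h.isOpen hf ht).hasDerivAt.comp t
      (hφd t)).mul_const μ).const_mul |μ|⁻¹
    exact h3.deriv
  refine ⟨hopen, ?_, ?_, ?_, ?_, fun t ht => mul_pos hμ' (h.pos_a _ ht),
    fun t ht => mul_pos hμ' (h.pos_b _ ht), fun t ht => ?_, fun t ht => ?_, fun t ht => ?_⟩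
  · obtain ⟨t, ht⟩ := h.nonempty
    refine ⟨(t - c) / μ, ?_⟩
    rwa [mem_preimage, mul_div_cancel₀ _ hμ, sub_add_cancel]
  · rcases hμ.lt_or_gt with h0 | h0
    · exact h.ordConnected.preimage_anti fun x y hxy => by nlinarith
    · exact h.ordConnected.preimage_mono fun x y hxy => by nlinarith
  · exact contDiffOn_const.mul (h.smooth_a.comp hφ.contDiffOn fun t ht => ht)
  · exact contDiffOn_const.mul (h.smooth_b.comp hφ.contDiffOn fun t ht => ht)
  all_goals
    simp only [(key h.smooth_a t ht).1, (key h.smooth_a t ht).2, (key h.smooth_b t ht).1,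
      (key h.smooth_b t ht).2]
    have e1 := h.eq_time _ ht
    have e2 := h.eq_a _ ht
    have e3 := h.eq_b _ ht
    have ha := (h.pos_a _ ht).ne'
    have hb := (h.pos_b _ ht).ne'
    generalize |μ|⁻¹ = l at *
    have hl0 := hμ'.ne'
  · have : (m : ℝ) * (l * (deriv (deriv a) (μ * t + c) * μ * μ) / (l * a (μ * t + c))) +
        n * (l * (deriv (deriv b) (μ * t + c) * μ * μ) / (l * b (μ * t + c))) =
        μ ^ 2 * (m * (deriv (deriv a) (μ * t + c) / a (μ * t + c)) +
          n * (deriv (deriv b) (μ * t + c) / b (μ * t + c))) := by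
      field_simp
    rw [this, e1, mul_zero]
  · have : (l * a (μ * t + c) * (l * (deriv (deriv a) (μ * t + c) * μ * μ)) -
        (l * (deriv a (μ * t + c) * μ)) ^ 2 +
        (m * (l * (deriv a (μ * t + c) * μ) / (l * a (μ * t + c))) +
          n * (l * (deriv b (μ * t + c) * μ) / (l * b (μ * t + c)))) *
          (l * a (μ * t + c) * (l * (deriv a (μ * t + c) * μ)))) = (l ^ 2 * μ ^ 2) *
        (a (μ * t + c) * deriv (deriv a) (μ * t + c) - deriv a (μ * t + c) ^ 2 +
          (m * (deriv a (μ * t + c) / a (μ * t + c)) + n * (deriv b (μ * t + c) / b (μ * t + c))) *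
          (a (μ * t + c) * deriv a (μ * t + c))) := by
      field_simp
    rw [this, e2, hl2, one_mul]
  · have : (l * b (μ * t + c) * (l * (deriv (deriv b) (μ * t + c) * μ * μ)) -
        (l * (deriv b (μ * t + c) * μ)) ^ 2 +
        (m * (l * (deriv a (μ * t + c) * μ) / (l * a (μ * t + c))) +
          n * (l * (deriv b (μ * t + c) * μ) / (l * b (μ * t + c)))) *
          (l * b (μ * t + c) * (l * (deriv b (μ * t + c) * μ)))) = (l ^ 2 * μ ^ 2) *
        (b (μ * t + c) * deriv (deriv b) (μ * t + c) - deriv b (μ * t + c) ^ 2 +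
          (m * (deriv a (μ * t + c) / a (μ * t + c)) + n * (deriv b (μ * t + c) / b (μ * t + c))) *
          (b (μ * t + c) * deriv b (μ * t + c))) := by
      field_simp
    rw [this, e3, hl2, one_mul]

/-- These transformations are invertible on solutions, so an extension of the transformed solution
transforms back to an extension of the original one. -/
theorem IsMaxSol.comp_affine (h : IsMaxSol m n I a b) {μ : ℝ} (hμ : μ ≠ 0) (c : ℝ) :
    IsMaxSol m n ((fun t => μ * t + c) ⁻¹' I) (fun t => |μ|⁻¹ * a (μ * t + c))
      (fun t => |μ|⁻¹ * b (μ * t + c)) := by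
  refine ⟨h.isSol.comp_affine hμ c, fun I' a' b' h' hI ha hb => ?_⟩
  have inv1 : ∀ t : ℝ, μ⁻¹ * (μ * t + c) + -(μ⁻¹ * c) = t := fun t => by field_simp; ring
  have inv2 : ∀ t : ℝ, μ * (μ⁻¹ * t + -(μ⁻¹ * c)) + c = t := fun t => by field_simp; ring
  have h0 : |μ| ≠ 0 := abs_ne_zero.mpr hμ
  have h1 := h'.comp_affine (inv_ne_zero hμ) (-(μ⁻¹ * c))
  have hmem : ∀ {t}, t ∈ I → μ⁻¹ * t + -(μ⁻¹ * c) ∈ (fun t => μ * t + c) ⁻¹' I := fun {t} ht => by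
    rwa [mem_preimage, inv2]
  have h2 := h.maximal _ _ _ h1 (fun t ht => hI (hmem ht))
    (fun t ht => by
      simp only [ha (hmem ht), inv2, abs_inv, inv_inv]
      exact mul_inv_cancel_left₀ h0 _)
    (fun t ht => by
      simp only [hb (hmem ht), inv2, abs_inv, inv_inv]
      exact mul_inv_cancel_left₀ h0 _)
  ext t
  rw [← h2]
  simp only [mem_preimage, inv1]

end Symmetry

/-! ### Expansion, and collapse of the volume in the past -/

section Expansion

/-- The logarithmic derivative of `a ^ m b ^ n`. -/
def expansion (m n : ℕ) (a b : ℝ → ℝ) (t : ℝ) : ℝ :=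
  m * (deriv a t / a t) + n * (deriv b t / b t)

lemma hasDerivAt_volume {m n : ℕ} {a b : ℝ → ℝ} {a' b' t : ℝ} (ha : HasDerivAt a a' t)
    (hb : HasDerivAt b b' t) (ha0 : a t ≠ 0) (hb0 : b t ≠ 0) :
    HasDerivAt (fun t => a t ^ m * b t ^ n)
      (a t ^ m * b t ^ n * (m * (a' / a t) + n * (b' / b t))) t := by
  have e : ∀ (k : ℕ) {x : ℝ}, x ≠ 0 → (k : ℝ) * x ^ (k - 1) = k * (x ^ k / x) := by
    rintro (_ | k) x hx
    · simp
    · rw [Nat.add_sub_cancel, pow_succ, mul_div_assoc, div_self hx, mul_one]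
  refine ((ha.fun_pow m).fun_mul (hb.fun_pow n)).congr_deriv ?_
  rw [e m ha0, e n hb0]
  field_simp

variable {m n : ℕ} {I : Set ℝ} {a b : ℝ → ℝ}

/-- The constraint in the form that keeps the expansion away from zero. Its last term is positive
because both factors have negative Ricci curvature. -/
lemma IsSol.expansion_sq (h : IsSol m n I a b) {t : ℝ} (ht : t ∈ I) : expansion m n a b t ^ 2 =
    m * (deriv a t / a t) ^ 2 + n * (deriv b t / b t) ^ 2 +
      (m + n - 1) * (m / a t ^ 2 + n / b t ^ 2) := by
  rw [expansion]
  linear_combination h.constraint ht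

/-- This is the Raychaudhuri equation, a rewriting of the time component of the vacuum equations. -/
lemma IsSol.hasDerivAt_expansion (h : IsSol m n I a b) {t : ℝ} (ht : t ∈ I) :
    HasDerivAt (expansion m n a b)
      (-(m * (deriv a t / a t) ^ 2 + n * (deriv b t / b t) ^ 2)) t := by
  have da := (differentiableAt_of_smooth h.isOpen h.smooth_a ht).hasDerivAt
  have db := (differentiableAt_of_smooth h.isOpen h.smooth_b ht).hasDerivAt
  have dda := (differentiableAt_deriv_of_smooth h.isOpen h.smooth_a ht).hasDerivAt
  have ddb := (differentiableAt_deriv_of_smooth h.isOpen h.smooth_b ht).hasDerivAt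
  have ha := (h.pos_a t ht).ne'
  have hb := (h.pos_b t ht).ne'
  refine (((dda.fun_div da ha).const_mul (m : ℝ)).fun_add
    ((ddb.fun_div db hb).const_mul (n : ℝ))).congr_deriv ?_
  have e := h.eq_time t ht
  field_simp at e ⊢
  linear_combination a t * b t * e

lemma IsSol.expansion_sq_pos (hm : 1 < m) (hn : 1 < n) (h : IsSol m n I a b) {t : ℝ}
    (ht : t ∈ I) : 0 < expansion m n a b t ^ 2 := by
  have hm' : (1 : ℝ) < m := by exact_mod_cast hm
  have hn' : (1 : ℝ) < n := by exact_mod_cast hn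
  have hK : (0 : ℝ) < m + n - 1 := by linarith
  have ha := h.pos_a t ht
  have hb := h.pos_b t ht
  rw [h.expansion_sq ht]
  positivity

/-- The expansion of a solution has constant sign. -/
lemma IsSol.expansion_pos_or_neg (hm : 1 < m) (hn : 1 < n) (h : IsSol m n I a b) :
    (∀ t ∈ I, 0 < expansion m n a b t) ∨ ∀ t ∈ I, expansion m n a b t < 0 := by
  have h0 : ∀ t ∈ I, expansion m n a b t ≠ 0 := fun t ht h0 => by
    have := h.expansion_sq_pos hm hn ht
    rw [h0] at this
    norm_num at this
  by_contra! hcon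
  obtain ⟨⟨t, ht, ht0⟩, u, hu, hu0⟩ := hcon
  obtain ⟨w, hw, hw0⟩ := (isPreconnected_iff_ordConnected.mpr h.ordConnected).intermediate_value
    ht hu (fun t ht => (h.hasDerivAt_expansion ht).continuousAt.continuousWithinAt) ⟨ht0, hu0⟩
  exact h0 w hw hw0

lemma IsFlow.comp_sub {s : ℝ → ℝ × ℝ × ℝ} (h : IsFlow m n I s) (c : ℝ) :
    IsFlow m n ((fun t => t - c) ⁻¹' I) (fun t => s (t - c)) := by
  refine ⟨h.isOpen.preimage (by fun_prop), ?_, h.ordConnected.preimage_mono fun x y hxy => by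
    simpa using hxy, fun t ht => h.mem _ ht,
    fun t ht => (h.hasDerivAt _ ht).comp_sub_const t c⟩
  obtain ⟨t, ht⟩ := h.nonempty
  exact ⟨t + c, by simpa using ht⟩

/-- Bounds for an expanding solution whose volume is bounded below. -/
lemma IsSol.exists_bounds (hm : 1 < m) (hn : 1 < n) (h : IsSol m n I a b)
    (hS : ∀ t ∈ I, 0 < expansion m n a b t) {c : ℝ} (hc : 0 < c)
    (hV : ∀ t ∈ I, c ≤ a t ^ m * b t ^ n) {t₁ : ℝ} (ht₁ : t₁ ∈ I) :
    ∃ L σ : ℝ, ∀ t ∈ I, t ≤ t₁ →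
      L ≤ t ∧ |deriv a t / a t| ≤ σ ∧ |deriv b t / b t| ≤ σ := by
  have hm' : (1 : ℝ) < m := by exact_mod_cast hm
  have hn' : (1 : ℝ) < n := by exact_mod_cast hn
  have hK : (0 : ℝ) < m + n - 1 := by linarith
  have da := fun t ht => (differentiableAt_of_smooth h.isOpen h.smooth_a (t := t) ht).hasDerivAt
  have db := fun t ht => (differentiableAt_of_smooth h.isOpen h.smooth_b (t := t) ht).hasDerivAt
  have hVd := fun t (ht : t ∈ I) => hasDerivAt_volume (m := m) (n := n) (da t ht) (db t ht)
    (h.pos_a t ht).ne' (h.pos_b t ht).ne'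
  have hSd := fun t (ht : t ∈ I) => h.hasDerivAt_expansion ht
  -- For the volume `V` and the expansion `S`, the constraint cancels the quadratic terms of `(S
  -- V)'`, so `S V` increases. With `V ≥ c` this bounds `S` in the past.
  have hmono : MonotoneOn (fun t => expansion m n a b t * (a t ^ m * b t ^ n)) I := by
    have hd := fun t (ht : t ∈ I) => (hSd t ht).fun_mul (hVd t ht)
    refine monotoneOn_of_deriv_nonneg h.ordConnected.convex
      (fun t ht => (hd t ht).continuousAt.continuousWithinAt)
      (fun t ht => (hd t (interior_subset ht)).differentiableAt.differentiableWithinAt)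
      fun t ht => ?_
    have ht := interior_subset ht
    have ha := h.pos_a t ht
    have hb := h.pos_b t ht
    rw [(hd t ht).deriv]
    have e := h.expansion_sq ht
    have : -(m * (deriv a t / a t) ^ 2 + n * (deriv b t / b t) ^ 2) * (a t ^ m * b t ^ n) +
        expansion m n a b t * (a t ^ m * b t ^ n *
          (m * (deriv a t / a t) + n * (deriv b t / b t))) =
        (a t ^ m * b t ^ n) * ((m + n - 1) * (m / a t ^ 2 + n / b t ^ 2)) := by
      rw [← expansion]
      linear_combination (a t ^ m * b t ^ n) * e
    rw [this]
    positivity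
  -- By Cauchy–Schwarz the derivative of `1/S` is at least `1/(m + n)`. Since `1/S` stays positive,
  -- the past has finite length.
  have hinv : MonotoneOn (fun t => (expansion m n a b t)⁻¹ - t / (m + n)) I := by
    have hd := fun t (ht : t ∈ I) => ((hSd t ht).fun_inv (hS t ht).ne').fun_sub
      ((hasDerivAt_id t).div_const ((m : ℝ) + n))
    refine monotoneOn_of_deriv_nonneg h.ordConnected.convex
      (fun t ht => (hd t ht).continuousAt.continuousWithinAt)
      (fun t ht => (hd t (interior_subset ht)).differentiableAt.differentiableWithinAt)
      fun t ht => ?_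
    have ht := interior_subset ht
    have hS2 := pow_pos (hS t ht) 2
    have hd' := (hd t ht).deriv
    simp only [id] at hd'
    rw [hd', neg_neg, sub_nonneg, div_le_div_iff₀ (by positivity) hS2, expansion]
    nlinarith [mul_nonneg (mul_nonneg (Nat.cast_nonneg (α := ℝ) m) (Nat.cast_nonneg (α := ℝ) n))
      (sq_nonneg (deriv a t / a t - deriv b t / b t))]
  refine ⟨t₁ - (m + n) * (expansion m n a b t₁)⁻¹,
    expansion m n a b t₁ * (a t₁ ^ m * b t₁ ^ n) / c, fun t ht htt => ?_⟩
  have hSt := hS t ht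
  have hle : expansion m n a b t ≤ expansion m n a b t₁ * (a t₁ ^ m * b t₁ ^ n) / c := by
    rw [le_div_iff₀ hc]
    exact (mul_le_mul_of_nonneg_left (hV t ht) hSt.le).trans (hmono ht ht₁ htt)
  have hsq := h.expansion_sq ht
  have ha := h.pos_a t ht
  have hb := h.pos_b t ht
  have hpos : 0 ≤ (m + n - 1) * (m / a t ^ 2 + n / b t ^ 2) := by positivity
  have hu := sq_nonneg (deriv a t / a t)
  have hv := sq_nonneg (deriv b t / b t)
  refine ⟨?_, (abs_le_of_sq_le_sq ?_ hSt.le).trans hle, (abs_le_of_sq_le_sq ?_ hSt.le).trans hle⟩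
  · have h1 := hinv ht ht₁ htt
    simp only at h1
    have h2 : 0 < (expansion m n a b t)⁻¹ := inv_pos.mpr hSt
    have h3 : (t₁ - t) / (m + n) ≤ (expansion m n a b t₁)⁻¹ := by
      rw [sub_div]
      linarith
    rw [div_le_iff₀ (by positivity)] at h3
    linarith
  · nlinarith
  · nlinarith

/-- The mean value inequality for `log f` over a time span of bounded length. -/
lemma exists_Icc_of_logDeriv_le (hI : I.OrdConnected) {f : ℝ → ℝ}
    (hd : ∀ t ∈ I, DifferentiableAt ℝ f t) (hf : ∀ t ∈ I, 0 < f t) {L σ t₁ : ℝ} (ht₁ : t₁ ∈ I)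
    (hσ : ∀ t ∈ I, t ≤ t₁ → L ≤ t ∧ |deriv f t / f t| ≤ σ) :
    ∃ p q : ℝ, 0 < p ∧ ∀ t ∈ I, t ≤ t₁ → f t ∈ Icc p q := by
  refine ⟨Real.exp (Real.log (f t₁) - σ * (t₁ - L)), Real.exp (Real.log (f t₁) + σ * (t₁ - L)),
    Real.exp_pos _, fun t ht htt => ?_⟩
  have hσ0 : 0 ≤ σ := (abs_nonneg _).trans (hσ t₁ ht₁ le_rfl).2
  have h1 := (hI.convex.inter (convex_Iic t₁)).norm_image_sub_le_of_norm_hasDerivWithin_le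
    (f := fun t => Real.log (f t)) (f' := fun t => deriv f t / f t) (C := σ)
    (fun t ht => ((hd t ht.1).hasDerivAt.log (hf t ht.1).ne').hasDerivWithinAt)
    (fun t ht => (hσ t ht.1 ht.2).2) ⟨ht₁, self_mem_Iic⟩ ⟨ht, htt⟩
  rw [Real.norm_eq_abs, Real.norm_eq_abs, abs_of_nonpos (sub_nonpos.mpr htt), neg_sub] at h1
  have h2 := h1.trans (mul_le_mul_of_nonneg_left
    (sub_le_sub_left (hσ t ht htt).1 t₁) hσ0)
  rw [abs_le] at h2
  rw [← Real.exp_log (hf t ht)]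
  exact ⟨Real.exp_le_exp.mpr (by linarith), Real.exp_le_exp.mpr (by linarith)⟩

/-- The volume of a maximal expanding solution becomes arbitrarily small. -/
theorem IsMaxSol.exists_volume_lt (hm : 1 < m) (hn : 1 < n) (h : IsMaxSol m n I a b)
    (hS : ∀ t ∈ I, 0 < expansion m n a b t) {c : ℝ} (hc : 0 < c) :
    ∃ t ∈ I, a t ^ m * b t ^ n < c := by
  by_contra! hV
  have hsol := h.isSol
  obtain ⟨t₁, ht₁⟩ := hsol.nonempty
  obtain ⟨L, σ, hLσ⟩ := hsol.exists_bounds hm hn hS hc hV ht₁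
  obtain ⟨p, q, hp, hpq⟩ := exists_Icc_of_logDeriv_le hsol.ordConnected
    (fun t ht => differentiableAt_of_smooth hsol.isOpen hsol.smooth_a ht) hsol.pos_a ht₁
    (fun t ht htt => ⟨(hLσ t ht htt).1, (hLσ t ht htt).2.1⟩)
  obtain ⟨p', q', hp', hpq'⟩ := exists_Icc_of_logDeriv_le hsol.ordConnected
    (fun t ht => differentiableAt_of_smooth hsol.isOpen hsol.smooth_b ht) hsol.pos_b ht₁
    (fun t ht htt => ⟨(hLσ t ht htt).1, (hLσ t ht htt).2.2⟩)
  have hσ0 : 0 ≤ σ := (abs_nonneg _).trans (hLσ t₁ ht₁ le_rfl).2.1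
  have hmem : ∀ t ∈ I, t ≤ t₁ →
      (a t, b t, deriv b t) ∈ Icc p q ×ˢ Icc p' q' ×ˢ Icc (-(σ * q')) (σ * q') := by
    intro t ht htt
    refine ⟨hpq t ht htt, hpq' t ht htt, ?_⟩
    have hb := hsol.pos_b t ht
    have h1 := (hLσ t ht htt).2.2
    rw [abs_div, abs_of_pos hb, div_le_iff₀ hb] at h1
    exact abs_le.mp (h1.trans (mul_le_mul_of_nonneg_left (hpq' t ht htt).2 hσ0))
  obtain ⟨ε, hε, hγ⟩ := exists_uniform_flow isOpen_flowDomain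
    ((flowField_contDiffOn hm hn).of_le (by simp))
    (isCompact_Icc.prod (isCompact_Icc.prod isCompact_Icc) :
      IsCompact (Icc p q ×ˢ Icc p' q' ×ˢ Icc (-(σ * q')) (σ * q')))
    (fun s hs => ⟨hp.trans_le hs.1.1, hp'.trans_le hs.2.1.1⟩)
  have hbdd : BddBelow I := by
    refine ⟨L, fun t ht => ?_⟩
    rcases le_total t t₁ with htt | htt
    · exact (hLσ t ht htt).1
    · exact (hLσ t₁ ht₁ le_rfl).1.trans htt
  -- Restarting the flow closer to `sInf I` than the uniform existence time `ε` carries it past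
  -- `sInf I`. By maximality the infimum would then belong to the open interval `I`.
  obtain ⟨t₂, ht₂, ht₂₁, ht₂ε⟩ : ∃ t ∈ I, t ≤ t₁ ∧ t < sInf I + ε := by
    obtain ⟨t, ht, htε⟩ := exists_lt_of_csInf_lt hsol.nonempty
      (show sInf I < sInf I + ε by linarith)
    rcases le_total t t₁ with htt | htt
    · exact ⟨t, ht, htt, htε⟩
    · exact ⟨t₁, ht₁, le_rfl, htt.trans_lt htε⟩
  obtain ⟨γ, hγ0, hγd⟩ := hγ _ (hmem t₂ ht₂ ht₂₁)
  have hflow : IsFlow m n (Ioo (-ε) ε) γ := ⟨isOpen_Ioo, ⟨0, by linarith, hε⟩, ordConnected_Ioo,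
    fun t ht => (hγd t ht).1, fun t ht => (hγd t ht).2⟩
  obtain ⟨r, hr, hrs, -⟩ := (hsol.isFlow hm hn hS).exists_union hm hn (hflow.comp_sub t₂)
    (t₀ := t₂) ⟨ht₂, by simp [hε]⟩ (by rw [sub_self, hγ0])
  have hU := h.maximal _ _ _ (hr.isSol hm hn) subset_union_left
    (fun t ht => by simp only [hrs ht]) (fun t ht => by simp only [hrs ht])
  have hle := csInf_le hbdd ht₂
  have hinf : sInf I ∈ I := hU.subset (Or.inr (by
    rw [mem_preimage, mem_Ioo]
    constructor <;> linarith))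
  obtain ⟨δ, hδ, hball⟩ := Metric.isOpen_iff.mp hsol.isOpen _ hinf
  have h1 : sInf I - δ / 2 ∈ I := hball (by
    rw [Metric.mem_ball, Real.dist_eq, abs_lt]; constructor <;> linarith)
  linarith [csInf_le hbdd h1]

end Expansion

/-! ### Accelerating solutions near zero volume -/

section EarlyTimes

/-- Compared with `sub_pos_of_mem_unit`, this includes `z = 1` at the price of `β < 1`, so that `ż >
0` also on the line `z = 1`. -/
lemma orbit_sub_pos {m n z β : ℝ} (hm : 1 < m) (hn : 1 < n) (hz : 0 < z) (hz1 : z ≤ 1)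
    (hβ : 0 < β) (hβ1 : β < 1) : 0 < orbitX m n z β - β * z := by
  have h := orbitD_mul hm hn z β
  have hD := orbitD_pos hm hn z β
  have h1 : 0 < m + n - 1 := by linarith
  have h2 : 0 < m - 1 := by linarith
  have h3 : 0 < orbitD m n z β + (m + n - 1) * β * z := by positivity
  have h4 : 0 < m + n * z ^ 2 - (m + n) * β ^ 2 * z ^ 2 := by
    have h5 : z ^ 2 ≤ 1 := by nlinarith
    have h6 : β ^ 2 < 1 := by nlinarith
    have h7 : 0 < z ^ 2 := by positivity
    have h8 : β ^ 2 * z ^ 2 < z ^ 2 := by nlinarith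
    nlinarith
  have h5 := orbitX_sub hm hn z β
  have h6 : 0 < m * (orbitD m n z β - (m + n - 1) * β * z) := by
    rw [← mul_pos_iff_of_pos_right h3, mul_assoc, h]
    positivity
  rw [← mul_pos_iff_of_pos_left h2, h5]
  exact (mul_pos_iff_of_pos_left (by linarith)).mp h6

/-- The right-hand side is `b β̇`. For `z ≥ 1`, the bound `m ≤ m z²` in the factorisation gives `2 m
β (ȧ - β z) ≤ (m + n)(1 - β²) z`, and what is left over is the stated multiple of `1 - β²`. -/
lemma orbit_growth {m n z β : ℝ} (hm : 1 < m) (hn : 1 < n) (hz : 1 ≤ z)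
    (hβ : 0 < β) (hβ1 : β < 1) :
    (m + n - 2) / 2 * (1 - β ^ 2) ≤ m + n - 1 - β * (m * (orbitX m n z β / z) + (n - 1) * β) := by
  have hz0 : 0 < z := by linarith
  have h := orbitD_mul hm hn z β
  have h1 : 0 < m + n - 1 := by linarith
  have h2 : 0 < m - 1 := by linarith
  have h5 := orbitX_sub hm hn z β
  have hβ2 : 0 < 1 - β ^ 2 := by nlinarith
  obtain ⟨y, hy⟩ : ∃ y, y = orbitX m n z β - β * z := ⟨_, rfl⟩
  have hX : orbitX m n z β = y + β * z := by linarith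
  rw [← hy] at h5
  have key : 2 * m * β * y ≤ (m + n) * (1 - β ^ 2) * z := by
    rcases le_total y 0 with h0 | h0
    · have h6 : 2 * m * β * y ≤ 0 := mul_nonpos_of_nonneg_of_nonpos (by positivity) h0
      have h7 : 0 ≤ (m + n) * (1 - β ^ 2) * z := by positivity
      linarith
    · have h6 : 0 ≤ (m - 1) * y := by positivity
      rw [h5] at h6
      have h7 : m * y * (orbitD m n z β + (m + n - 1) * β * z) =
          (m + n - 1) * (m + n * z ^ 2 - (m + n) * β ^ 2 * z ^ 2) := by
        apply mul_left_cancel₀ h2.ne'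
        rw [← h5] at h
        linear_combination h
      have h8 : m * y * (2 * ((m + n - 1) * β * z)) ≤
          m * y * (orbitD m n z β + (m + n - 1) * β * z) :=
        mul_le_mul_of_nonneg_left (by linarith) (by positivity)
      have hzm : m * 1 ≤ m * z ^ 2 :=
        mul_le_mul_of_nonneg_left (one_le_pow₀ hz) (by linarith)
      have h9 : (m + n - 1) * (m + n * z ^ 2 - (m + n) * β ^ 2 * z ^ 2) ≤
          (m + n - 1) * ((m + n) * (1 - β ^ 2) * z ^ 2) :=
        mul_le_mul_of_nonneg_left (by linarith) h1.le
      have h10 : ((m + n - 1) * z) * (2 * m * β * y) ≤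
          ((m + n - 1) * z) * ((m + n) * (1 - β ^ 2) * z) := by nlinarith
      exact le_of_mul_le_mul_left h10 (by positivity)
  have e : orbitX m n z β / z = y / z + β := by
    rw [hX]; field_simp
  have h11 : 2 * m * β * (y / z) ≤ (m + n) * (1 - β ^ 2) := by
    rw [← mul_div_assoc, div_le_iff₀ hz0]
    exact key
  rw [e]
  nlinarith

variable {m n : ℕ} {I : Set ℝ} {s : ℝ → ℝ × ℝ × ℝ}

lemma IsFlow.hasDerivAt_volume (h : IsFlow m n I s) {t : ℝ} (ht : t ∈ I) :
    HasDerivAt (fun t => (s t).1 ^ m * (s t).2.1 ^ n) ((s t).1 ^ m * (s t).2.1 ^ n *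
      (m * (orbitX m n ((s t).1 / (s t).2.1) (s t).2.2 / (s t).1) +
        n * ((s t).2.2 / (s t).2.1))) t :=
  WarpedCosmology.hasDerivAt_volume (h.hasDerivAt_fst ht) (h.hasDerivAt_snd ht) (h.mem t ht).1.ne'
    (h.mem t ht).2.ne'

lemma IsFlow.strictMonoOn_volume (hm : 1 < m) (hn : 1 < n) (h : IsFlow m n I s) :
    StrictMonoOn (fun t => (s t).1 ^ m * (s t).2.1 ^ n) I := by
  refine strictMonoOn_of_deriv_pos h.ordConnected.convex
    (fun t ht => (h.hasDerivAt_volume ht).continuousAt.continuousWithinAt) fun t ht => ?_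
  have ht := interior_subset ht
  have ha := (h.mem t ht).1
  have hb := (h.mem t ht).2
  have h1 := h.expanding hm hn ht
  rw [(h.hasDerivAt_fst ht).deriv, (h.hasDerivAt_snd ht).deriv] at h1
  rw [(h.hasDerivAt_volume ht).deriv]
  positivity

lemma IsFlow.exists_volume_lt_of_le (hm : 1 < m) (hn : 1 < n) (h : IsFlow m n I s)
    (hV : ∀ c > 0, ∃ t ∈ I, (s t).1 ^ m * (s t).2.1 ^ n < c) {t₁ : ℝ} (ht₁ : t₁ ∈ I) {c : ℝ}
    (hc : 0 < c) : ∃ t ∈ I, t < t₁ ∧ (s t).1 ^ m * (s t).2.1 ^ n < c := by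
  have ha := (h.mem t₁ ht₁).1
  have hb := (h.mem t₁ ht₁).2
  obtain ⟨t, ht, htc⟩ := hV (min c ((s t₁).1 ^ m * (s t₁).2.1 ^ n)) (lt_min hc (by positivity))
  refine ⟨t, ht, ?_, htc.trans_le (min_le_left _ _)⟩
  exact ((h.strictMonoOn_volume hm hn).lt_iff_lt ht ht₁).mp (htc.trans_le (min_le_right _ _))

/-- If `|ḃ| < 1` and the volume tends to zero in the past, then `ḃ > 0`. -/
lemma IsFlow.trd_pos (hm : 1 < m) (hn : 1 < n) (h : IsFlow m n I s)
    (hV : ∀ c > 0, ∃ t ∈ I, (s t).1 ^ m * (s t).2.1 ^ n < c)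
    (hβ : ∀ t ∈ I, (s t).2.2 ^ 2 < 1) : ∀ t ∈ I, 0 < (s t).2.2 := by
  have hm' : (1 : ℝ) < m := by exact_mod_cast hm
  have hn' : (1 : ℝ) < n := by exact_mod_cast hn
  -- `β V` is strictly increasing, while `|β V| < V` takes arbitrarily small values in the past, so
  -- `β V` can nowhere be nonpositive.
  have hmono : StrictMonoOn (fun t => (s t).2.2 * ((s t).1 ^ m * (s t).2.1 ^ n)) I := by
    have hd := fun t (ht : t ∈ I) => (h.hasDerivAt_trd ht).fun_mul (h.hasDerivAt_volume ht)
    refine strictMonoOn_of_deriv_pos h.ordConnected.convex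
      (fun t ht => (hd t ht).continuousAt.continuousWithinAt) fun t ht => ?_
    have ht := interior_subset ht
    have ha := (h.mem t ht).1
    have hb := (h.mem t ht).2
    rw [(hd t ht).deriv]
    generalize orbitX m n ((s t).1 / (s t).2.1) (s t).2.2 = x
    have hVp : 0 < (s t).1 ^ m * (s t).2.1 ^ n := by positivity
    generalize (s t).1 ^ m * (s t).2.1 ^ n = V at *
    have hK : (0 : ℝ) < m + n - 1 := by linarith
    calc (0 : ℝ) < V * (m + n - 1 + (s t).2.2 ^ 2) / (s t).2.1 := by positivity
      _ = _ := by field_simp; ring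
  intro t ht
  by_contra! hneg
  have ha := (h.mem t ht).1
  have hb := (h.mem t ht).2
  obtain ⟨t', ht', htt', -⟩ := h.exists_volume_lt_of_le hm hn hV ht one_pos
  have h1 := hmono ht' ht htt'
  have h2 : (s t).2.2 * ((s t).1 ^ m * (s t).2.1 ^ n) ≤ 0 :=
    mul_nonpos_of_nonpos_of_nonneg hneg (by positivity)
  obtain ⟨t'', ht'', htt'', hlt⟩ := h.exists_volume_lt_of_le hm hn hV ht'
    (neg_pos.mpr (h1.trans_le h2))
  have h3 := hmono ht'' ht' htt''
  have ha := (h.mem t'' ht'').1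
  have hb := (h.mem t'' ht'').2
  have h4 : -1 < (s t'').2.2 := by nlinarith [hβ t'' ht'']
  have h5 : 0 < (s t'').1 ^ m * (s t'').2.1 ^ n := by positivity
  simp only at h3 hlt
  nlinarith

/-- The ratio of the scale factors is less than one at some time. -/
lemma IsFlow.exists_ratio_lt_one (hm : 1 < m) (hn : 1 < n) (h : IsFlow m n I s)
    (hV : ∀ c > 0, ∃ t ∈ I, (s t).1 ^ m * (s t).2.1 ^ n < c)
    (hβ : ∀ t ∈ I, (s t).2.2 ^ 2 < 1) : ∃ t ∈ I, (s t).1 / (s t).2.1 < 1 := by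
  have hm' : (1 : ℝ) < m := by exact_mod_cast hm
  have hn' : (1 : ℝ) < n := by exact_mod_cast hn
  by_contra! hz
  have hpos := h.trd_pos hm hn hV hβ
  have hc : (0 : ℝ) < m + n - 2 := by linarith
  -- If `z ≥ 1` always, then `b ^ (m + n - 2) (1 - β²)` is nonincreasing in time. So `b`, and with
  -- it `a ≥ b`, is bounded below in the past, against the vanishing volume.
  have hanti : AntitoneOn (fun t => Real.log (s t).2.1 +
      Real.log (1 - (s t).2.2 ^ 2) / (m + n - 2)) I := by
    have hd := fun t (ht : t ∈ I) => ((h.hasDerivAt_snd ht).log (h.mem t ht).2.ne').fun_add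
      (((((h.hasDerivAt_trd ht).fun_pow 2).const_sub 1).log
        (sub_pos.mpr (hβ t ht)).ne').div_const ((m : ℝ) + n - 2))
    refine antitoneOn_of_deriv_nonpos h.ordConnected.convex
      (fun t ht => (hd t ht).continuousAt.continuousWithinAt)
      (fun t ht => (hd t (interior_subset ht)).differentiableAt.differentiableWithinAt)
      fun t ht => ?_
    have ht := interior_subset ht
    have ha := (h.mem t ht).1
    have hb := (h.mem t ht).2
    have hp := hpos t ht
    have hβt := sub_pos.mpr (hβ t ht)
    rw [(hd t ht).deriv]
    have hg := orbit_growth hm' hn' (hz t ht) hp (by nlinarith [hβ t ht])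
    have e : orbitX m n ((s t).1 / (s t).2.1) (s t).2.2 / ((s t).1 / (s t).2.1) =
        orbitX m n ((s t).1 / (s t).2.1) (s t).2.2 * (s t).2.1 / (s t).1 := by field_simp
    rw [e, ← mul_div_assoc, ← mul_assoc] at hg
    obtain ⟨R, hR⟩ : ∃ R, R = (m : ℝ) + n - 1 - (s t).2.2 *
      (m * orbitX m n ((s t).1 / (s t).2.1) (s t).2.2 * (s t).2.1 / (s t).1
        + (n - 1) * (s t).2.2) := ⟨_, rfl⟩
    rw [← hR] at hg ⊢
    have : (s t).2.2 / (s t).2.1 + -(((2 : ℕ) : ℝ) * (s t).2.2 ^ (2 - 1) * (R / (s t).2.1)) /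
        (1 - (s t).2.2 ^ 2) / (m + n - 2) = -(2 * (s t).2.2 / ((s t).2.1 *
          ((1 - (s t).2.2 ^ 2) * (m + n - 2)))) *
          (R - (m + n - 2) / 2 * (1 - (s t).2.2 ^ 2)) := by
      have := hβt.ne'
      have := hc.ne'
      field_simp
      push_cast
      ring
    rw [this]
    exact mul_nonpos_of_nonpos_of_nonneg (neg_nonpos.mpr (by positivity)) (by linarith)
  obtain ⟨t₁, ht₁⟩ := h.nonempty
  obtain ⟨p, hp⟩ : ∃ p, p = Real.exp (Real.log (s t₁).2.1 +
      Real.log (1 - (s t₁).2.2 ^ 2) / (m + n - 2)) := ⟨_, rfl⟩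
  have hp0 : 0 < p := hp ▸ Real.exp_pos _
  obtain ⟨t, ht, htt, hlt⟩ := h.exists_volume_lt_of_le hm hn hV ht₁
    (show 0 < p ^ m * p ^ n by positivity)
  have ha := (h.mem t ht).1
  have hb := (h.mem t ht).2
  have hpb : p ≤ (s t).2.1 := by
    rw [hp, ← Real.le_log_iff_exp_le hb]
    refine (hanti ht ht₁ htt.le).trans ?_
    have h1 : Real.log (1 - (s t).2.2 ^ 2) ≤ 0 :=
      Real.log_nonpos (sub_nonneg.mpr (hβ t ht).le) (by nlinarith [sq_nonneg (s t).2.2])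
    have h2 := div_nonpos_of_nonpos_of_nonneg h1 hc.le
    simp only
    linarith
  have hpa : p ≤ (s t).1 := hpb.trans ((one_le_div hb).mp (hz t ht))
  have : p ^ m * p ^ n ≤ (s t).1 ^ m * (s t).2.1 ^ n := by gcongr
  linarith

/-- Before a time at which the ratio of the scale factors is less than one, it is increasing. -/
lemma IsFlow.strictMonoOn_ratio (hm : 1 < m) (hn : 1 < n) (h : IsFlow m n I s)
    (hβ : ∀ t ∈ I, 0 < (s t).2.2 ∧ (s t).2.2 < 1) {t₁ : ℝ} (ht₁ : t₁ ∈ I)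
    (hz : (s t₁).1 / (s t₁).2.1 < 1) :
    StrictMonoOn (fun t => (s t).1 / (s t).2.1) (I ∩ Iic t₁) := by
  have hm' : (1 : ℝ) < m := by exact_mod_cast hm
  have hn' : (1 : ℝ) < n := by exact_mod_cast hn
  have hpos : ∀ t ∈ I, (s t).1 / (s t).2.1 ≤ 1 →
      0 < (orbitX m n ((s t).1 / (s t).2.1) (s t).2.2 - (s t).2.2 * ((s t).1 / (s t).2.1))
        / (s t).2.1 := by
    intro t ht hle
    have ha := (h.mem t ht).1
    have hb := (h.mem t ht).2
    exact div_pos (orbit_sub_pos hm' hn' (by positivity) hle (hβ t ht).1 (hβ t ht).2) hb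
  -- Since `ż > 0` at `z = 1`, that line cannot be reached backwards from `z < 1`. The substitution
  -- `u = -t` puts this in the forward form of the comparison principle.
  have hle : ∀ t ∈ I, t ≤ t₁ → (s t).1 / (s t).2.1 ≤ 1 := by
    intro t ht htt
    have hmem : ∀ u ∈ Icc (-t₁) (-t), -u ∈ I := fun u hu =>
      h.ordConnected.out ht ht₁ ⟨by linarith [hu.2], by linarith [hu.1]⟩
    have hd : ∀ u ∈ Icc (-t₁) (-t), HasDerivAt (fun u => (s (-u)).1 / (s (-u)).2.1)
        (-((orbitX m n ((s (-u)).1 / (s (-u)).2.1) (s (-u)).2.2 -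
          (s (-u)).2.2 * ((s (-u)).1 / (s (-u)).2.1)) / (s (-u)).2.1)) u := fun u hu => by
      have := (h.hasDerivAt_ratio (hmem u hu)).comp u (hasDerivAt_neg u)
      rwa [mul_neg_one] at this
    have := image_le_of_deriv_right_lt_deriv_boundary (B := fun _ => 1) (B' := fun _ => 0)
      (fun u hu => (hd u hu).continuousAt.continuousWithinAt)
      (fun u hu => (hd u (Ico_subset_Icc_self hu)).hasDerivWithinAt) (by simpa using hz.le)
      (fun u => hasDerivAt_const u 1)
      (fun u hu hu1 => neg_lt_zero.mpr (hpos (-u) (hmem u (Ico_subset_Icc_self hu)) hu1.le))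
      (right_mem_Icc.mpr (neg_le_neg htt))
    simpa using this
  refine strictMonoOn_of_deriv_pos (h.ordConnected.convex.inter (convex_Iic t₁))
    (fun t ht => (h.hasDerivAt_ratio ht.1).continuousAt.continuousWithinAt) fun t ht => ?_
  have ht := interior_subset ht
  rw [(h.hasDerivAt_ratio ht.1).deriv]
  exact hpos t ht.1 (hle t ht.1 ht.2)

/-- The ratio of the scale factors becomes arbitrarily small in the past. -/
lemma IsFlow.exists_ratio_lt (hm : 1 < m) (hn : 1 < n) (h : IsFlow m n I s)
    (hV : ∀ c > 0, ∃ t ∈ I, (s t).1 ^ m * (s t).2.1 ^ n < c)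
    (hβ : ∀ t ∈ I, 0 < (s t).2.2 ∧ (s t).2.2 < 1) {t₁ : ℝ} (ht₁ : t₁ ∈ I)
    (hz : (s t₁).1 / (s t₁).2.1 < 1) {ε : ℝ} (hε : 0 < ε) :
    ∃ t ∈ I, t ≤ t₁ ∧ (s t).1 / (s t).2.1 < ε := by
  have hm' : (1 : ℝ) < m := by exact_mod_cast hm
  have hn' : (1 : ℝ) < n := by exact_mod_cast hn
  by_contra! hge
  have hmono := (h.strictMonoOn_ratio hm hn hβ ht₁ hz).monotoneOn
  have hmem : ∀ t ∈ I ∩ Iic t₁, ((s t).1 / (s t).2.1, (s t).2.2) ∈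
      Icc ε ((s t₁).1 / (s t₁).2.1) ×ˢ Icc (0 : ℝ) 1 := fun t ht =>
    ⟨⟨hge t ht.1 ht.2, hmono ht ⟨ht₁, self_mem_Iic⟩ ht.2⟩, (hβ t ht.1).1.le, (hβ t ht.1).2.le⟩
  have hcomp : IsCompact (Icc ε ((s t₁).1 / (s t₁).2.1) ×ˢ Icc (0 : ℝ) 1) :=
    isCompact_Icc.prod isCompact_Icc
  have hXc := (orbitX_contDiff hm' hn').continuous
  have hyc : Continuous fun p : ℝ × ℝ => orbitX m n p.1 p.2 - p.2 * p.1 := by fun_prop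
  obtain ⟨p, hp, hpmin⟩ := hcomp.exists_isMinOn ⟨_, hmem t₁ ⟨ht₁, self_mem_Iic⟩⟩ hyc.continuousOn
  obtain ⟨C, hC⟩ := hcomp.exists_bound_of_continuousOn hXc.continuousOn
  obtain ⟨δ, hδ⟩ : ∃ δ, δ = orbitX m n p.1 p.2 - p.2 * p.1 := ⟨_, rfl⟩
  have hδ0 : 0 < δ := by
    have h1 := sub_pos_of_mem_unit hm' hn' (hε.le.trans hp.1.1) (hp.1.2.trans_lt hz) hp.2.1 hp.2.2
    rw [← orbitX_sub hm' hn', ← hδ] at h1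
    exact (mul_pos_iff_of_pos_left (by linarith)).mp h1
  have hC0 : 0 ≤ C := (norm_nonneg _).trans (hC p hp)
  -- On the compact rectangle `ȧ - β z ≥ δ` and `ȧ ≤ C`, hence `d log z ≥ κ d log a`. If `z ≥ ε`,
  -- this bounds `a` below in the past, and `b ≥ a` as well.
  obtain ⟨κ, hκ⟩ : ∃ κ, κ = δ / (C + 1) := ⟨_, rfl⟩
  have hκ0 : 0 < κ := hκ ▸ by positivity
  have hG : MonotoneOn (fun t => Real.log ((s t).1 / (s t).2.1) - κ * Real.log (s t).1)
      (I ∩ Iic t₁) := by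
    have hd := fun t (ht : t ∈ I) => ((h.hasDerivAt_ratio ht).log
      (div_pos (h.mem t ht).1 (h.mem t ht).2).ne').fun_sub
      (((h.hasDerivAt_fst ht).log (h.mem t ht).1.ne').const_mul κ)
    refine monotoneOn_of_deriv_nonneg (h.ordConnected.convex.inter (convex_Iic t₁))
      (fun t ht => (hd t ht.1).continuousAt.continuousWithinAt)
      (fun t ht => (hd t (interior_subset ht).1).differentiableAt.differentiableWithinAt)
      fun t ht => ?_
    have ht := interior_subset ht
    have ha := (h.mem t ht.1).1
    have hb := (h.mem t ht.1).2
    have h1 : δ ≤ orbitX m n ((s t).1 / (s t).2.1) (s t).2.2 -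
        (s t).2.2 * ((s t).1 / (s t).2.1) := hδ ▸ hpmin (hmem t ht)
    have h2 := (le_abs_self _).trans (hC _ (hmem t ht))
    simp only at h2
    rw [(hd t ht.1).deriv]
    generalize orbitX m n ((s t).1 / (s t).2.1) (s t).2.2 = x at *
    have h3 : κ * x ≤ δ := by
      rw [hκ, div_mul_eq_mul_div, div_le_iff₀ (by positivity)]
      exact mul_le_mul_of_nonneg_left (by linarith) hδ0.le
    have : (x - (s t).2.2 * ((s t).1 / (s t).2.1)) / (s t).2.1 / ((s t).1 / (s t).2.1) -
        κ * (x / (s t).1) = (x - (s t).2.2 * ((s t).1 / (s t).2.1) - κ * x) / (s t).1 := by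
      field_simp
    rw [this]
    exact div_nonneg (by linarith) ha.le
  obtain ⟨q, hq⟩ : ∃ q, q = Real.exp ((Real.log ε - (Real.log ((s t₁).1 / (s t₁).2.1) -
      κ * Real.log (s t₁).1)) / κ) := ⟨_, rfl⟩
  have hq0 : 0 < q := hq ▸ Real.exp_pos _
  obtain ⟨t, ht, htt, hlt⟩ := h.exists_volume_lt_of_le hm hn hV ht₁
    (show 0 < q ^ m * q ^ n by positivity)
  have ha := (h.mem t ht).1
  have hb := (h.mem t ht).2
  have hqa : q ≤ (s t).1 := by
    rw [hq, ← Real.le_log_iff_exp_le ha, div_le_iff₀ hκ0]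
    have h1 := hG ⟨ht, htt.le⟩ ⟨ht₁, self_mem_Iic⟩ htt.le
    have h2 := Real.log_le_log hε (hge t ht htt.le)
    simp only at h1
    linarith
  have hqb : q ≤ (s t).2.1 := by
    refine hqa.trans ((div_le_one hb).mp ?_)
    exact (hmono ⟨ht, htt.le⟩ ⟨ht₁, self_mem_Iic⟩ htt.le).trans hz.le
  have : q ^ m * q ^ n ≤ (s t).1 ^ m * (s t).2.1 ^ n := by gcongr
  linarith

end EarlyTimes

/-! ### Every accelerating maximal solution is the regular one -/

section Uniqueness

variable {m n : ℕ} {I : Set ℝ} {B : ℝ → ℝ}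

/-- An accelerating expanding solution emanating from zero volume follows the regular orbit. -/
theorem IsFlow.exists_eq_orbit (hm : 1 < m) (hn : 1 < n) {s : ℝ → ℝ × ℝ × ℝ} (h : IsFlow m n I s)
    (hV : ∀ c > 0, ∃ t ∈ I, (s t).1 ^ m * (s t).2.1 ^ n < c)
    (hβ : ∀ t ∈ I, (s t).2.2 ^ 2 < 1) (hB : IsOrbitFunction m n B) :
    ∃ t ∈ I, (s t).1 / (s t).2.1 ∈ Ioo (0 : ℝ) 1 ∧ (s t).2.2 = B ((s t).1 / (s t).2.1) := by
  have hm' : (1 : ℝ) < m := by exact_mod_cast hm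
  have hn' : (1 : ℝ) < n := by exact_mod_cast hn
  have hpos := h.trd_pos hm hn hV hβ
  have hβ' : ∀ t ∈ I, 0 < (s t).2.2 ∧ (s t).2.2 < 1 := fun t ht =>
    ⟨hpos t ht, by nlinarith [hpos t ht, hβ t ht]⟩
  have hz0 : ∀ t ∈ I, 0 < (s t).1 / (s t).2.1 := fun t ht => div_pos (h.mem t ht).1 (h.mem t ht).2
  obtain ⟨t₀, ht₀, hz₀⟩ := h.exists_ratio_lt_one hm hn hV hβ
  -- Any bound below `1` would do in place of `1/2`; it keeps `z` where `orbitRhs` is uniformly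
  -- Lipschitz in `β`.
  obtain ⟨t₁, ht₁, -, hz₁⟩ := h.exists_ratio_lt hm hn hV hβ' ht₀ hz₀ (one_half_pos (α := ℝ))
  have hz₁' : (s t₁).1 / (s t₁).2.1 < 1 := by linarith
  have hmono := h.strictMonoOn_ratio hm hn hβ' ht₁ hz₁'
  have hmem₁ : t₁ ∈ I ∩ Iic t₁ := ⟨ht₁, self_mem_Iic⟩
  have hz : ∀ t ∈ I ∩ Iic t₁, (s t).1 / (s t).2.1 ∈ Ioo (0 : ℝ) 1 ∧
      (s t).1 / (s t).2.1 ≤ 1 / 2 := fun t ht => by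
    have := hmono.monotoneOn ht hmem₁ ht.2
    exact ⟨⟨hz0 t ht.1, by linarith⟩, by linarith⟩
  refine ⟨t₁, ht₁, (hz t₁ hmem₁).1, ?_⟩
  obtain ⟨Λ, hΛ⟩ := orbitRhs_lipschitz hm' hn' one_half_lt_one
  -- the difference of the two orbits, suitably weighted
  have hd : ∀ t ∈ I ∩ Iic t₁, HasDerivAt (fun t => ((s t).1 / (s t).2.1) ^ m *
      ((s t).2.2 - B ((s t).1 / (s t).2.1)))
      ((orbitX m n ((s t).1 / (s t).2.1) (s t).2.2 - (s t).2.2 * ((s t).1 / (s t).2.1)) / (s t).2.1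
        * (((s t).1 / (s t).2.1) ^ m * (orbitRhs m n ((s t).1 / (s t).2.1) (s t).2.2 -
        orbitRhs m n ((s t).1 / (s t).2.1) (B ((s t).1 / (s t).2.1))))) t := by
    intro t ht
    have ha := (h.mem t ht.1).1
    have hb := (h.mem t ht.1).2
    have hzt := (hz t ht).1
    have h1 := h.hasDerivAt_ratio ht.1
    have h2 := (hB.deriv _ hzt).comp t h1
    refine ((h1.fun_pow m).fun_mul ((h.hasDerivAt_trd ht.1).fun_sub h2)).congr_deriv ?_
    have hy := orbit_sub_pos hm' hn' hzt.1 hzt.2.le (hβ' t ht.1).1 (hβ' t ht.1).2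
    have hsub := orbitX_sub hm' hn' ((s t).1 / (s t).2.1) (s t).2.2
    have hR : orbitRhs m n ((s t).1 / (s t).2.1) (s t).2.2 *
        (orbitX m n ((s t).1 / (s t).2.1) (s t).2.2 - (s t).2.2 * ((s t).1 / (s t).2.1)) =
        (m + n - 1) * (1 - (s t).2.2 ^ 2) := by
      have hm1 : (m : ℝ) - 1 ≠ 0 := by linarith
      rw [orbitRhs, ← hsub, div_mul_eq_mul_div, div_eq_iff (mul_ne_zero hm1 hy.ne')]
      ring
    have hpow : ((s t).1 / (s t).2.1) ^ m = ((s t).1 / (s t).2.1) ^ (m - 1) *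
        ((s t).1 / (s t).2.1) := (pow_sub_one_mul (by omega) _).symm
    have e : orbitX m n ((s t).1 / (s t).2.1) (s t).2.2 * (s t).2.1 / (s t).1 =
        orbitX m n ((s t).1 / (s t).2.1) (s t).2.2 / ((s t).1 / (s t).2.1) := by field_simp
    rw [hpow, mul_assoc (m : ℝ) (orbitX _ _ _ _), mul_div_assoc (m : ℝ), e]
    simp only [Function.comp]
    have hz0 := hzt.1.ne'
    generalize orbitX m n ((s t).1 / (s t).2.1) (s t).2.2 = x at *
    generalize orbitRhs m n ((s t).1 / (s t).2.1) (s t).2.2 = R at *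
    generalize orbitRhs m n ((s t).1 / (s t).2.1) (B ((s t).1 / (s t).2.1)) = R' at *
    generalize B ((s t).1 / (s t).2.1) = β' at *
    generalize (s t).1 / (s t).2.1 = z at *
    generalize (s t).2.2 = β at *
    generalize z ^ (m - 1) = w at *
    field_simp
    linear_combination -w * z * hR
  -- Grönwall with `z` as the independent variable. The weight `z ^ m` removes the singular term `m
  -- β / z`. Going back in time the expression cannot decrease, yet it is at most `z`, which becomes
  -- arbitrarily small.
  have hanti : AntitoneOn (fun t => (((s t).1 / (s t).2.1) ^ m *
      ((s t).2.2 - B ((s t).1 / (s t).2.1))) ^ 2 *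
        Real.exp (-(2 * Λ * ((s t).1 / (s t).2.1)))) (I ∩ Iic t₁) := by
    have hd' := fun t ht => ((hd t ht).fun_pow 2).fun_mul
      (((h.hasDerivAt_ratio ht.1).const_mul (2 * (Λ : ℝ))).fun_neg.exp)
    refine antitoneOn_of_deriv_nonpos (h.ordConnected.convex.inter (convex_Iic t₁))
      (fun t ht => (hd' t ht).continuousAt.continuousWithinAt)
      (fun t ht => (hd' t (interior_subset ht)).differentiableAt.differentiableWithinAt)
      fun t ht => ?_
    have ht := interior_subset ht
    have hb := (h.mem t ht.1).2
    have hzt := hz t ht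
    have hy := orbit_sub_pos hm' hn' hzt.1.1 hzt.1.2.le (hβ' t ht.1).1 (hβ' t ht.1).2
    have hlip := (hΛ _ ⟨hzt.1.1.le, hzt.2⟩).dist_le_mul (s t).2.2 ⟨(hβ' t ht.1).1.le,
      (hβ' t ht.1).2.le⟩ (B ((s t).1 / (s t).2.1)) ⟨(hB.pos _ hzt.1).le, (hB.lt_one _ hzt.1).le⟩
    rw [Real.dist_eq, Real.dist_eq] at hlip
    rw [(hd' t ht).deriv]
    have hv := div_pos hy hb
    generalize (orbitX m n ((s t).1 / (s t).2.1) (s t).2.2 -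
      (s t).2.2 * ((s t).1 / (s t).2.1)) / (s t).2.1 = v at *
    generalize orbitRhs m n ((s t).1 / (s t).2.1) (s t).2.2 -
      orbitRhs m n ((s t).1 / (s t).2.1) (B ((s t).1 / (s t).2.1)) = R at *
    generalize (s t).2.2 - B ((s t).1 / (s t).2.1) = w at *
    have hE := Real.exp_pos (-(2 * Λ * ((s t).1 / (s t).2.1)))
    generalize Real.exp (-(2 * Λ * ((s t).1 / (s t).2.1))) = E at *
    have hzm := pow_pos hzt.1.1 m
    generalize ((s t).1 / (s t).2.1) ^ m = Z at *
    have hwR : w * R ≤ Λ * w ^ 2 := by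
      calc w * R ≤ |w * R| := le_abs_self _
        _ = |w| * |R| := abs_mul _ _
        _ ≤ |w| * (Λ * |w|) := mul_le_mul_of_nonneg_left hlip (abs_nonneg _)
        _ = Λ * w ^ 2 := by rw [← sq_abs w]; ring
    have : ((2 : ℕ) : ℝ) * (Z * w) ^ (2 - 1) * (v * (Z * R)) * E +
        (Z * w) ^ 2 * (E * -(2 * Λ * v)) = -(2 * v * Z ^ 2 * E) * (Λ * w ^ 2 - w * R) := by
      push_cast
      ring
    rw [this]
    exact mul_nonpos_of_nonpos_of_nonneg (neg_nonpos.mpr (by positivity)) (by linarith)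
  by_contra hne
  have hG : 0 < (((s t₁).1 / (s t₁).2.1) ^ m * ((s t₁).2.2 - B ((s t₁).1 / (s t₁).2.1))) ^ 2 *
      Real.exp (-(2 * Λ * ((s t₁).1 / (s t₁).2.1))) := by
    have h1 := pow_pos (hz t₁ hmem₁).1.1 m
    have h2 : (s t₁).2.2 - B ((s t₁).1 / (s t₁).2.1) ≠ 0 := sub_ne_zero.mpr hne
    positivity
  obtain ⟨t, ht, htt, hlt⟩ := h.exists_ratio_lt hm hn hV hβ' ht₁ hz₁' hG
  have h1 := hanti ⟨ht, htt⟩ hmem₁ htt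
  have hzt := (hz t ⟨ht, htt⟩).1
  have h2 : (((s t).1 / (s t).2.1) ^ m * ((s t).2.2 - B ((s t).1 / (s t).2.1))) ^ 2 *
      Real.exp (-(2 * Λ * ((s t).1 / (s t).2.1))) ≤ (s t).1 / (s t).2.1 := by
    have h3 : ((s t).2.2 - B ((s t).1 / (s t).2.1)) ^ 2 ≤ 1 := by
      have := hB.pos _ hzt
      have := hB.lt_one _ hzt
      have := hβ' t ht
      rw [sq_le_one_iff_abs_le_one, abs_le]
      constructor <;> linarith
    have h4 : Real.exp (-(2 * Λ * ((s t).1 / (s t).2.1))) ≤ 1 := by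
      rw [Real.exp_le_one_iff, neg_nonpos]
      have := hzt.1
      positivity
    have h5 : (((s t).1 / (s t).2.1) ^ m) ^ 2 ≤ (s t).1 / (s t).2.1 := by
      rw [← pow_mul]
      exact pow_le_of_le_one hzt.1.le hzt.2.le (by omega)
    rw [mul_pow]
    have h6 := hzt.1
    calc _ ≤ (((s t).1 / (s t).2.1) ^ m) ^ 2 * 1 * 1 := by gcongr
      _ ≤ _ := by linarith
  simp only at h1
  linarith

/-- The regular solution is inextendible. -/
theorem IsRegularFlow.isMaxSol (hm : 1 < m) (hn : 1 < n) {s : ℝ → ℝ × ℝ × ℝ}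
    (h : IsRegularFlow m n B s) :
    IsMaxSol m n (Ioi 0) (fun t => (s t).1) (fun t => (s t).2.1) := by
  refine ⟨h.flow.isSol hm hn, fun I' a' b' h' hI ha _ => ?_⟩
  refine Subset.antisymm (fun t ht => ?_) hI
  by_contra hneg
  -- A proper extension would contain `0`, where its first scale factor would be positive, whereas
  -- `a → 0` as `t ↘ 0`.
  have h0 : (0 : ℝ) ∈ I' := h'.ordConnected.out ht (hI (mem_Ioi.mpr one_pos))
    ⟨not_lt.mp hneg, zero_le_one⟩
  have h1 : Tendsto a' (𝓝[>] 0) (𝓝 (a' 0)) :=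
    ((differentiableAt_of_smooth h'.isOpen h'.smooth_a h0).continuousAt).tendsto.mono_left
      nhdsWithin_le_nhds
  have h2 : Tendsto a' (𝓝[>] 0) (𝓝 0) :=
    h.fst_zero.congr' (by filter_upwards [self_mem_nhdsWithin] with t ht using (ha ht).symm)
  exact (h'.pos_a 0 h0).ne' (tendsto_nhds_unique h1 h2)

lemma deriv_comp_affine {f : ℝ → ℝ} {μ c t : ℝ} (hf : DifferentiableAt ℝ f (μ * t + c)) (l : ℝ) :
    deriv (fun t => l * f (μ * t + c)) t = l * (deriv f (μ * t + c) * μ) :=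
  ((hf.hasDerivAt.comp t (((hasDerivAt_id t).const_mul μ).add_const c)).const_mul l).deriv.trans
    (by simp)

lemma IsSol.expansion_comp_affine {a b : ℝ → ℝ} (h : IsSol m n I a b) {μ : ℝ} (hμ : μ ≠ 0) {c t : ℝ}
    (ht : μ * t + c ∈ I) : expansion m n (fun t => |μ|⁻¹ * a (μ * t + c))
      (fun t => |μ|⁻¹ * b (μ * t + c)) t = μ * expansion m n a b (μ * t + c) := by
  have ha := (h.pos_a _ ht).ne'
  have hb := (h.pos_b _ ht).ne'
  have h0 : |μ| ≠ 0 := abs_ne_zero.mpr hμ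
  rw [expansion, expansion, deriv_comp_affine (differentiableAt_of_smooth h.isOpen h.smooth_a ht),
    deriv_comp_affine (differentiableAt_of_smooth h.isOpen h.smooth_b ht)]
  field_simp

lemma IsSol.deriv_comp_affine_sq {a b : ℝ → ℝ} (h : IsSol m n I a b) {μ : ℝ} (hμ : μ ≠ 0) {c t : ℝ}
    (ht : μ * t + c ∈ I) :
    deriv (fun t => |μ|⁻¹ * b (μ * t + c)) t ^ 2 = deriv b (μ * t + c) ^ 2 := by
  rw [deriv_comp_affine (differentiableAt_of_smooth h.isOpen h.smooth_b ht), mul_pow, mul_pow,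
    inv_pow, sq_abs]
  field_simp

/-- A maximal accelerating expanding solution is the regular solution, up to scale and translation
of time. -/
theorem IsMaxSol.eq_regular_of_expanding (hm : 1 < m) (hn : 1 < n) {a b : ℝ → ℝ}
    (h : IsMaxSol m n I a b) (hS : ∀ t ∈ I, 0 < expansion m n a b t)
    (hβ : ∀ t ∈ I, deriv b t ^ 2 < 1) {s : ℝ → ℝ × ℝ × ℝ} (hs : IsRegularFlow m n B s) :
    ∃ μ c : ℝ, μ ≠ 0 ∧ (fun t => μ * t + c) ⁻¹' I = Ioi 0 ∧ ∀ t ∈ Ioi (0 : ℝ),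
      |μ|⁻¹ * a (μ * t + c) = (s t).1 ∧ |μ|⁻¹ * b (μ * t + c) = (s t).2.1 := by
  obtain ⟨t₁, ht₁, hz₁, hβ₁⟩ := (h.isSol.isFlow hm hn hS).exists_eq_orbit hm hn
    (fun c hc => h.exists_volume_lt hm hn hS hc) hβ hs.orbit
  simp only at hz₁ hβ₁
  obtain ⟨t₂, ht₂, hz₂⟩ := hs.surj _ hz₁
  have ha := h.isSol.pos_a t₁ ht₁
  have hb := h.isSol.pos_b t₁ ht₁
  have ha₂ := (hs.flow.mem t₂ ht₂).1
  have hb₂ := (hs.flow.mem t₂ ht₂).2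
  -- `z` and `ḃ` are invariant under rescaling and already agree. Matching `b` fixes the scale, and
  -- then `a` matches too.
  obtain ⟨μ, hμ⟩ : ∃ μ, μ = b t₁ / (s t₂).2.1 := ⟨_, rfl⟩
  have hμ0 : 0 < μ := hμ ▸ by positivity
  obtain ⟨c, hc⟩ : ∃ c, c = t₁ - μ * t₂ := ⟨_, rfl⟩
  have hct : μ * t₂ + c = t₁ := by rw [hc]; ring
  have h' := h.comp_affine hμ0.ne' c
  have hF := h'.isSol.isFlow hm hn fun t ht => by
    have h1 := h.isSol.expansion_comp_affine hμ0.ne' (c := c) ht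
    rw [expansion] at h1
    rw [h1]
    exact mul_pos hμ0 (hS _ ht)
  have hmem : t₂ ∈ (fun t => μ * t + c) ⁻¹' I := by rwa [mem_preimage, hct]
  have heq : (|μ|⁻¹ * a (μ * t₂ + c), |μ|⁻¹ * b (μ * t₂ + c),
      deriv (fun t => |μ|⁻¹ * b (μ * t + c)) t₂) = s t₂ := by
    rw [deriv_comp_affine (differentiableAt_of_smooth h.isSol.isOpen h.isSol.smooth_b hmem), hct,
      abs_of_pos hμ0]
    refine Prod.ext ?_ (Prod.ext ?_ ?_)
    · rw [hμ]
      field_simp at hz₂ ⊢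
      linarith
    · rw [hμ]
      field_simp
    · rw [hs.eq_orbit t₂ ht₂, hz₂, ← hβ₁]
      field_simp
  obtain ⟨r, hr, hr1, hr2⟩ := hF.exists_union hm hn hs.flow ⟨hmem, ht₂⟩ heq
  have hrsol := hr.isSol hm hn
  have e1 := h'.maximal _ _ _ hrsol subset_union_left (fun t ht => by simp only [hr1 ht])
    (fun t ht => by simp only [hr1 ht])
  have e2 := (hs.isMaxSol hm hn).maximal _ _ _ hrsol subset_union_right
    (fun t ht => by simp only [hr2 ht]) (fun t ht => by simp only [hr2 ht])
  have e3 := e1.symm.trans e2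
  refine ⟨μ, c, hμ0.ne', e3, fun t ht => ?_⟩
  have h1 := hr1 (e3.symm.subset ht)
  rw [hr2 ht] at h1
  rw [h1]
  exact ⟨rfl, rfl⟩

/-- A maximal accelerating solution is the regular solution, up to scale, translation and reversal
of time. -/
theorem IsMaxSol.eq_regular (hm : 1 < m) (hn : 1 < n) {a b : ℝ → ℝ}
    (h : IsMaxSol m n I a b) (hβ : ∀ t ∈ I, deriv b t ^ 2 < 1) {s : ℝ → ℝ × ℝ × ℝ}
    (hs : IsRegularFlow m n B s) :
    ∃ μ c : ℝ, μ ≠ 0 ∧ (fun t => μ * t + c) ⁻¹' I = Ioi 0 ∧ ∀ t ∈ Ioi (0 : ℝ),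
      |μ|⁻¹ * a (μ * t + c) = (s t).1 ∧ |μ|⁻¹ * b (μ * t + c) = (s t).2.1 := by
  rcases h.isSol.expansion_pos_or_neg hm hn with hS | hS
  · exact h.eq_regular_of_expanding hm hn hS hβ hs
  have h1 : (-1 : ℝ) ≠ 0 := by norm_num
  obtain ⟨μ, c, hμ, hI, hab⟩ := (h.comp_affine h1 0).eq_regular_of_expanding hm hn
    (fun t ht => by
      rw [h.isSol.expansion_comp_affine h1 ht]
      linarith [hS _ ht])
    (fun t ht => by
      rw [h.isSol.deriv_comp_affine_sq h1 ht]
      exact hβ _ ht) hs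
  have e : ∀ t : ℝ, -1 * (μ * t + c) + 0 = -μ * t + -c := fun t => by ring
  simp only [e, abs_neg, abs_one, inv_one, one_mul, preimage_preimage] at hI hab
  refine ⟨-μ, -c, neg_ne_zero.mpr hμ, hI, fun t ht => ?_⟩
  rw [abs_neg]
  exact hab t ht

/-- The reductions of two solutions related by an affine change of time are related by an affine
change of time. -/
theorem IsReduction.comp_affine {a b a' b' : ℝ → ℝ} {I' J J' : Set ℝ} {α Φ α' Φ' : ℝ → ℝ}
    (h : IsSol m n I a b) (hr : IsReduction m n I a b J α Φ)
    (hr' : IsReduction m n I' a' b' J' α' Φ') {μ c : ℝ} (hμ : μ ≠ 0)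
    (hI : (fun t => μ * t + c) ⁻¹' I' = I) (ha : ∀ t ∈ I, |μ|⁻¹ * a' (μ * t + c) = a t)
    (hb : ∀ t ∈ I, |μ|⁻¹ * b' (μ * t + c) = b t) :
    ∃ μ c k : ℝ, μ ≠ 0 ∧ J' = (fun s => μ * s + c) '' J ∧
      ∀ s ∈ J, α' (μ * s + c) = |μ| * α s ∧ Φ' (μ * s + c) = Φ s + k := by
  obtain ⟨T, hT, hd⟩ := hr
  obtain ⟨T', hT', hd'⟩ := hr'
  obtain ⟨k, hk⟩ : ∃ k : ℝ, k = (n : ℝ) / (m - 1) := ⟨_, rfl⟩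
  simp only [← hk] at hd hd'
  have habs : 0 < |μ| := abs_pos.mpr hμ
  have hmem : ∀ t ∈ I, μ * t + c ∈ I' := fun t ht => hI.symm.subset ht
  have ha' : ∀ t ∈ I, a' (μ * t + c) = |μ| * a t := fun t ht => by
    rw [← ha t ht, mul_inv_cancel_left₀ habs.ne']
  have hb' : ∀ t ∈ I, b' (μ * t + c) = |μ| * b t := fun t ht => by
    rw [← hb t ht, mul_inv_cancel_left₀ habs.ne']
  have hpk : 0 < |μ| ^ k := Real.rpow_pos_of_pos habs k
  -- The reduced time is rescaled by `μ` from the change of time and by `|μ| ^ k` from its density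
  -- `b ^ k`; the orientation is that of `μ`.
  obtain ⟨ν, hν⟩ : ∃ ν, ν = |μ| ^ k * μ := ⟨_, rfl⟩
  obtain ⟨t₀, ht₀⟩ := h.nonempty
  have hdiff : ∀ t ∈ I, HasDerivAt (fun t => T' (μ * t + c) - ν * T t) 0 t := by
    intro t ht
    have h1 := ((hd' _ (hmem t ht)).1.comp t
      (((hasDerivAt_id t).const_mul μ).add_const c)).sub ((hd t ht).1.const_mul ν)
    refine h1.congr_deriv ?_
    rw [hb' t ht, Real.mul_rpow habs.le (h.pos_b t ht).le, hν]
    ring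
  have hconst : ∀ t ∈ I, T' (μ * t + c) = ν * T t + (T' (μ * t₀ + c) - ν * T t₀) := by
    intro t ht
    have := h.isOpen.is_const_of_deriv_eq_zero (isPreconnected_iff_ordConnected.mpr h.ordConnected)
      (fun t ht => (hdiff t ht).differentiableAt.differentiableWithinAt)
      (fun t ht => (hdiff t ht).deriv) ht ht₀
    linarith
  have hνabs : |ν| = |μ| ^ k * |μ| := by rw [hν, abs_mul, abs_of_pos hpk]
  refine ⟨ν, T' (μ * t₀ + c) - ν * T t₀,
    -(√((m : ℝ) - 1) * √((m : ℝ) + n - 1) / (√(8 * Real.pi) * √(n : ℝ))) *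
      Real.log (|μ| ^ (-k)), by rw [hν]; positivity, ?_, ?_⟩
  · ext x
    constructor
    · intro hx
      obtain ⟨u, hu, rfl⟩ := hT'.surjOn hx
      have hut : μ * ((u - c) / μ) + c = u := by field_simp; ring
      have ht : (u - c) / μ ∈ I := hI.subset (by rwa [mem_preimage, hut])
      refine ⟨T ((u - c) / μ), hT.mapsTo ht, ?_⟩
      simp only
      rw [← hconst _ ht, hut]
    · rintro ⟨_, hs, rfl⟩
      obtain ⟨t, ht, rfl⟩ := hT.surjOn hs
      simp only
      rw [← hconst t ht]
      exact hT'.mapsTo (hmem t ht)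
  · intro s hs
    obtain ⟨t, ht, rfl⟩ := hT.surjOn hs
    have hbt := h.pos_b t ht
    rw [← hconst t ht]
    obtain ⟨-, h2, h3⟩ := hd' _ (hmem t ht)
    obtain ⟨-, h2', h3'⟩ := hd t ht
    rw [h2, h3, h2', h3', ha' t ht, hb' t ht, Real.mul_rpow habs.le hbt.le,
      Real.mul_rpow habs.le hbt.le, Real.log_mul (Real.rpow_pos_of_pos habs _).ne'
      (Real.rpow_pos_of_pos hbt _).ne', hνabs]
    constructor <;> ring

end Uniqueness

/-! ### Limits of the scale invariant variables -/

section ScaleInvariant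

/-- The scale invariant variables in terms of the ratio of the scale factors and of `ḃ`. -/
def orbitScaleInvariant (m n : ℝ) (p : ℝ × ℝ) : ℝ × ℝ × ℝ × ℝ :=
  (1 / (m * orbitX m n p.1 p.2 + n * (p.2 * p.1)),
    p.1 / (m * orbitX m n p.1 p.2 + n * (p.2 * p.1)),
    orbitX m n p.1 p.2 / (m * orbitX m n p.1 p.2 + n * (p.2 * p.1)),
    p.2 * p.1 / (m * orbitX m n p.1 p.2 + n * (p.2 * p.1)))

lemma orbitScaleInvariant_continuous {m n : ℝ} (hm : 1 < m) (hn : 1 < n) :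
    Continuous (orbitScaleInvariant m n) := by
  have hX := (orbitX_contDiff hm hn).continuous
  have hW : Continuous fun p : ℝ × ℝ => m * orbitX m n p.1 p.2 + n * (p.2 * p.1) := by fun_prop
  have h0 : ∀ p : ℝ × ℝ, m * orbitX m n p.1 p.2 + n * (p.2 * p.1) ≠ 0 :=
    fun p => (orbitX_expanding hm hn p.1 p.2).ne'
  exact (continuous_const.div hW h0).prodMk ((continuous_fst.div hW h0).prodMk
    ((hX.div hW h0).prodMk ((continuous_snd.mul continuous_fst).div hW h0)))

/-- At `z = β = 1` the constraint gives `ȧ = 1`, as on the cone `a = b = t`. -/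
lemma orbitScaleInvariant_one {m n : ℕ} (hm : 1 < m) (hn : 1 < n) :
    orbitScaleInvariant m n (1, 1) = pointFstar m n := by
  have hm' : (1 : ℝ) < m := by exact_mod_cast hm
  have hn' : (1 : ℝ) < n := by exact_mod_cast hn
  have hX : 1 = orbitX m n 1 1 := eq_orbitX hm' hn' (by linarith) (by ring)
  simp [orbitScaleInvariant, ← hX, pointFstar]

/-- At `z = β = 0` the constraint reduces to `ȧ² = (m + n - 1) / (m - 1)`, which produces the square
root in `F_B`. -/
lemma orbitScaleInvariant_zero {m n : ℕ} (hm : 1 < m) (hn : 1 < n) :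
    orbitScaleInvariant m n (0, 0) = pointFB m n := by
  have hm' : (1 : ℝ) < m := by exact_mod_cast hm
  have hn' : (1 : ℝ) < n := by exact_mod_cast hn
  have hm1 : (0 : ℝ) < m - 1 := by linarith
  have hK : (0 : ℝ) < m + n - 1 := by linarith
  have hx : 0 < √(((m : ℝ) + n - 1) / (m - 1)) := Real.sqrt_pos.mpr (by positivity)
  have hX : √(((m : ℝ) + n - 1) / (m - 1)) = orbitX m n 0 0 := by
    apply eq_orbitX hm' hn'
    · rw [mul_zero, mul_zero, add_zero]
      positivity
    · rw [Real.sq_sqrt (by positivity)]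
      field_simp
      ring
  have hA : √(((m : ℝ) - 1) / ((m : ℝ) ^ 2 * ((m : ℝ) + n - 1))) =
      1 / (m * √(((m : ℝ) + n - 1) / (m - 1))) := by
    rw [Real.sqrt_eq_iff_mul_self_eq (by positivity) (by positivity)]
    have hsq : √(((m : ℝ) + n - 1) / (m - 1)) ^ 2 = (m + n - 1) / (m - 1) :=
      Real.sq_sqrt (by positivity)
    rw [← pow_two, div_pow, mul_pow, hsq]
    field_simp
  rw [pointFB, hA]
  simp only [orbitScaleInvariant, ← hX, mul_zero, add_zero, zero_div]
  refine Prod.ext rfl (Prod.ext rfl (Prod.ext ?_ rfl))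
  field_simp

lemma IsFlow.scaleInvariant_eq {m n : ℕ} (hm : 1 < m) (hn : 1 < n) {I : Set ℝ}
    {s : ℝ → ℝ × ℝ × ℝ} (h : IsFlow m n I s) {t : ℝ} (ht : t ∈ I) :
    scaleInvariant m n (fun t => (s t).1) (fun t => (s t).2.1) t =
      orbitScaleInvariant m n ((s t).1 / (s t).2.1, (s t).2.2) := by
  have hm' : (1 : ℝ) < m := by exact_mod_cast hm
  have hn' : (1 : ℝ) < n := by exact_mod_cast hn
  have ha := (h.mem t ht).1
  have hb := (h.mem t ht).2
  have hW := orbitX_expanding hm' hn' ((s t).1 / (s t).2.1) (s t).2.2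
  have hH : meanCurvature m n (fun t => (s t).1) (fun t => (s t).2.1) t =
      -((m * orbitX m n ((s t).1 / (s t).2.1) (s t).2.2 +
        n * ((s t).2.2 * ((s t).1 / (s t).2.1))) / (s t).1) := by
    rw [meanCurvature, (h.hasDerivAt_fst ht).deriv, (h.hasDerivAt_snd ht).deriv]
    field_simp
    ring
  simp only [scaleInvariant, orbitScaleInvariant, hH, (h.hasDerivAt_fst ht).deriv,
    (h.hasDerivAt_snd ht).deriv]
  obtain ⟨W, hWd⟩ : ∃ W, W = m * orbitX m n ((s t).1 / (s t).2.1) (s t).2.2 +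
    n * ((s t).2.2 * ((s t).1 / (s t).2.1)) := ⟨_, rfl⟩
  rw [← hWd] at hW ⊢
  have hW' := hW.ne'
  refine Prod.ext ?_ (Prod.ext ?_ (Prod.ext ?_ ?_)) <;> simp only <;> field_simp

variable {m n : ℕ} {B : ℝ → ℝ} {s : ℝ → ℝ × ℝ × ℝ}

theorem IsRegularFlow.tendsto_atTop (hm : 1 < m) (hn : 1 < n) (h : IsRegularFlow m n B s) :
    Tendsto (scaleInvariant m n (fun t => (s t).1) (fun t => (s t).2.1)) atTop
      (𝓝 (pointFstar m n)) := by
  have hm' : (1 : ℝ) < m := by exact_mod_cast hm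
  have hn' : (1 : ℝ) < n := by exact_mod_cast hn
  rw [← orbitScaleInvariant_one hm hn]
  refine (((orbitScaleInvariant_continuous hm' hn').tendsto (1, 1)).comp
    (h.ratio_top.prodMk_nhds h.trd_top)).congr' ?_
  filter_upwards [eventually_gt_atTop 0] with t ht
  exact (h.flow.scaleInvariant_eq hm hn ht).symm

theorem IsRegularFlow.tendsto_zero (hm : 1 < m) (hn : 1 < n) (h : IsRegularFlow m n B s) :
    Tendsto (scaleInvariant m n (fun t => (s t).1) (fun t => (s t).2.1)) (𝓝[>] 0)
      (𝓝 (pointFB m n)) := by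
  have hm' : (1 : ℝ) < m := by exact_mod_cast hm
  have hn' : (1 : ℝ) < n := by exact_mod_cast hn
  rw [← orbitScaleInvariant_zero hm hn]
  have hβ : Tendsto (fun t => (s t).2.2) (𝓝[>] 0) (𝓝 0) := by
    have h1 : Tendsto (fun t => (s t).1 / (s t).2.1) (𝓝[>] 0) (𝓝[>] 0) :=
      tendsto_nhdsWithin_iff.mpr ⟨h.ratio_zero, by
        filter_upwards [self_mem_nhdsWithin] with t ht using (h.ratio_mem t ht).1⟩
    refine (h.orbit.tendsto.comp h1).congr' ?_
    filter_upwards [self_mem_nhdsWithin] with t ht using (h.eq_orbit t ht).symm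
  refine (((orbitScaleInvariant_continuous hm' hn').tendsto (0, 0)).comp
    (h.ratio_zero.prodMk_nhds hβ)).congr' ?_
  filter_upwards [self_mem_nhdsWithin] with t ht
  exact (h.flow.scaleInvariant_eq hm hn ht).symm

lemma IsRegularFlow.deriv_sq_lt_one (h : IsRegularFlow m n B s) :
    ∀ t ∈ Ioi (0 : ℝ), deriv (fun t => (s t).2.1) t ^ 2 < 1 := by
  intro t ht
  have h1 := h.orbit.pos _ (h.ratio_mem t ht)
  have h2 := h.orbit.lt_one _ (h.ratio_mem t ht)
  rw [(h.flow.hasDerivAt_snd ht).deriv, h.eq_orbit t ht]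
  nlinarith

end ScaleInvariant

end WarpedCosmology

end

/-! ### Existence and uniqueness of eternal acceleration -/

theorem mainTheorem1 (m n : ℕ) (hm : 1 < m) (hn : 1 < n) (hmn : 9 ≤ m + n)
    (hne : (m, n) ≠ (2, 7))
    {M : Type*} [TopologicalSpace M] [ChartedSpace (EuclideanSpace ℝ (Fin m)) M]
    [IsManifold 𝓘(ℝ, EuclideanSpace ℝ (Fin m)) ∞ M] [Nonempty M]
    {N : Type*} [TopologicalSpace N] [ChartedSpace (EuclideanSpace ℝ (Fin n)) N]
    [IsManifold 𝓘(ℝ, EuclideanSpace ℝ (Fin n)) ∞ N] [Nonempty N]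
    (g : WarpedCosmology.SmoothMetric m M) (h : WarpedCosmology.SmoothMetric n N)
    (hg : WarpedCosmology.IsEinstein g (-((m : ℝ) + n - 1)))
    (hh : WarpedCosmology.IsEinstein h (-((m : ℝ) + n - 1))) :
    ∃ (a b : ℝ → ℝ) (J : Set ℝ) (α Φ : ℝ → ℝ),
      WarpedCosmology.IsMaximalVacuum g h (Ioi 0) a b ∧
      WarpedCosmology.IsReduction m n (Ioi 0) a b J α Φ ∧
      WarpedCosmology.IsEinsteinScalar n g J α Φ ∧
      WarpedCosmology.EternallyAccelerating J α ∧
      Tendsto (WarpedCosmology.scaleInvariant m n a b) atTop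
        (𝓝 (WarpedCosmology.pointFstar m n)) ∧
      Tendsto (WarpedCosmology.scaleInvariant m n a b) (𝓝[>] 0)
        (𝓝 (WarpedCosmology.pointFB m n)) ∧
      ∀ (I' : Set ℝ) (a' b' : ℝ → ℝ) (J' : Set ℝ) (α' Φ' : ℝ → ℝ),
        WarpedCosmology.IsMaximalVacuum g h I' a' b' →
        WarpedCosmology.IsReduction m n I' a' b' J' α' Φ' →
        WarpedCosmology.EternallyAccelerating J' α' →
        ∃ μ c k : ℝ, μ ≠ 0 ∧ J' = (fun s => μ * s + c) '' J ∧
          ∀ s ∈ J, α' (μ * s + c) = |μ| * α s ∧ Φ' (μ * s + c) = Φ s + k := by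
  obtain ⟨B, s, hs⟩ := WarpedCosmology.exists_isRegularFlow hm hn hmn hne
  have hmax := hs.isMaxSol hm hn
  obtain ⟨J, α, Φ, hr⟩ := WarpedCosmology.exists_isReduction hmax.isSol
  refine ⟨_, _, J, α, Φ, (WarpedCosmology.isMaximalVacuum_iff hm hn hg hh).mpr hmax, hr,
    hr.isEinsteinScalar hm hn hg hmax.isSol,
    (hr.accelerating_iff hm hn hmax.isSol).mpr hs.deriv_sq_lt_one, hs.tendsto_atTop hm hn,
    hs.tendsto_zero hm hn, fun I' a' b' J' α' Φ' hmax' hr' hacc => ?_⟩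
  have h' := (WarpedCosmology.isMaximalVacuum_iff hm hn hg hh).mp hmax'
  obtain ⟨μ, c, hμ, hI, hab⟩ := h'.eq_regular hm hn
    ((hr'.accelerating_iff hm hn h'.isSol).mp hacc) hs
  exact hr.comp_affine hmax.isSol hr' hμ hI (fun t ht => (hab t ht).1) fun t ht => (hab t ht).2
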